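/- Let $n\ge 3$ and let $M$ be a compact $n$-dimensional orbifold with exactly one singular point $(\check p,\Gamma)$. That is: $M$ is a compact Hausdorff space, $M\setminus\{\check p\}$ is a smooth $n$-manifold, $\Gamma\subset O(n)$ is a nontrivial finite subgroup acting freely on $\mathbf R^n\setminus\{0\}$, and there is given a homeomorphism $\phi:U\to \mathbf B_\tau(0)/\Gamma$ from an open neighborhood $U$ of $\check p$, with $\phi(\check p)=0$, which restricts to a diffeomorphism $U\setminus\{\check p\}\to(\mathbf B_\tau(0)\setminus\{0\})/\Gamma$. For any $\tau>0$ let $\pi:\mathbf B_\tau(0)\to\mathbf B_\tau(0)/\Gamma$ be the projection. A Riemannian metric $g$ on $M\setminus\{\check p\}$ is an *orbifold metric* if $(\phi^{-1}\circ\pi)^*g$ is the restriction to $\mathbf B_\tau(0)\setminus\{0\}$ of a $\Gamma$-invariant smooth metric on $\mathbf B_\tau(0)$. The *orbifold conformal class* $[g]_{\rm orb}$ of an orbifold metric $g$ is the set of orbifold metrics $e^{2f}g$ with $f\in C^0(M)\cap C^\infty(M\setminus\{\check p\})$ and $f\circ\phi^{-1}\circ\pi\in C^\infty(\mathbf B_\tau(0))$.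 The *orbifold Yamabe invariant* is $$Y^{\rm orb}(M)=\sup_{g}\ \inf_{\tilde g\in[g]_{\rm orb}}\frac{\int_M R_{\tilde g}\,d\sigma_{\tilde g}}{\mathrm{Vol}_{\tilde g}(M)^{(n-2)/n}},$$ where $g$ runs over all orbifold metrics, and $R_{\tilde g}$ and $d\sigma_{\tilde g}$ denote the scalar curvature and the volume measure. A homeomorphism $\tilde\phi:V\to\mathbf B_{\tilde\tau}(0)/\Gamma$ with the same properties as $\phi$ is *compatible* if, for some $0<\hat\tau\le\tau$, there is a $\Gamma$-equivariant diffeomorphism $\Phi$ from $\mathbf B_{\hat\tau}(0)$ onto an open subset of $\mathbf B_{\tilde\tau}(0)$ with $\tilde\phi\circ\phi^{-1}\circ\pi=\pi\circ\Phi$ on $\mathbf B_{\hat\tau}(0)\setminus\{0\}$. Let $h_\Gamma$ be the metric of constant curvature one on $S^{n-1}/\Gamma$ induced by the round metric of $S^{n-1}$. A *cylindrical metric modeled by $(S^{n-1}/\Gamma,h_\Gamma)$* is a (complete) Riemannian metric $\bar g$ on $M\setminus\{\check p\}$ such that, for some open neighborhood $V\subset U$ of $\check p$ and some coordinates $(z,t)\in(S^{n-1}/\Gamma)\times(0,\infty)\cong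 V\setminus\{\check p\}$ compatible with the orbifold structure, $\bar g=h_\Gamma+dt^2$ on $\{t\ge1\}$. Here the coordinates are called compatible with the orbifold structure if the map $V\to\mathbf B_1(0)/\Gamma$ given by $(z,t)\mapsto e^{-t}z$, $\check p\mapsto 0$, is a compatible homeomorphism as above. With $\alpha_n=\frac{4(n-1)}{n-2}$, the *$h_\Gamma$-cylindrical Yamabe invariant* is $$Y^{h_\Gamma\text{-}cyl}(M\setminus\{\check p\})=\sup_{\bar g}\ \inf_{\substack{u\in C_c^\infty(M\setminus\{\check p\})\\ u\not\equiv0}}\frac{\int_{M\setminus\{\check p\}}\left(\alpha_n|du|_{\bar g}^2+R_{\bar g}u^2\right)d\sigma_{\bar g}}{\left(\int_{M\setminus\{\check p\}}|u|^{\frac{2n}{n-2}}d\sigma_{\bar g}\right)^{\frac{n-2}{n}}},$$ where $\bar g$ runs over all cylindrical metrics modeled by $(S^{n-1}/\Gamma,h_\Gamma)$. **Theorem.** $Y^{\rm orb}(M)=Y^{h_\Gamma\text{-}cyl}(M\setminus\{\check p\})$. -/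

import Mathlib

open scoped Manifold ContDiff

noncomputable section

namespace OrbifoldYamabe

/-- Euclidean space `ℝⁿ`. -/
abbrev E (n : ℕ) : Type := EuclideanSpace ℝ (Fin n)

/-- The `i`-th standard basis vector of `ℝⁿ`. -/
def stdVec {n : ℕ} (i : Fin n) : E n := EuclideanSpace.single i (1 : ℝ)

/-! ### Riemannian geometry in coordinates

A Riemannian metric on an open subset of `ℝⁿ` is described by its matrix of coefficients
`G y i j = g_{ij}(y)`. -/

/-- The partial derivative `∂_i f` at `y`. -/
def partialDeriv {n : ℕ} (i : Fin n) (f : E n → ℝ) (y : E n) : ℝ := fderiv ℝ f y (stdVec i)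

/-- The Christoffel symbol
`Γ^k_{ij} = ½ ∑_l g^{kl} (∂_i g_{jl} + ∂_j g_{il} - ∂_l g_{ij})`. -/
def christoffel {n : ℕ} (G : E n → Matrix (Fin n) (Fin n) ℝ) (k i j : Fin n) (y : E n) : ℝ :=
  (1 / 2 : ℝ) * ∑ l, (G y)⁻¹ k l *
    (partialDeriv i (fun y' => G y' j l) y + partialDeriv j (fun y' => G y' i l) y
      - partialDeriv l (fun y' => G y' i j) y)

/-- The Ricci tensor
`R_{jk} = ∑_i (∂_i Γ^i_{jk} - ∂_j Γ^i_{ik}) + ∑_{i,m} (Γ^i_{im} Γ^m_{jk} - Γ^i_{jm} Γ^m_{ik})`. -/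
def ricci {n : ℕ} (G : E n → Matrix (Fin n) (Fin n) ℝ) (j k : Fin n) (y : E n) : ℝ :=
  (∑ i, (partialDeriv i (christoffel G i j k) y - partialDeriv j (christoffel G i i k) y))
    + ∑ i, ∑ m, (christoffel G i i m y * christoffel G m j k y
        - christoffel G i j m y * christoffel G m i k y)

/-- The scalar curvature `∑_{j,k} g^{jk} R_{jk}`. -/
def scalarCoord {n : ℕ} (G : E n → Matrix (Fin n) (Fin n) ℝ) (y : E n) : ℝ :=
  ∑ j, ∑ k, (G y)⁻¹ j k * ricci G j k y

section Manifold

variable {n : ℕ} {X : Type*} [TopologicalSpace X] [ChartedSpace (E n) X]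
  [IsManifold 𝓘(ℝ, E n) ∞ X]

variable (n X) in
/-- `Riem(X)`: smooth Riemannian metrics on the smooth `n`-manifold `X`. -/
abbrev Metric : Type _ :=
  Bundle.ContMDiffRiemannianMetric 𝓘(ℝ, E n) ∞ (E n)
    (fun x : X => TangentSpace 𝓘(ℝ, E n) x)

/-- The pull-back `(ψ^* g)_y (v, w) = g_{ψ(y)} (dψ_y v, dψ_y w)`, for `ψ` defined near `y` in a
normed space `F`. -/
def pullback {F : Type*} [NormedAddCommGroup F] [NormedSpace ℝ F]
    (g : Metric n X) (ψ : F → X) (y v w : F) : ℝ :=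
  g.inner (ψ y) (mfderiv 𝓘(ℝ, F) 𝓘(ℝ, E n) ψ y v) (mfderiv 𝓘(ℝ, F) 𝓘(ℝ, E n) ψ y w)

/-- The coefficients `g_{ij}` of `g` in the preferred chart at `x`. -/
def coeff (g : Metric n X) (x : X) (y : E n) : Matrix (Fin n) (Fin n) ℝ :=
  Matrix.of fun i j => pullback g (chartAt (E n) x).symm y (stdVec i) (stdVec j)

/-- The scalar curvature `R_g`. -/
def scalarCurvature (g : Metric n X) (x : X) : ℝ :=
  scalarCoord (coeff g x) (chartAt (E n) x x)

/-- `|du|²_g = ∑_{i,j} g^{ij} ∂_i u ∂_j u`. -/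
def gradSq (g : Metric n X) (u : X → ℝ) (x : X) : ℝ :=
  ∑ i, ∑ j, (coeff g x (chartAt (E n) x x))⁻¹ i j
    * partialDeriv i (fun y => u ((chartAt (E n) x).symm y)) (chartAt (E n) x x)
    * partialDeriv j (fun y => u ((chartAt (E n) x).symm y)) (chartAt (E n) x x)

variable [MeasurableSpace X] [BorelSpace X]

/-- The Riemannian volume on the domain of the preferred chart at `x` (zero elsewhere): the image of
`√(det g_{ij}) dy` under the inverse of the chart. -/
def chartVolume (g : Metric n X) (x : X) : MeasureTheory.Measure X :=
  ((MeasureTheory.volume.restrict (chartAt (E n) x).target).withDensity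
    (fun y => ENNReal.ofReal (Real.sqrt (coeff g x y).det))).map (chartAt (E n) x).symm

/-- The Riemannian volume measure `dσ_g`. It is the smallest measure that dominates all the
`chartVolume`s; since these agree on overlaps of charts, its restriction to each chart domain is the
`chartVolume` (for `X` second countable). -/
def vol (g : Metric n X) : MeasureTheory.Measure X := ⨆ x : X, chartVolume g x

/-- The normalized Einstein-Hilbert functional `I(g) = ∫ R_g dσ_g / Vol(g)^{(n-2)/n}`. -/
def einsteinHilbert (g : Metric n X) : ℝ :=
  (∫ x, scalarCurvature g x ∂(vol g)) / (vol g).real Set.univ ^ (((n : ℝ) - 2) / n)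

/-- The Yamabe functional
`Q_g(u) = ∫ (α_n |du|² + R_g u²) dσ_g / (∫ |u|^{2n/(n-2)} dσ_g)^{(n-2)/n}`, where
`α_n = 4(n-1)/(n-2)`. -/
def yamabeQ (g : Metric n X) (u : X → ℝ) : ℝ :=
  (∫ x, (4 * ((n : ℝ) - 1) / ((n : ℝ) - 2) * gradSq g u x + scalarCurvature g x * u x ^ 2) ∂(vol g))
    / (∫ x, |u x| ^ (2 * (n : ℝ) / ((n : ℝ) - 2)) ∂(vol g)) ^ (((n : ℝ) - 2) / n)

/-- `Y^{cyl}_{[g]}(X) = inf Q_g(u)` over nonzero `u ∈ C_c^∞(X)`, as an extended real number. -/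
def cylYamabeConst (g : Metric n X) : EReal :=
  ⨅ u ∈ {u : X → ℝ | ContMDiff 𝓘(ℝ, E n) 𝓘(ℝ, ℝ) ∞ u ∧ HasCompactSupport u ∧ u ≠ 0},
    ((yamabeQ g u : ℝ) : EReal)

end Manifold

/-! ### Orbifolds with one isolated singularity -/

section Orbifold

variable {n : ℕ}

/-- The groups `Γ` that occur as structure groups: nontrivial finite subgroups of `O(n)` (linear
isometries of `ℝⁿ`) acting freely on `ℝⁿ \ {0}`. -/
structure IsStructureGroup (Γ : Subgroup (E n ≃ₗᵢ[ℝ] E n)) : Prop where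
  finite : Finite Γ
  nontrivial : Nontrivial Γ
  free : ∀ γ ∈ Γ, ∀ x : E n, x ≠ 0 → γ x = x → γ = 1

/-- Two points of `ℝⁿ` are equivalent if they lie in the same `Γ`-orbit. -/
def orbitSetoid (Γ : Subgroup (E n ≃ₗᵢ[ℝ] E n)) : Setoid (E n) where
  r x y := ∃ γ ∈ Γ, γ x = y
  iseqv :=
    { refl := fun _ => ⟨1, Γ.one_mem, rfl⟩
      symm := by
        rintro x y ⟨γ, hγ, rfl⟩
        exact ⟨γ⁻¹, Γ.inv_mem hγ, γ.symm_apply_apply x⟩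
      trans := by
        rintro x y z ⟨γ, hγ, rfl⟩ ⟨δ, hδ, rfl⟩
        exact ⟨δ * γ, Γ.mul_mem hδ hγ, rfl⟩ }

/-- The orbit space `ℝⁿ/Γ`, with the quotient topology. -/
abbrev OrbitSpace (Γ : Subgroup (E n ≃ₗᵢ[ℝ] E n)) : Type := Quotient (orbitSetoid Γ)

/-- The canonical projection `π : ℝⁿ → ℝⁿ/Γ`. -/
def proj (Γ : Subgroup (E n ≃ₗᵢ[ℝ] E n)) (x : E n) : OrbitSpace Γ := Quotient.mk (orbitSetoid Γ) x

/-- The open ball `B_τ(0)` without its centre. -/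
def puncturedBall (n : ℕ) (τ : ℝ) : Set (E n) := Metric.ball 0 τ \ {0}

/-- `M \ {p}`. -/
abbrev Punctured (M : Type*) (p : M) : Type _ := {x : M // x ≠ p}

variable {M : Type*} [TopologicalSpace M] {p : M} [ChartedSpace (E n) (Punctured M p)]

/-- A local uniformization of `(p, Γ)`: a homeomorphism `φ : U → B_τ(0)/Γ` from an open
neighbourhood `U = φ.source` of `p` with `φ(p) = [0]`, that restricts to a diffeomorphism
`U \ {p} → (B_τ(0) \ {0})/Γ`. As `π` is a local diffeomorphism onto the latter quotient, this means
that `φ⁻¹ ∘ π : B_τ(0) \ {0} → M \ {p}` is a local diffeomorphism. The field `lift` is the map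
`φ⁻¹ ∘ π` with codomain `M \ {p}`; its values outside `B_τ(0) \ {0}` are irrelevant. -/
structure LocalUniformization (Γ : Subgroup (E n ≃ₗᵢ[ℝ] E n)) (p : M)
    [ChartedSpace (E n) (Punctured M p)] where
  φ : OpenPartialHomeomorph M (OrbitSpace Γ)
  τ : ℝ
  τ_pos : 0 < τ
  target_eq : φ.target = proj Γ '' Metric.ball 0 τ
  mem_source : p ∈ φ.source
  map_singular : φ p = proj Γ 0
  lift : E n → Punctured M p
  lift_eq : ∀ x ∈ puncturedBall n τ, (lift x : M) = φ.symm (proj Γ x)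
  isLocalDiffeo :
    IsLocalDiffeomorphOn 𝓘(ℝ, E n) 𝓘(ℝ, E n) ∞ lift (puncturedBall n τ)

variable {Γ : Subgroup (E n ≃ₗᵢ[ℝ] E n)}

/-- `(Ũ, φ̃)` is compatible with `(U, φ)`: there is, for some `0 < τ̂ ≤ τ`, a `Γ`-equivariant
diffeomorphism `Φ` from `B_τ̂(0)` onto an open subset of `B_τ̃(0)` which lifts `φ̃ ∘ φ⁻¹`. -/
def Compatible (u u' : LocalUniformization Γ p) : Prop :=
  ∃ (r : ℝ) (Φ : E n → E n), 0 < r ∧ r ≤ u.τ ∧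
    ContDiffOn ℝ ∞ Φ (Metric.ball 0 r) ∧
    Set.InjOn Φ (Metric.ball 0 r) ∧
    Set.MapsTo Φ (Metric.ball 0 r) (Metric.ball 0 u'.τ) ∧
    (∀ x ∈ Metric.ball (0 : E n) r, Function.Bijective (fderiv ℝ Φ x)) ∧
    (∀ γ ∈ Γ, ∀ x ∈ Metric.ball (0 : E n) r, Φ (γ x) = γ (Φ x)) ∧
    ∀ x ∈ puncturedBall n r, u.φ.symm (proj Γ x) = u'.φ.symm (proj Γ (Φ x))

variable [IsManifold 𝓘(ℝ, E n) ∞ (Punctured M p)]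

/-- `g` is an orbifold metric: `(φ⁻¹ ∘ π)^* g` is, on `B_τ(0) \ {0}`, the restriction of a
`Γ`-invariant smooth Riemannian metric `ĝ` on `B_τ(0)`. -/
def IsOrbifoldMetric (u : LocalUniformization Γ p) (g : Metric n (Punctured M p)) : Prop :=
  ∃ G : E n → E n →L[ℝ] E n →L[ℝ] ℝ,
    ContDiffOn ℝ ∞ G (Metric.ball 0 u.τ) ∧
    (∀ x ∈ Metric.ball (0 : E n) u.τ, ∀ v w, G x v w = G x w v) ∧
    (∀ x ∈ Metric.ball (0 : E n) u.τ, ∀ v, v ≠ 0 → 0 < G x v v) ∧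
    (∀ γ ∈ Γ, ∀ x ∈ Metric.ball (0 : E n) u.τ, ∀ v w, G (γ x) (γ v) (γ w) = G x v w) ∧
    ∀ x ∈ puncturedBall n u.τ, ∀ v w, pullback g u.lift x v w = G x v w

/-- The orbifold conformal class `[g]_orb`: the orbifold metrics `e^{2f} g` with
`f ∈ C⁰(M) ∩ C^∞(M \ {p})` and `f ∘ φ⁻¹ ∘ π ∈ C^∞(B_τ(0))`. -/
def orbConformalClass (u : LocalUniformization Γ p) (g : Metric n (Punctured M p)) :
    Set (Metric n (Punctured M p)) :=
  {g' | IsOrbifoldMetric u g' ∧ ∃ f : M → ℝ, Continuous f ∧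
    ContMDiff 𝓘(ℝ, E n) 𝓘(ℝ, ℝ) ∞ (fun x : Punctured M p => f x) ∧
    ContDiffOn ℝ ∞ (fun x => f (u.φ.symm (proj Γ x))) (Metric.ball 0 u.τ) ∧
    ∀ x v w, g'.inner x v w = Real.exp (2 * f x) * g.inner x v w}

/-- `𝒞^orb(M)`: the set of orbifold conformal classes. -/
def orbConformalClasses (u : LocalUniformization Γ p) : Set (Set (Metric n (Punctured M p))) :=
  {C | ∃ g, IsOrbifoldMetric u g ∧ C = orbConformalClass u g}

/-- `g` is a cylindrical metric modeled by `(S^{n-1}/Γ, h_Γ)`: near `p` there are coordinates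
`(z, t) ∈ (S^{n-1}/Γ) × (0, ∞) ≅ V \ {p}`, compatible with the orbifold structure at `p` and with
`V ⊆ U`, such that `g = h_Γ + dt²` for `t ≥ 1`. Such coordinates are the polar coordinates
`φ̃ = [e^{-t} z]` of a compatible local uniformization `φ̃ : V → B_1(0)/Γ`. The metric is
written on the cover `S^{n-1} × (0, ∞)`, whose tangent space at `(z, t)` consists of the `(v, a)` in
`ℝⁿ × ℝ` with `v ⟂ z`; there `h_Γ` becomes the round metric of curvature one, induced by `ℝⁿ`.
Completeness of `g` follows if `M` is compact. -/
def IsCylindricalMetric (u : LocalUniformization Γ p) (g : Metric n (Punctured M p)) : Prop :=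
  ∃ u' : LocalUniformization Γ p, u'.τ = 1 ∧ u'.φ.source ⊆ u.φ.source ∧ Compatible u u' ∧
    ∀ (z : E n) (t : ℝ), ‖z‖ = 1 → 1 ≤ t →
      ∀ (v w : E n) (a b : ℝ), inner ℝ z v = 0 → inner ℝ z w = 0 →
        pullback g (fun q : E n × ℝ => u'.lift (Real.exp (-q.2) • q.1)) (z, t) (v, a) (w, b)
          = inner ℝ v w + a * b

variable [MeasurableSpace M] [BorelSpace M]

/-- The Yamabe constant `Y_C(M) = inf_{g ∈ C} I(g)` of an orbifold conformal class. -/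
def orbYamabeConst (C : Set (Metric n (Punctured M p))) : EReal :=
  ⨅ g ∈ C, ((einsteinHilbert g : ℝ) : EReal)

/-- The orbifold Yamabe invariant `Y^orb(M) = sup_{C ∈ 𝒞^orb(M)} Y_C(M)`. -/
def orbYamabeInvariant (u : LocalUniformization Γ p) : EReal :=
  ⨆ C ∈ orbConformalClasses u, orbYamabeConst C

/-- The `h_Γ`-cylindrical Yamabe invariant of `M \ {p}`: the supremum of `Y^{cyl}_{[g]}(M \ {p})` over
the cylindrical metrics `g` modeled by `(S^{n-1}/Γ, h_Γ)`. -/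
def cylYamabeInvariant (u : LocalUniformization Γ p) : EReal :=
  ⨆ g ∈ {g : Metric n (Punctured M p) | IsCylindricalMetric u g}, cylYamabeConst g

end Orbifold

end OrbifoldYamabe

end

noncomputable section

open Filter Topology MeasureTheory

namespace OrbifoldYamabe

set_option maxSynthPendingDepth 3
set_option linter.unusedSectionVars false

/-! Both invariants are governed by one functional. If `g̃ = e^{2f} g` and `w = e^{(n-2)f/2}`, then
the energy densities of `u` for `g̃` and of `w u` for `g` differ, after passing to `dσ_g`, by a
divergence, and the critical norms agree. Hence `Q_{g̃}(u) = Q_g(w u)` whenever the divergence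
integrates to zero (`yamabeQ_confMetric`). The normalized Einstein-Hilbert functional is `Q_g(1)`
(`einsteinHilbert_eq`). A cylindrical end `h_Γ + dt²` is `|x|^{-2}` times the Euclidean metric under
`x = e^{-t} z` (`cylinder_iff`), so cylindrical metrics are conformal to metrics that are flat near
the singular point.

The inequality cyl ≤ orb. Multiplying a cylindrical metric by `|x|²` near the singular point yields
a flat orbifold metric (`exists_orbifoldMetric_of_cylindrical`), and its whole orbifold conformal
class is conformal to the cylindrical metric on the punctured space. For each `g'` in that class,
the constant 1 is approximated by cutoffs vanishing near the point. Their gradients are `O(1/ε)` on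
a set of volume `O(ε^n)`, so the Dirichlet energy is `O(ε^{n-2})`, which tends to 0 because `n ≥ 3`.
Thus a point is negligible for the Yamabe functional, and the infimum over compactly supported
functions is at most the value at 1 (`OrbForm.cylYamabeConst_le_einsteinHilbert`).

The inequality orb ≤ cyl. Let `c < c'`, with `c'` at most the Yamabe constant of an orbifold class.
(a) For compactly supported `v`, the conformal metric of weight `√(v² + δ²)` is a constant multiple
of `g` near the point, so it lies in the class. Letting `δ → 0` gives `c' ‖v‖² ≤ E_g(v)` in the
critical norm (`OrbForm.mul_critNorm_le`). (b) The metric is frozen to its value at the origin on a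
ball of radius `ε`. After rescaling by `1/ε` it converges smoothly to a constant metric, so its
scalar curvature is `o(ε^{-2})` (`eventually_scal_flat_le`). By Hölder, the part of the energy
coming from this curvature is at most `o(ε^{-2}) · Vol^{2/n} ‖v‖²` with `Vol^{2/n} = O(ε²)`, which
is `o(1) ‖v‖²`. So the lower bound survives with `c` in place of `c'`
(`OrbForm.exists_flat_lower_bound`). (c) A constant inner product becomes Euclidean under its
symmetric square root, which commutes with `Γ` (`IsInnerForm.exists_sqrt`). Dividing by the squared
radius then gives a cylindrical metric in a compatible uniformization
(`exists_cylindrical_of_flat`).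

The tensor calculus is carried out from the coordinate definitions. The transformation laws under
coordinate changes and conformal changes (`scal_pullForm`, `scal_confForm`) and the divergence
theorem (`integral_divGrad`) are the local input. -/

/-! ### Bilinear forms on `ℝⁿ` -/

/-- Bilinear forms on `ℝⁿ`. -/
abbrev Form (n : ℕ) : Type := E n →L[ℝ] E n →L[ℝ] ℝ

variable {n : ℕ}

/-- Symmetric positive definite forms. -/
structure IsInnerForm (B : Form n) : Prop where
  symm : ∀ v w, B v w = B w v
  pos : ∀ v, v ≠ 0 → 0 < B v v

/-- The matrix of a bilinear form in the standard basis. -/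
def matOf (B : Form n) : Matrix (Fin n) (Fin n) ℝ :=
  Matrix.of fun i j => B (stdVec i) (stdVec j)

/-- The inverse `(ℝⁿ)* → ℝⁿ` of `v ↦ B v`. -/
def sharp (B : Form n) : (E n →L[ℝ] ℝ) →L[ℝ] E n := ContinuousLinearMap.inverse B

/-- The `j`-th coordinate functional. -/
abbrev coord (j : Fin n) : E n →L[ℝ] ℝ := EuclideanSpace.proj j

lemma sum_smul_stdVec (v : E n) : ∑ i, v i • stdVec i = v := by
  have := (EuclideanSpace.basisFun (Fin n) ℝ).sum_repr v
  simpa [stdVec] using this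

lemma stdVec_apply (i j : Fin n) : stdVec (n := n) i j = if j = i then 1 else 0 := by
  simp [stdVec]

lemma dual_eq_sum (a : E n →L[ℝ] ℝ) : a = ∑ i, a (stdVec i) • coord i := by
  ext v
  conv_lhs => rw [← sum_smul_stdVec v]
  simp [mul_comm]

lemma IsInnerForm.nonneg {B : Form n} (h : IsInnerForm B) (v : E n) : 0 ≤ B v v := by
  by_cases hv : v = 0
  · simp [hv]
  · exact (h.pos v hv).le

lemma IsInnerForm.eq_of_forall {B : Form n} (h : IsInnerForm B) {v w : E n}
    (hvw : ∀ z, B v z = B w z) : v = w := by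
  by_contra hne
  have := h.pos (v - w) (sub_ne_zero.mpr hne)
  rw [map_sub, map_sub] at this
  simp [hvw] at this

/-- Positivity gives injectivity, and the dual has the same dimension. This is what gives `sharp`
its meaning, since `ContinuousLinearMap.inverse` takes the value zero at maps that are not
invertible. -/
lemma IsInnerForm.isInvertible {B : Form n} (h : IsInnerForm B) : B.IsInvertible := by
  have hinj : Function.Injective (B : E n →ₗ[ℝ] (E n →L[ℝ] ℝ)) := fun v w hvw =>
    h.eq_of_forall fun z => by
      have : B v = B w := hvw
      rw [this]
  have hdim : Module.finrank ℝ (E n) = Module.finrank ℝ (E n →L[ℝ] ℝ) := by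
    rw [← (LinearMap.toContinuousLinearMap (𝕜 := ℝ) (E := E n) (F' := ℝ)).finrank_eq]
    exact (Subspace.dual_finrank_eq (K := ℝ) (V := E n)).symm
  refine ⟨(LinearEquiv.ofInjectiveOfFinrankEq _ hinj hdim).toContinuousLinearEquiv, ?_⟩
  ext v w
  rfl

lemma apply_sharp {B : Form n} (h : IsInnerForm B) (a : E n →L[ℝ] ℝ) : B (sharp B a) = a := by
  have := h.isInvertible.self_comp_inverse
  exact DFunLike.congr_fun this a

lemma form_apply_eq_sum (B : Form n) (v w : E n) :
    B v w = ∑ i, ∑ j, v i * w j * matOf B i j := by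
  conv_lhs => rw [← sum_smul_stdVec v, ← sum_smul_stdVec w]
  simp only [map_sum, map_smul, sum_apply, smul_apply,
    smul_eq_mul, matOf, Matrix.of_apply, Finset.mul_sum]
  rw [Finset.sum_comm]
  refine Finset.sum_congr rfl fun i _ => Finset.sum_congr rfl fun j _ => by ring

/-- The identity `B(e_i, ♯dx^l) = dx^l(e_i)` read in coordinates. It allows every matrix inverse in
the coordinate definitions to be replaced by the basis-free `sharp`. -/
lemma matOf_mul_sharp {B : Form n} (h : IsInnerForm B) :
    matOf B * Matrix.of (fun k l => sharp B (coord l) k) = 1 := by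
  ext i l
  rw [Matrix.mul_apply]
  have h1 : B (stdVec i) (sharp B (coord l)) = coord l (stdVec i) := by
    rw [h.symm, apply_sharp h]
  rw [form_apply_eq_sum] at h1
  simp only [stdVec_apply, ite_mul, one_mul, zero_mul, Finset.sum_ite_irrel,
    Finset.sum_const_zero, Finset.sum_ite_eq', Finset.mem_univ, if_true] at h1
  simp only [Matrix.of_apply, Matrix.one_apply]
  simpa [stdVec_apply, mul_comm, eq_comm] using h1

lemma matOf_inv {B : Form n} (h : IsInnerForm B) (k l : Fin n) :
    (matOf B)⁻¹ k l = sharp B (coord l) k := by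
  rw [Matrix.inv_eq_right_inv (matOf_mul_sharp h)]
  rfl

lemma matOf_posDef {B : Form n} (h : IsInnerForm B) : (matOf B).PosDef := by
  refine Matrix.PosDef.of_dotProduct_mulVec_pos ?_ ?_
  · ext i j
    simp [matOf, h.symm (stdVec i)]
  · intro x hx
    have h1 := h.pos (WithLp.toLp 2 x) (by simpa using hx)
    rw [form_apply_eq_sum] at h1
    refine h1.trans_le (le_of_eq ?_)
    simp only [dotProduct, Matrix.mulVec, Finset.mul_sum]
    refine Finset.sum_congr rfl fun i _ => Finset.sum_congr rfl fun j _ => ?_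
    simp; ring

lemma matOf_det_pos {B : Form n} (h : IsInnerForm B) : 0 < (matOf B).det := (matOf_posDef h).det_pos

lemma sharp_eq_sum (B : Form n) (a : E n →L[ℝ] ℝ) :
    sharp B a = ∑ l, a (stdVec l) • sharp B (coord l) := by
  conv_lhs => rw [dual_eq_sum a]
  simp

/-! ### The Christoffel symbols as a bilinear map -/

/-- Exchange of the arguments of a bilinear form, as a continuous linear map. -/
def swapL : Form n →L[ℝ] Form n :=
  (ContinuousLinearMap.flipₗᵢ ℝ (E n) (E n) ℝ).toContinuousLinearEquiv.toContinuousLinearMap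

@[simp] lemma swapL_apply (B : Form n) (v w : E n) : swapL B v w = B w v := rfl

/-- The right-hand side of the Koszul formula,
`½ (D v (w, z) + D w (v, z) - D z (v, w))`. -/
def kos (D : E n →L[ℝ] Form n) : E n →L[ℝ] Form n :=
  (1 / 2 : ℝ) • (D + (D.flip : E n →L[ℝ] Form n) - swapL.comp (D.flip : E n →L[ℝ] Form n))

lemma kos_apply (D : E n →L[ℝ] Form n) (v w z : E n) :
    kos D v w z = (1 / 2 : ℝ) * (D v w z + D w v z - D z v w) := by
  simp [kos]

/-- The Christoffel symbols of `B` as a bilinear map. -/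
def chr (B : E n → Form n) (y : E n) : E n →L[ℝ] E n →L[ℝ] E n :=
  (ContinuousLinearMap.compL ℝ (E n) (E n →L[ℝ] ℝ) (E n) (sharp (B y))).comp
    (kos (fderiv ℝ B y))

lemma chr_apply (B : E n → Form n) (y v w : E n) :
    chr B y v w = sharp (B y) (kos (fderiv ℝ B y) v w) := rfl

/-- The Koszul formula: lowering the index cancels `sharp`. Together with nondegeneracy it
identifies Christoffel maps by testing against arbitrary vectors. -/
lemma form_chr {B : E n → Form n} {y : E n} (h : IsInnerForm (B y)) (v w z : E n) :
    B y (chr B y v w) z = kos (fderiv ℝ B y) v w z := by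
  rw [chr_apply, apply_sharp h]

/-- The operator `u ↦ R(u, v) w`. -/
def ricOp (C : E n →L[ℝ] E n →L[ℝ] E n) (D : E n →L[ℝ] E n →L[ℝ] E n →L[ℝ] E n) (v w : E n) :
    E n →L[ℝ] E n :=
  (D.flip v).flip w - (D v).flip w + C.flip (C v w) - (C v).comp (C.flip w)

lemma ricOp_apply (C : E n →L[ℝ] E n →L[ℝ] E n) (D : E n →L[ℝ] E n →L[ℝ] E n →L[ℝ] E n)
    (v w u : E n) :
    ricOp C D v w u = D u v w - D v u w + C u (C v w) - C v (C u w) := rfl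

/-- The trace of an endomorphism. -/
def tr (L : E n →L[ℝ] E n) : ℝ := LinearMap.trace ℝ (E n) L

lemma tr_eq_sum (L : E n →L[ℝ] E n) : tr L = ∑ i, L (stdVec i) i := by
  rw [tr, LinearMap.trace_eq_matrix_trace ℝ (EuclideanSpace.basisFun (Fin n) ℝ).toBasis,
    Matrix.trace]
  simp [LinearMap.toMatrix_apply, stdVec]

lemma tr_add (L L' : E n →L[ℝ] E n) : tr (L + L') = tr L + tr L' := by
  simp [tr_eq_sum, Finset.sum_add_distrib]

lemma tr_sub (L L' : E n →L[ℝ] E n) : tr (L - L') = tr L - tr L' := by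
  simp [tr_eq_sum, Finset.sum_sub_distrib]

lemma tr_smul (c : ℝ) (L : E n →L[ℝ] E n) : tr (c • L) = c * tr L := by
  simp [tr_eq_sum, Finset.mul_sum]

lemma tr_id : tr (ContinuousLinearMap.id ℝ (E n)) = n := by
  simp [tr_eq_sum, stdVec_apply]

lemma tr_smulRight (a : E n →L[ℝ] ℝ) (v : E n) : tr (a.smulRight v) = a v := by
  rw [tr_eq_sum]
  conv_rhs => rw [dual_eq_sum a]
  simp [mul_comm]

lemma tr_comp_symm (A : E n ≃L[ℝ] E n) (L : E n →L[ℝ] E n) :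
    tr ((A : E n →L[ℝ] E n).comp (L.comp (A.symm : E n →L[ℝ] E n))) = tr L := by
  have := LinearMap.trace_conj' (L : E n →ₗ[ℝ] E n) A.toLinearEquiv
  exact this

/-- The Ricci form of `C` with derivative `D`. -/
def ric (C : E n →L[ℝ] E n →L[ℝ] E n) (D : E n →L[ℝ] E n →L[ℝ] E n →L[ℝ] E n) (v w : E n) : ℝ :=
  tr (ricOp C D v w)

/-- The scalar curvature of `B`. -/
def scal (B : E n → Form n) (y : E n) : ℝ :=
  ∑ j, ric (chr B y) (fderiv ℝ (chr B) y) (stdVec j) (sharp (B y) (coord j))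

lemma ric_add_left (C : E n →L[ℝ] E n →L[ℝ] E n) (D : E n →L[ℝ] E n →L[ℝ] E n →L[ℝ] E n)
    (v v' w : E n) : ric C D (v + v') w = ric C D v w + ric C D v' w := by
  rw [ric, ric, ric, ← tr_add]
  congr 1
  ext1 u
  simp only [ricOp_apply, map_add, add_apply]
  abel

lemma ric_smul_left (C : E n →L[ℝ] E n →L[ℝ] E n) (D : E n →L[ℝ] E n →L[ℝ] E n →L[ℝ] E n)
    (c : ℝ) (v w : E n) : ric C D (c • v) w = c * ric C D v w := by
  rw [ric, ric, ← tr_smul]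
  congr 1
  ext1 u
  simp only [ricOp_apply, map_smul, smul_apply, smul_sub, smul_add]

lemma ric_add_right (C : E n →L[ℝ] E n →L[ℝ] E n) (D : E n →L[ℝ] E n →L[ℝ] E n →L[ℝ] E n)
    (v w w' : E n) : ric C D v (w + w') = ric C D v w + ric C D v w' := by
  rw [ric, ric, ric, ← tr_add]
  congr 1
  ext1 u
  simp only [ricOp_apply, map_add, add_apply]
  abel

lemma ric_smul_right (C : E n →L[ℝ] E n →L[ℝ] E n) (D : E n →L[ℝ] E n →L[ℝ] E n →L[ℝ] E n)
    (c : ℝ) (v w : E n) : ric C D v (c • w) = c * ric C D v w := by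
  rw [ric, ric, ← tr_smul]
  congr 1
  ext1 u
  simp only [ricOp_apply, map_smul, smul_apply, smul_sub, smul_add]

/-- The Ricci form as a bilinear map. -/
def ricB (C : E n →L[ℝ] E n →L[ℝ] E n) (D : E n →L[ℝ] E n →L[ℝ] E n →L[ℝ] E n) :
    E n →ₗ[ℝ] E n →ₗ[ℝ] ℝ :=
  LinearMap.mk₂ ℝ (ric C D) (ric_add_left C D) (ric_smul_left C D) (ric_add_right C D)
    (ric_smul_right C D)

@[simp] lemma ricB_apply (C : E n →L[ℝ] E n →L[ℝ] E n) (D : E n →L[ℝ] E n →L[ℝ] E n →L[ℝ] E n)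
    (v w : E n) : ricB C D v w = ric C D v w := rfl

/-! ### Comparison with the coordinate formulas -/

lemma partialDeriv_matOf {B : E n → Form n} {y : E n} (hB : DifferentiableAt ℝ B y)
    (l i j : Fin n) :
    partialDeriv l (fun y' => matOf (B y') i j) y
      = fderiv ℝ B y (stdVec l) (stdVec i) (stdVec j) := by
  have h : HasFDerivAt (fun y' => matOf (B y') i j)
      ((((fderiv ℝ B y).flip (stdVec i)).flip (stdVec j))) y := by
    have h1 := (hB.hasFDerivAt.clm_apply (hasFDerivAt_const (stdVec i) y)).clm_apply
      (hasFDerivAt_const (stdVec j) y)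
    refine h1.congr_fderiv ?_
    ext v
    simp
  rw [partialDeriv, h.fderiv]
  rfl

lemma christoffel_matOf {B : E n → Form n} {y : E n} (h : IsInnerForm (B y))
    (hB : DifferentiableAt ℝ B y) (k i j : Fin n) :
    christoffel (fun y => matOf (B y)) k i j y = chr B y (stdVec i) (stdVec j) k := by
  rw [christoffel, chr_apply, sharp_eq_sum]
  simp only [partialDeriv_matOf hB, matOf_inv h, kos_apply, Finset.mul_sum]
  simp only [WithLp.ofLp_sum, Finset.sum_apply, WithLp.ofLp_smul, Pi.smul_apply, smul_eq_mul]
  refine Finset.sum_congr rfl fun l _ => ?_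
  ring

lemma contDiffAt_sharp {B : Form n} (h : IsInnerForm B) : ContDiffAt ℝ ∞ (sharp (n := n)) B :=
  h.isInvertible.contDiffAt_map_inverse

lemma contDiff_kos : ContDiff ℝ ∞ (kos (n := n)) := by
  have h1 : ContDiff ℝ ∞ (fun D : E n →L[ℝ] Form n => (D.flip : E n →L[ℝ] Form n)) :=
    (ContinuousLinearMap.flipₗᵢ ℝ (E n) (E n) (E n →L[ℝ] ℝ)).toContinuousLinearEquiv.contDiff
  have h2 : ContDiff ℝ ∞ (fun D : E n →L[ℝ] Form n => (swapL.comp D : E n →L[ℝ] Form n)) :=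
    (ContinuousLinearMap.compL ℝ (E n) (Form n) (Form n) swapL).contDiff
  exact ContDiff.const_smul (1 / 2 : ℝ) ((contDiff_id.add h1).sub (h2.comp h1))

section Param

variable {P : Type*} [NormedAddCommGroup P] [NormedSpace ℝ P] {F : P → E n → Form n} {q : P × E n}

/-- The Christoffel map involves only `F`, its first derivative in the space variable, and
inversion, all smooth in the parameter as well. Joint smoothness in a parameter is needed later for
the rescaled metrics as the scale tends to zero; the versions without parameter below use a dummy
parameter in `ℝ`. -/
lemma contDiffAt_chr (hF : ContDiffAt ℝ ∞ (fun q : P × E n => F q.1 q.2) q)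
    (h : IsInnerForm (F q.1 q.2)) : ContDiffAt ℝ ∞ (fun q : P × E n => chr (F q.1) q.2) q := by
  have h1 : ContDiffAt ℝ ∞ (fun q : P × E n => fderiv ℝ (F q.1) q.2) q := by
    refine ContDiffAt.fderiv (f := fun q : P × E n => F q.1) (n := ∞) ?_ contDiffAt_snd (by simp)
    exact ContDiffAt.comp (g := fun q : P × E n => F q.1 q.2)
      (f := fun z : (P × E n) × E n => (z.1.1, z.2)) (q, q.2) hF (by fun_prop)
  have h2 : ContDiffAt ℝ ∞ (fun q : P × E n => kos (fderiv ℝ (F q.1) q.2)) q :=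
    contDiff_kos.contDiffAt.comp q h1
  have h3 : ContDiffAt ℝ ∞ (fun q : P × E n => sharp (F q.1 q.2)) q :=
    (contDiffAt_sharp h).comp q hF
  exact ContDiffAt.clm_comp
    ((ContinuousLinearMap.compL ℝ (E n) (E n →L[ℝ] ℝ) (E n)).contDiff.contDiffAt.comp q h3) h2

lemma contDiffAt_scal (hF : ContDiffAt ℝ ∞ (fun q : P × E n => F q.1 q.2) q)
    (hs : IsInnerForm (F q.1 q.2)) :
    ContDiffAt ℝ ∞ (fun q : P × E n => scal (F q.1) q.2) q := by
  have hC := contDiffAt_chr hF hs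
  have h1 : ContDiffAt ℝ ∞ (fun q : P × E n => fderiv ℝ (chr (F q.1)) q.2) q := by
    refine ContDiffAt.fderiv (f := fun q : P × E n => chr (F q.1)) (n := ∞) ?_ contDiffAt_snd
      (by simp)
    exact ContDiffAt.comp (g := fun q : P × E n => chr (F q.1) q.2)
      (f := fun z : (P × E n) × E n => (z.1.1, z.2)) (q, q.2) hC (by fun_prop)
  have h3 : ContDiffAt ℝ ∞ (fun q : P × E n => sharp (F q.1 q.2)) q :=
    (contDiffAt_sharp hs).comp q hF
  simp only [scal, ric, tr_eq_sum, ricOp_apply]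
  refine ContDiffAt.sum fun j _ => ContDiffAt.sum fun i _ => ?_
  set C := fun q : P × E n => chr (F q.1) q.2
  have h4 : ContDiffAt ℝ ∞ (fun q : P × E n => sharp (F q.1 q.2) (coord j)) q :=
    h3.clm_apply contDiffAt_const
  have hc : ∀ {v w : P × E n → E n}, ContDiffAt ℝ ∞ v q → ContDiffAt ℝ ∞ w q →
    ContDiffAt ℝ ∞ (fun q => chr (F q.1) q.2 (v q) (w q)) q := fun hv hw =>
      (hC.clm_apply hv).clm_apply hw
  have hd : ∀ v w : E n, ContDiffAt ℝ ∞
      (fun q => fderiv ℝ (chr (F q.1)) q.2 v w (sharp (F q.1 q.2) (coord j))) q := fun v w =>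
    ((h1.clm_apply contDiffAt_const).clm_apply contDiffAt_const).clm_apply h4
  exact contDiffAt_euclidean.1 ((((hd (stdVec i) (stdVec j)).sub (hd (stdVec j) (stdVec i))).add
    (hc contDiffAt_const (hc contDiffAt_const h4))).sub
    (hc contDiffAt_const (hc contDiffAt_const h4))) i

end Param

section

variable {B : E n → Form n} {y : E n}

lemma contDiffAt_chr' (hB : ContDiffAt ℝ ∞ B y) (h : IsInnerForm (B y)) :
    ContDiffAt ℝ ∞ (chr B) y := by
  have h1 : ContDiffAt ℝ ∞ (fun q : ℝ × E n => chr B q.2) ((0 : ℝ), y) :=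
    contDiffAt_chr (F := fun _ : ℝ => B) (q := ((0 : ℝ), y))
      (ContDiffAt.comp (g := B) (f := Prod.snd) ((0 : ℝ), y) hB contDiffAt_snd) h
  exact ContDiffAt.comp (g := fun q : ℝ × E n => chr B q.2) (f := fun z => ((0 : ℝ), z)) y h1
    (by fun_prop)

lemma contDiffAt_scal' (hB : ContDiffAt ℝ ∞ B y) (h : IsInnerForm (B y)) :
    ContDiffAt ℝ ∞ (scal B) y := by
  have h1 : ContDiffAt ℝ ∞ (fun q : ℝ × E n => scal B q.2) ((0 : ℝ), y) :=
    contDiffAt_scal (F := fun _ : ℝ => B) (q := ((0 : ℝ), y))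
      (ContDiffAt.comp (g := B) (f := Prod.snd) ((0 : ℝ), y) hB contDiffAt_snd) h
  exact ContDiffAt.comp (g := fun q : ℝ × E n => scal B q.2) (f := fun z => ((0 : ℝ), z)) y h1
    (by fun_prop)

lemma eventually_differentiableAt (hB : ContDiffAt ℝ ∞ B y) :
    ∀ᶠ y' in 𝓝 y, DifferentiableAt ℝ B y' := by
  have h1 : ContDiffAt ℝ 1 B y := hB.of_le (by exact_mod_cast le_top)
  filter_upwards [h1.eventually (by simp)] with y' h
  exact h.differentiableAt (by simp)

lemma partialDeriv_christoffel (hB : ContDiffAt ℝ ∞ B y) (h : ∀ᶠ y' in 𝓝 y, IsInnerForm (B y'))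
    (l k i j : Fin n) :
    partialDeriv l (christoffel (fun y => matOf (B y)) k i j) y
      = fderiv ℝ (chr B) y (stdVec l) (stdVec i) (stdVec j) k := by
  have hC : DifferentiableAt ℝ (chr B) y :=
    (contDiffAt_chr' hB h.self_of_nhds).differentiableAt (by simp)
  have h1 : christoffel (fun y => matOf (B y)) k i j =ᶠ[𝓝 y]
      fun y' => coord k (chr B y' (stdVec i) (stdVec j)) := by
    filter_upwards [h, eventually_differentiableAt hB] with y' h h'
    exact christoffel_matOf h h' k i j
  rw [partialDeriv, h1.fderiv_eq]
  have h2 := ((coord k).hasFDerivAt (x := chr B y (stdVec i) (stdVec j))).comp y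
    ((hC.hasFDerivAt.clm_apply (hasFDerivAt_const (stdVec i) y)).clm_apply
      (hasFDerivAt_const (stdVec j) y))
  have h3 := h2.fderiv
  simp only [Function.comp_def] at h3
  rw [h3]
  simp

lemma ofLp_sum_apply {ι : Type*} (s : Finset ι) (f : ι → E n) (i : Fin n) :
    (∑ j ∈ s, f j) i = ∑ j ∈ s, f j i := by
  simp

lemma chr_apply_coord (C : E n →L[ℝ] E n →L[ℝ] E n) (v w : E n) (i : Fin n) :
    C v w i = ∑ m, C v (stdVec m) i * w m := by
  conv_lhs => rw [← sum_smul_stdVec w]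
  simp [mul_comm]

lemma ricci_matOf (hB : ContDiffAt ℝ ∞ B y) (h : ∀ᶠ y' in 𝓝 y, IsInnerForm (B y'))
    (j k : Fin n) :
    ricci (fun y => matOf (B y)) j k y
      = ric (chr B y) (fderiv ℝ (chr B) y) (stdVec j) (stdVec k) := by
  have h0 := h.self_of_nhds
  have hd : DifferentiableAt ℝ B y := hB.differentiableAt (by simp)
  rw [ricci, ric, tr_eq_sum, ← Finset.sum_add_distrib]
  refine Finset.sum_congr rfl fun i _ => ?_
  simp only [partialDeriv_christoffel hB h, christoffel_matOf h0 hd, ricOp_apply]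
  rw [Finset.sum_sub_distrib]
  simp only [PiLp.sub_apply, PiLp.add_apply]
  rw [chr_apply_coord (chr B y) (stdVec i) (chr B y (stdVec j) (stdVec k)),
    chr_apply_coord (chr B y) (stdVec j) (chr B y (stdVec i) (stdVec k))]
  ring

/-- Expanding the second argument of the Ricci form in the standard basis turns the invariant
contraction into the coordinate one; the symmetry of the inverse matrix reconciles the order of
indices. -/
lemma scalarCoord_matOf (hB : ContDiffAt ℝ ∞ B y) (h : ∀ᶠ y' in 𝓝 y, IsInnerForm (B y')) :
    scalarCoord (fun y => matOf (B y)) y = scal B y := by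
  rw [scalarCoord, scal]
  refine Finset.sum_congr rfl fun j _ => ?_
  have := dual_eq_sum ((ricB (chr B y) (fderiv ℝ (chr B) y) (stdVec j)).toContinuousLinearMap)
  have h1 : ∀ w, ric (chr B y) (fderiv ℝ (chr B) y) (stdVec j) w
      = ∑ k, ric (chr B y) (fderiv ℝ (chr B) y) (stdVec j) (stdVec k) * w k := fun w => by
    have := DFunLike.congr_fun this w
    simpa using this
  rw [h1]
  refine Finset.sum_congr rfl fun k _ => ?_
  rw [ricci_matOf hB h]
  have h2 := (matOf_posDef h.self_of_nhds).inv.isHermitian.apply j k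
  rw [← h2]
  simp only [star_trivial]
  rw [matOf_inv h.self_of_nhds, mul_comm]

end

variable {n : ℕ}

/-! ### Behaviour under changes of coordinates -/

/-- The form `(v, w) ↦ B (A v) (A w)`. -/
def pullForm (B : Form n) (A : E n →L[ℝ] E n) : Form n := B.bilinearComp A A

@[simp] lemma pullForm_apply (B : Form n) (A : E n →L[ℝ] E n) (v w : E n) :
    pullForm B A v w = B (A v) (A w) := rfl

lemma IsInnerForm.pullForm {B : Form n} (h : IsInnerForm B) {A : E n →L[ℝ] E n}
    (hA : Function.Injective A) : IsInnerForm (pullForm B A) where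
  symm v w := h.symm _ _
  pos v hv := h.pos _ fun h0 => hv (hA (by simpa using h0))

lemma differentiableAt_form_apply {B : E n → Form n} {y : E n} (hB : DifferentiableAt ℝ B y)
    {f g : E n → E n} (hf : DifferentiableAt ℝ f y) (hg : DifferentiableAt ℝ g y) (u : E n) :
    fderiv ℝ (fun y => B y (f y) (g y)) y u
      = fderiv ℝ B y u (f y) (g y) + B y (fderiv ℝ f y u) (g y) + B y (f y) (fderiv ℝ g y u) := by
  have h := ((hB.hasFDerivAt.clm_apply hf.hasFDerivAt).clm_apply hg.hasFDerivAt).fderiv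
  rw [h]
  simp
  ring

lemma eq_of_kos {B : E n → Form n} {y : E n} (h : IsInnerForm (B y)) {v w x : E n}
    (hx : ∀ z, B y x z = kos (fderiv ℝ B y) v w z) : x = chr B y v w :=
  h.eq_of_forall fun z => by rw [hx, form_chr h]

section ChangeOfCoordinates

variable {H B : E n → Form n} {ψ : E n → E n} {y : E n}

lemma fderiv_form_apply {B : E n → Form n} {y : E n} (hB : DifferentiableAt ℝ B y) (u v w : E n) :
    fderiv ℝ (fun y => B y v w) y u = fderiv ℝ B y u v w := by
  have h := ((hB.hasFDerivAt.clm_apply (hasFDerivAt_const v y)).clm_apply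
    (hasFDerivAt_const w y)).fderiv
  rw [h]
  simp

lemma contDiffAt_fderiv {F : Type*} [NormedAddCommGroup F] [NormedSpace ℝ F] {f : E n → F}
    {y : E n} (hf : ContDiffAt ℝ ∞ f y) : ContDiffAt ℝ ∞ (fderiv ℝ f) y :=
  hf.fderiv_right (m := ∞) (by simp)

lemma fderiv_fderiv_symm {F : Type*} [NormedAddCommGroup F] [NormedSpace ℝ F] {f : E n → F}
    {y : E n} (hf : ContDiffAt ℝ ∞ f y) (u v : E n) :
    fderiv ℝ (fderiv ℝ f) y u v = fderiv ℝ (fderiv ℝ f) y v u :=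
  (hf.isSymmSndFDerivAt (by
    rw [minSmoothness_of_isRCLikeNormedField]; exact ENat.LEInfty.out)) u v

/-- The pull-back composes with `fderiv ℝ ψ` in each of the two slots. Exchanging the slots in
between expresses this as two ordinary compositions, for which smoothness is available. -/
lemma contDiffAt_pullForm (hH : ContDiffAt ℝ ∞ H (ψ y)) (hψ : ContDiffAt ℝ ∞ ψ y) :
    ContDiffAt ℝ ∞ (fun y => pullForm (H (ψ y)) (fderiv ℝ ψ y)) y := by
  have h1 : ContDiffAt ℝ ∞ (fun y => H (ψ y)) y := hH.comp y hψ
  have h2 := contDiffAt_fderiv hψ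
  have h3 : ContDiffAt ℝ ∞ (fun y => (H (ψ y)).comp (fderiv ℝ ψ y)) y := h1.clm_comp h2
  have h4 : ContDiffAt ℝ ∞ (fun y => swapL ((H (ψ y)).comp (fderiv ℝ ψ y))) y :=
    swapL.contDiff.contDiffAt.comp y h3
  exact swapL.contDiff.contDiffAt.comp y (h4.clm_comp h2)

lemma fderiv_pullForm (hH : DifferentiableAt ℝ H (ψ y)) (hψ : ContDiffAt ℝ ∞ ψ y)
    (hB : B =ᶠ[𝓝 y] fun y => pullForm (H (ψ y)) (fderiv ℝ ψ y)) (hBd : DifferentiableAt ℝ B y)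
    (u v w : E n) :
    fderiv ℝ B y u v w = fderiv ℝ H (ψ y) (fderiv ℝ ψ y u) (fderiv ℝ ψ y v) (fderiv ℝ ψ y w)
      + H (ψ y) (fderiv ℝ (fderiv ℝ ψ) y u v) (fderiv ℝ ψ y w)
      + H (ψ y) (fderiv ℝ ψ y v) (fderiv ℝ (fderiv ℝ ψ) y u w) := by
  have hψd : DifferentiableAt ℝ ψ y := hψ.differentiableAt (by simp)
  have hψ2 : DifferentiableAt ℝ (fderiv ℝ ψ) y :=
    (contDiffAt_fderiv hψ).differentiableAt (by simp)
  have hHc : HasFDerivAt (fun y => H (ψ y)) ((fderiv ℝ H (ψ y)).comp (fderiv ℝ ψ y)) y :=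
    hH.hasFDerivAt.comp y hψd.hasFDerivAt
  have hv : ∀ v, HasFDerivAt (fun y => fderiv ℝ ψ y v) ((fderiv ℝ (fderiv ℝ ψ) y).flip v) y :=
    fun v => by simpa using hψ2.hasFDerivAt.clm_apply (hasFDerivAt_const v y)
  rw [← fderiv_form_apply hBd]
  have h1 : (fun y => B y v w) =ᶠ[𝓝 y] fun y => H (ψ y) (fderiv ℝ ψ y v) (fderiv ℝ ψ y w) := by
    filter_upwards [hB] with y' h
    rw [h, pullForm_apply]
  rw [h1.fderiv_eq, differentiableAt_form_apply (B := fun y => H (ψ y)) hHc.differentiableAt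
    (hv v).differentiableAt (hv w).differentiableAt, hHc.fderiv, (hv v).fderiv, (hv w).fderiv]
  simp

/-- Both sides are tested against `dψ z`, which exhausts all vectors. In the Koszul expression of
the pull-back the second derivatives of `ψ` occur six times; by their symmetry four cancel, and the
remaining pair is the inhomogeneous term. -/
lemma fderiv_chr_pullForm (hH : DifferentiableAt ℝ H (ψ y)) (hψ : ContDiffAt ℝ ∞ ψ y)
    (hB : B =ᶠ[𝓝 y] fun y => pullForm (H (ψ y)) (fderiv ℝ ψ y)) (hBd : DifferentiableAt ℝ B y)
    (hi : IsInnerForm (H (ψ y))) (hA : Function.Bijective (fderiv ℝ ψ y)) (v w : E n) :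
    fderiv ℝ ψ y (chr B y v w) = chr H (ψ y) (fderiv ℝ ψ y v) (fderiv ℝ ψ y w)
      + fderiv ℝ (fderiv ℝ ψ) y v w := by
  have hBy : B y = pullForm (H (ψ y)) (fderiv ℝ ψ y) := hB.self_of_nhds
  have hiB : IsInnerForm (B y) := hBy ▸ hi.pullForm hA.injective
  refine hi.eq_of_forall fun z' => ?_
  obtain ⟨z, rfl⟩ := hA.surjective z'
  have h1 := form_chr hiB v w z
  rw [kos_apply, hBy, pullForm_apply] at h1
  simp only [fderiv_pullForm hH hψ hB hBd] at h1
  rw [h1, map_add, add_apply, form_chr hi, kos_apply, fderiv_fderiv_symm hψ w v,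
    fderiv_fderiv_symm hψ z v, fderiv_fderiv_symm hψ z w, hi.symm (fderiv ℝ ψ y v),
    hi.symm (fderiv ℝ ψ y w)]
  ring

/-- Differentiating the Christoffel law once more and antisymmetrizing in `u` and `v` removes the
third derivatives of `ψ`; the terms with second derivatives are absorbed by the law itself. The
curvature operator is therefore tensorial. -/
lemma ricOp_pullForm (hH : ContDiffAt ℝ ∞ H (ψ y)) (hψe : ∀ᶠ y' in 𝓝 y, ContDiffAt ℝ ∞ ψ y')
    (hB : B =ᶠ[𝓝 y] fun y => pullForm (H (ψ y)) (fderiv ℝ ψ y)) (hBd : ContDiffAt ℝ ∞ B y)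
    (hi : ∀ᶠ x in 𝓝 (ψ y), IsInnerForm (H x))
    (hA : ∀ᶠ y' in 𝓝 y, Function.Bijective (fderiv ℝ ψ y')) (v w u : E n) :
    fderiv ℝ ψ y (ricOp (chr B y) (fderiv ℝ (chr B) y) v w u)
      = ricOp (chr H (ψ y)) (fderiv ℝ (chr H) (ψ y)) (fderiv ℝ ψ y v) (fderiv ℝ ψ y w)
        (fderiv ℝ ψ y u) := by
  have hψ := hψe.self_of_nhds
  have hψd : DifferentiableAt ℝ ψ y := hψ.differentiableAt (by simp)
  have hψ2 : DifferentiableAt ℝ (fderiv ℝ ψ) y :=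
    (contDiffAt_fderiv hψ).differentiableAt (by simp)
  have hψ3 : DifferentiableAt ℝ (fderiv ℝ (fderiv ℝ ψ)) y :=
    (contDiffAt_fderiv (contDiffAt_fderiv hψ)).differentiableAt (by simp)
  have hBy : B y = pullForm (H (ψ y)) (fderiv ℝ ψ y) := hB.self_of_nhds
  have hiB : IsInnerForm (B y) := hBy ▸ hi.self_of_nhds.pullForm hA.self_of_nhds.injective
  have hC : HasFDerivAt (chr B) (fderiv ℝ (chr B) y) y :=
    ((contDiffAt_chr' hBd hiB).differentiableAt (by simp)).hasFDerivAt
  have hC' : HasFDerivAt (fun y => chr H (ψ y))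
      ((fderiv ℝ (chr H) (ψ y)).comp (fderiv ℝ ψ y)) y :=
    ((contDiffAt_chr' hH hi.self_of_nhds).differentiableAt (by simp)).hasFDerivAt.comp y
      hψd.hasFDerivAt
  have hlaw : ∀ᶠ y' in 𝓝 y, ∀ v w, fderiv ℝ ψ y' (chr B y' v w)
      = chr H (ψ y') (fderiv ℝ ψ y' v) (fderiv ℝ ψ y' w) + fderiv ℝ (fderiv ℝ ψ) y' v w := by
    filter_upwards [hψ.continuousAt.eventually (eventually_differentiableAt hH),
      hψe, eventually_eventuallyEq_nhds.mpr hB, eventually_differentiableAt hBd,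
      hψ.continuousAt.eventually hi, hA] with y' h1 h2 h3 h4 h5 h6 v w
    exact fderiv_chr_pullForm h1 h2 h3 h4 h5 h6 v w
  have hv : ∀ v, HasFDerivAt (fun y => fderiv ℝ ψ y v) ((fderiv ℝ (fderiv ℝ ψ) y).flip v) y :=
    fun v => by simpa using hψ2.hasFDerivAt.clm_apply (hasFDerivAt_const v y)
  have hD : ∀ u v w, fderiv ℝ (fderiv ℝ ψ) y u (chr B y v w)
      + fderiv ℝ ψ y (fderiv ℝ (chr B) y u v w)
      = fderiv ℝ (chr H) (ψ y) (fderiv ℝ ψ y u) (fderiv ℝ ψ y v) (fderiv ℝ ψ y w)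
      + chr H (ψ y) (fderiv ℝ (fderiv ℝ ψ) y u v) (fderiv ℝ ψ y w)
      + chr H (ψ y) (fderiv ℝ ψ y v) (fderiv ℝ (fderiv ℝ ψ) y u w)
      + fderiv ℝ (fderiv ℝ (fderiv ℝ ψ)) y u v w := by
    intro u v w
    have e : (fun y' => fderiv ℝ ψ y' (chr B y' v w)) =ᶠ[𝓝 y] fun y' =>
        chr H (ψ y') (fderiv ℝ ψ y' v) (fderiv ℝ ψ y' w) + fderiv ℝ (fderiv ℝ ψ) y' v w :=
      hlaw.mono fun y' h => h v w
    have e1 := e.fderiv_eq (𝕜 := ℝ)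
    have hL := (hψ2.hasFDerivAt.clm_apply ((hC.clm_apply (hasFDerivAt_const v y)).clm_apply
      (hasFDerivAt_const w y))).fderiv
    have hR1 := (hC'.clm_apply (hv v)).clm_apply (hv w)
    have hR2 := (hψ3.hasFDerivAt.clm_apply (hasFDerivAt_const v y)).clm_apply
      (hasFDerivAt_const w y)
    have hR := (hR1.add hR2).fderiv
    have e2 := hL.symm.trans (e1.trans hR)
    have e3 := DFunLike.congr_fun e2 u
    simp at e3
    rw [add_comm, e3]
    abel
  have h1 := hD u v w
  have h2 := hD v u w
  have l1 := hlaw.self_of_nhds u (chr B y v w)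
  have l2 := hlaw.self_of_nhds v (chr B y u w)
  have l3 := hlaw.self_of_nhds v w
  have l4 := hlaw.self_of_nhds u w
  rw [l3, map_add] at l1
  rw [l4, map_add] at l2
  rw [fderiv_fderiv_symm hψ v u, fderiv_fderiv_symm (contDiffAt_fderiv hψ) v u] at h2
  simp only [ricOp_apply, map_sub, map_add]
  rw [eq_sub_of_add_eq' h1, eq_sub_of_add_eq' h2, l1, l2]
  abel

/-- The curvature operators are conjugate by the differential `A` of `ψ`, so the Ricci forms
correspond because the trace is conjugation invariant. The metric contraction is independent of the
basis: `A e_j` and `dx^j ∘ A⁻¹` are again dual to each other. -/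
lemma scal_pullForm (hH : ContDiffAt ℝ ∞ H (ψ y)) (hψe : ∀ᶠ y' in 𝓝 y, ContDiffAt ℝ ∞ ψ y')
    (hB : B =ᶠ[𝓝 y] fun y => pullForm (H (ψ y)) (fderiv ℝ ψ y))
    (hi : ∀ᶠ x in 𝓝 (ψ y), IsInnerForm (H x))
    (hA : ∀ᶠ y' in 𝓝 y, Function.Bijective (fderiv ℝ ψ y')) :
    scal B y = scal H (ψ y) := by
  have hBd : ContDiffAt ℝ ∞ B y := (contDiffAt_pullForm hH hψe.self_of_nhds).congr_of_eventuallyEq hB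
  have hBy : B y = pullForm (H (ψ y)) (fderiv ℝ ψ y) := hB.self_of_nhds
  have hH0 := hi.self_of_nhds
  have hA0 := hA.self_of_nhds
  have hiB : IsInnerForm (B y) := hBy ▸ hH0.pullForm hA0.injective
  set A : E n ≃L[ℝ] E n := (LinearEquiv.ofBijective (fderiv ℝ ψ y : E n →ₗ[ℝ] E n)
    hA0).toContinuousLinearEquiv with hAdef
  have hAψ : ∀ v, fderiv ℝ ψ y v = A v := fun v => rfl
  have hric : ∀ v w, ric (chr B y) (fderiv ℝ (chr B) y) v w
      = ric (chr H (ψ y)) (fderiv ℝ (chr H) (ψ y)) (A v) (A w) := by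
    intro v w
    rw [ric, ric, ← tr_comp_symm A]
    congr 1
    ext1 u
    have := ricOp_pullForm hH hψe hB hBd hi hA v w (A.symm u)
    simpa [hAψ] using this
  have hsharp : ∀ a : E n →L[ℝ] ℝ, A (sharp (B y) a)
      = sharp (H (ψ y)) (a.comp (A.symm : E n →L[ℝ] E n)) := by
    intro a
    refine hH0.eq_of_forall fun z => ?_
    rw [apply_sharp hH0]
    have h1 := DFunLike.congr_fun (apply_sharp hiB a) (A.symm z)
    rw [hBy] at h1
    simpa [hAψ, hBy] using h1
  simp only [scal, hric, hsharp]
  have hexp : ∀ j : Fin n, A (stdVec j) = ∑ a, (A (stdVec j)) a • stdVec a := fun j =>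
    (sum_smul_stdVec _).symm
  set R := ricB (chr H (ψ y)) (fderiv ℝ (chr H) (ψ y)) with hR
  have hkey : ∀ a : Fin n, (∑ j, (A (stdVec j)) a • (coord j).comp (A.symm : E n →L[ℝ] E n))
      = coord a := by
    intro a
    ext z
    have h2 := congrArg (fun x => (A x) a) (sum_smul_stdVec (A.symm z))
    simpa [mul_comm] using h2
  calc ∑ j, R (A (stdVec j)) (sharp (H (ψ y)) ((coord j).comp (A.symm : E n →L[ℝ] E n)))
      = ∑ j, ∑ a, R (stdVec a) (sharp (H (ψ y))
          ((A (stdVec j)) a • (coord j).comp (A.symm : E n →L[ℝ] E n))) := by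
        refine Finset.sum_congr rfl fun j _ => ?_
        conv_lhs => rw [hexp j]
        simp only [map_sum, map_smul, LinearMap.sum_apply, LinearMap.smul_apply]
    _ = ∑ a, R (stdVec a) (sharp (H (ψ y)) (∑ j,
          (A (stdVec j)) a • (coord j).comp (A.symm : E n →L[ℝ] E n))) := by
        rw [Finset.sum_comm]
        simp only [map_sum]
    _ = _ := by simp only [hkey]; rfl

end ChangeOfCoordinates

variable {n : ℕ}

/-! ### Conformal changes -/

section Conformal

variable {B : E n → Form n} {f : E n → ℝ} {y : E n}

lemma fderiv_form_symm (hB : DifferentiableAt ℝ B y) (h : ∀ᶠ y' in 𝓝 y, IsInnerForm (B y'))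
    (u v w : E n) : fderiv ℝ B y u v w = fderiv ℝ B y u w v := by
  rw [← fderiv_form_apply hB, ← fderiv_form_apply hB]
  have : (fun y => B y v w) =ᶠ[𝓝 y] fun y => B y w v := h.mono fun y' h => h.symm v w
  rw [this.fderiv_eq]

lemma chr_symm (hB : DifferentiableAt ℝ B y) (h : ∀ᶠ y' in 𝓝 y, IsInnerForm (B y'))
    (v w : E n) : chr B y v w = chr B y w v := by
  refine (eq_of_kos h.self_of_nhds fun z => ?_).symm
  rw [form_chr h.self_of_nhds, kos_apply, kos_apply, fderiv_form_symm hB h z v w]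
  ring

/-- Metric compatibility of the Levi-Civita connection: in the sum of the two Koszul expressions all
terms cancel except twice `D u (v, w)`. -/
lemma fderiv_form_eq_chr (hB : DifferentiableAt ℝ B y) (h : ∀ᶠ y' in 𝓝 y, IsInnerForm (B y'))
    (u v w : E n) : fderiv ℝ B y u v w = B y (chr B y u v) w + B y v (chr B y u w) := by
  rw [h.self_of_nhds.symm v, form_chr h.self_of_nhds, form_chr h.self_of_nhds, kos_apply,
    kos_apply, fderiv_form_symm hB h v u w, fderiv_form_symm hB h w u v,
    fderiv_form_symm hB h u w v, fderiv_form_symm hB h w v u, fderiv_form_symm hB h v w u]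
  ring

/-- The gradient of `f`. -/
def grad (B : E n → Form n) (f : E n → ℝ) (y : E n) : E n := sharp (B y) (fderiv ℝ f y)

/-- The covariant derivative of the gradient of `f`. -/
def lapOp (B : E n → Form n) (f : E n → ℝ) (y : E n) : E n →L[ℝ] E n :=
  fderiv ℝ (grad B f) y + (chr B y).flip (grad B f y)

/-- The Laplacian of `f`. -/
def lap (B : E n → Form n) (f : E n → ℝ) (y : E n) : ℝ := tr (lapOp B f y)

lemma form_grad (h : IsInnerForm (B y)) (v : E n) : B y (grad B f y) v = fderiv ℝ f y v := by
  rw [grad, apply_sharp h]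

lemma form_grad' (h : IsInnerForm (B y)) (v : E n) : B y v (grad B f y) = fderiv ℝ f y v := by
  rw [h.symm, form_grad h]

lemma contDiffAt_grad (hB : ContDiffAt ℝ ∞ B y) (h : IsInnerForm (B y))
    (hf : ContDiffAt ℝ ∞ f y) : ContDiffAt ℝ ∞ (grad B f) y :=
  ((contDiffAt_sharp h).comp y hB).clm_apply (contDiffAt_fderiv hf)

/-- Differentiate `B(grad f, z) = df(z)` and use metric compatibility. The right-hand side is the
Hessian of `f`, which makes the symmetry of the operator visible. -/
lemma form_lapOp (hB : ContDiffAt ℝ ∞ B y) (h : ∀ᶠ y' in 𝓝 y, IsInnerForm (B y'))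
    (hf : ContDiffAt ℝ ∞ f y) (u z : E n) :
    B y (lapOp B f y u) z = fderiv ℝ (fderiv ℝ f) y u z - fderiv ℝ f y (chr B y u z) := by
  have h0 := h.self_of_nhds
  have hBd : DifferentiableAt ℝ B y := hB.differentiableAt (by simp)
  have hN : DifferentiableAt ℝ (grad B f) y :=
    (contDiffAt_grad hB h0 hf).differentiableAt (by simp)
  have hf2 : DifferentiableAt ℝ (fderiv ℝ f) y :=
    (contDiffAt_fderiv hf).differentiableAt (by simp)
  have e : (fun y => B y (grad B f y) z) =ᶠ[𝓝 y] fun y => fderiv ℝ f y z :=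
    h.mono fun y' h => form_grad h z
  have e1 := DFunLike.congr_fun (e.fderiv_eq (𝕜 := ℝ)) u
  rw [differentiableAt_form_apply hBd hN (differentiableAt_const z),
    (hf2.hasFDerivAt.clm_apply (hasFDerivAt_const z y)).fderiv,
    fderiv_form_eq_chr hBd h, form_grad h0] at e1
  simp at e1
  rw [lapOp, add_apply, map_add, add_apply, ContinuousLinearMap.flip_apply, ← e1]
  ring

/-- The form `e^{2f} B`. -/
def confForm (f : E n → ℝ) (B : E n → Form n) (y : E n) : Form n := Real.exp (2 * f y) • B y

lemma isInnerForm_smul {B : Form n} (h : IsInnerForm B) {c : ℝ} (hc : 0 < c) :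
    IsInnerForm (c • B) where
  symm v w := by simp [h.symm v w]
  pos v hv := by simpa using mul_pos hc (h.pos v hv)

lemma contDiffAt_confForm (hB : ContDiffAt ℝ ∞ B y) (hf : ContDiffAt ℝ ∞ f y) :
    ContDiffAt ℝ ∞ (confForm f B) y := (contDiffAt_const.mul hf).exp.smul hB

lemma fderiv_confForm (hB : DifferentiableAt ℝ B y) (hf : DifferentiableAt ℝ f y) (u v w : E n) :
    fderiv ℝ (confForm f B) y u v w
      = Real.exp (2 * f y) * (2 * fderiv ℝ f y u * B y v w + fderiv ℝ B y u v w) := by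
  have h1 : HasFDerivAt (fun y => Real.exp (2 * f y))
      (Real.exp (2 * f y) • (2 : ℝ) • fderiv ℝ f y) y :=
    (hf.hasFDerivAt.const_mul 2).exp
  have h2 := (h1.smul hB.hasFDerivAt).fderiv
  have h3 : fderiv ℝ (confForm f B) y = _ := h2
  rw [h3]
  simp
  ring

/-- The right-hand side satisfies the Koszul formula of `e^{2f} B`; the common factor `e^{2f}`
occurs on both sides. -/
lemma chr_confForm (hB : DifferentiableAt ℝ B y) (h : IsInnerForm (B y))
    (hf : DifferentiableAt ℝ f y) (v w : E n) :
    chr (confForm f B) y v w = chr B y v w + fderiv ℝ f y v • w + fderiv ℝ f y w • v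
      - B y v w • grad B f y := by
  refine (eq_of_kos (isInnerForm_smul h (Real.exp_pos _)) fun z => ?_).symm
  rw [kos_apply]
  simp only [fderiv_confForm hB hf]
  simp only [confForm, smul_apply, map_add, map_sub, map_smul, add_apply, sub_apply, smul_eq_mul,
    form_chr h, form_grad h, kos_apply]
  ring

lemma fderiv_chr_confForm (hB : ContDiffAt ℝ ∞ B y) (h : ∀ᶠ y' in 𝓝 y, IsInnerForm (B y'))
    (hf : ContDiffAt ℝ ∞ f y) (u v w : E n) :
    fderiv ℝ (chr (confForm f B)) y u v w = fderiv ℝ (chr B) y u v w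
      + fderiv ℝ (fderiv ℝ f) y u v • w + fderiv ℝ (fderiv ℝ f) y u w • v
      - (fderiv ℝ B y u v w • grad B f y + B y v w • fderiv ℝ (grad B f) y u) := by
  have h0 := h.self_of_nhds
  have hBd : DifferentiableAt ℝ B y := hB.differentiableAt (by simp)
  have hN : DifferentiableAt ℝ (grad B f) y :=
    (contDiffAt_grad hB h0 hf).differentiableAt (by simp)
  have hf2 : DifferentiableAt ℝ (fderiv ℝ f) y :=
    (contDiffAt_fderiv hf).differentiableAt (by simp)
  have hC : DifferentiableAt ℝ (chr B) y := (contDiffAt_chr' hB h0).differentiableAt (by simp)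
  have hC' : DifferentiableAt ℝ (chr (confForm f B)) y :=
    (contDiffAt_chr' (contDiffAt_confForm hB hf)
      (isInnerForm_smul h0 (Real.exp_pos _))).differentiableAt (by simp)
  have hfe : ∀ᶠ y' in 𝓝 y, DifferentiableAt ℝ f y' := by
    have h1 : ContDiffAt ℝ 1 f y := hf.of_le (by exact_mod_cast le_top)
    filter_upwards [h1.eventually (by simp)] with y' h
    exact h.differentiableAt (by simp)
  have e : (fun y => chr (confForm f B) y v w) =ᶠ[𝓝 y] fun y => chr B y v w
      + fderiv ℝ f y v • w + fderiv ℝ f y w • v - B y v w • grad B f y := by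
    filter_upwards [eventually_differentiableAt hB, h, hfe] with y' h1 h2 h3
    exact chr_confForm h1 h2 h3 v w
  have hL := ((hC'.hasFDerivAt.clm_apply (hasFDerivAt_const v y)).clm_apply
    (hasFDerivAt_const w y)).fderiv
  have hR1 := (hC.hasFDerivAt.clm_apply (hasFDerivAt_const v y)).clm_apply (hasFDerivAt_const w y)
  have hR2 := (hf2.hasFDerivAt.clm_apply (hasFDerivAt_const v y)).smul (hasFDerivAt_const w y)
  have hR3 := (hf2.hasFDerivAt.clm_apply (hasFDerivAt_const w y)).smul (hasFDerivAt_const v y)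
  have hR4 := ((hBd.hasFDerivAt.clm_apply (hasFDerivAt_const v y)).clm_apply
    (hasFDerivAt_const w y)).smul hN.hasFDerivAt
  have hR := (((hR1.add hR2).add hR3).sub hR4).fderiv
  have e2 := hL.symm.trans ((e.fderiv_eq (𝕜 := ℝ)).trans hR)
  have e3 := DFunLike.congr_fun e2 u
  simp at e3
  rw [e3]
  module

lemma ricOp_confForm (hB : ContDiffAt ℝ ∞ B y) (h : ∀ᶠ y' in 𝓝 y, IsInnerForm (B y'))
    (hf : ContDiffAt ℝ ∞ f y) (v w u : E n) :
    ricOp (chr (confForm f B) y) (fderiv ℝ (chr (confForm f B)) y) v w u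
      = ricOp (chr B y) (fderiv ℝ (chr B) y) v w u
        + B y (lapOp B f y w) u • v - B y v w • lapOp B f y u
        - B y (lapOp B f y v) w • u + B y w u • lapOp B f y v
        + (fderiv ℝ f y v * fderiv ℝ f y w) • u - (fderiv ℝ f y w * fderiv ℝ f y u) • v
        - fderiv ℝ f y (grad B f y) • (B y v w • u - B y w u • v)
        + B y v w • fderiv ℝ f y u • grad B f y
        - fderiv ℝ f y v • B y w u • grad B f y := by
  have h0 := h.self_of_nhds
  have hBd : DifferentiableAt ℝ B y := hB.differentiableAt (by simp)
  have hfd : DifferentiableAt ℝ f y := hf.differentiableAt (by simp)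
  simp only [ricOp_apply, chr_confForm hBd h0 hfd, fderiv_chr_confForm hB h hf,
    form_lapOp hB h hf, fderiv_form_eq_chr hBd h]
  simp only [map_add, map_sub, map_smul, add_apply, smul_eq_mul,
    form_grad' h0, lapOp, ContinuousLinearMap.flip_apply]
  rw [fderiv_fderiv_symm hf v u, fderiv_fderiv_symm hf w u, chr_symm hBd h v u,
    chr_symm hBd h w u, h0.symm w u, h0.symm v (chr B y u w), h0.symm u (chr B y v w),
    h0.symm v u]
  module

lemma form_lapOp_symm (hB : ContDiffAt ℝ ∞ B y) (h : ∀ᶠ y' in 𝓝 y, IsInnerForm (B y'))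
    (hf : ContDiffAt ℝ ∞ f y) (v w : E n) :
    B y (lapOp B f y v) w = B y (lapOp B f y w) v := by
  rw [form_lapOp hB h hf, form_lapOp hB h hf, fderiv_fderiv_symm hf,
    chr_symm (hB.differentiableAt (by simp)) h]

/-- Each term of the conformal curvature operator is a multiple of the identity, a rank-one
operator, or the Hessian operator, so the traces are immediate. The trace of the identity produces
the dimension. -/
lemma ric_confForm (hB : ContDiffAt ℝ ∞ B y) (h : ∀ᶠ y' in 𝓝 y, IsInnerForm (B y'))
    (hf : ContDiffAt ℝ ∞ f y) (v w : E n) :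
    ric (chr (confForm f B) y) (fderiv ℝ (chr (confForm f B)) y) v w
      = ric (chr B y) (fderiv ℝ (chr B) y) v w - (n - 2) * B y (lapOp B f y v) w
        - B y v w * lap B f y + (n - 2) * (fderiv ℝ f y v * fderiv ℝ f y w)
        - (n - 2) * (fderiv ℝ f y (grad B f y) * B y v w) := by
  have h0 := h.self_of_nhds
  have e : ricOp (chr (confForm f B) y) (fderiv ℝ (chr (confForm f B)) y) v w
      = ricOp (chr B y) (fderiv ℝ (chr B) y) v w
        + (B y (lapOp B f y w)).smulRight v - B y v w • lapOp B f y
        - B y (lapOp B f y v) w • ContinuousLinearMap.id ℝ (E n)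
        + (B y w).smulRight (lapOp B f y v)
        + (fderiv ℝ f y v * fderiv ℝ f y w) • ContinuousLinearMap.id ℝ (E n)
        - fderiv ℝ f y w • (fderiv ℝ f y).smulRight v
        - fderiv ℝ f y (grad B f y) • (B y v w • ContinuousLinearMap.id ℝ (E n)
          - (B y w).smulRight v)
        + B y v w • (fderiv ℝ f y).smulRight (grad B f y)
        - fderiv ℝ f y v • (B y w).smulRight (grad B f y) := by
    ext1 u
    rw [ricOp_confForm hB h hf]
    simp only [add_apply, sub_apply, smul_apply, ContinuousLinearMap.smulRight_apply,
      ContinuousLinearMap.id_apply]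
    module
  rw [ric, e]
  simp only [tr_add, tr_sub, tr_smul, tr_id, tr_smulRight]
  rw [← ric, ← lap, form_lapOp_symm hB h hf w v, h0.symm w (lapOp B f y v), h0.symm w v,
    form_grad' h0]
  ring

lemma sharp_smul {B : Form n} (h : IsInnerForm B) {c : ℝ} (hc : 0 < c) (a : E n →L[ℝ] ℝ) :
    sharp (c • B) a = c⁻¹ • sharp B a := by
  refine (isInnerForm_smul h hc).eq_of_forall fun z => ?_
  rw [apply_sharp (isInnerForm_smul h hc)]
  simp [apply_sharp h, hc.ne']

/-- Contracting the Ricci law: the metric, the Hessian and `df ⊗ df` contract to `n`, `Δf` and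
`|df|²`, and the inverse metric contributes `e^{-2f}`. -/
lemma scal_confForm (hB : ContDiffAt ℝ ∞ B y) (h : ∀ᶠ y' in 𝓝 y, IsInnerForm (B y'))
    (hf : ContDiffAt ℝ ∞ f y) :
    scal (confForm f B) y = (Real.exp (2 * f y))⁻¹ * (scal B y - 2 * (n - 1) * lap B f y
      - (n - 1) * (n - 2) * fderiv ℝ f y (grad B f y)) := by
  have h0 := h.self_of_nhds
  have s1 : ∑ j : Fin n, B y (stdVec j) (sharp (B y) (coord j)) = n := by
    simp [h0.symm (stdVec _), apply_sharp h0, stdVec_apply]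
  have s2 : ∑ j : Fin n, B y (lapOp B f y (stdVec j)) (sharp (B y) (coord j)) = lap B f y := by
    simp only [h0.symm (lapOp B f y _), apply_sharp h0, lap, tr_eq_sum]
    rfl
  have s3 : ∑ j : Fin n, fderiv ℝ f y (stdVec j) * fderiv ℝ f y (sharp (B y) (coord j))
      = fderiv ℝ f y (grad B f y) := by
    rw [grad, sharp_eq_sum (B y) (fderiv ℝ f y)]
    simp
  have e : ∀ j : Fin n, sharp (confForm f B y) (coord j)
      = (Real.exp (2 * f y))⁻¹ • sharp (B y) (coord j) := fun j =>
    sharp_smul h0 (Real.exp_pos _) _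
  have e2 : ∀ j : Fin n, ric (chr (confForm f B) y) (fderiv ℝ (chr (confForm f B)) y) (stdVec j)
      (sharp (confForm f B y) (coord j)) = (Real.exp (2 * f y))⁻¹ *
        (ric (chr B y) (fderiv ℝ (chr B) y) (stdVec j) (sharp (B y) (coord j))
        - (n - 2) * B y (lapOp B f y (stdVec j)) (sharp (B y) (coord j))
        - B y (stdVec j) (sharp (B y) (coord j)) * lap B f y
        + (n - 2) * (fderiv ℝ f y (stdVec j) * fderiv ℝ f y (sharp (B y) (coord j)))
        - (n - 2) * (fderiv ℝ f y (grad B f y) * B y (stdVec j) (sharp (B y) (coord j)))) :=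
    fun j => by rw [e, ric_smul_right, ric_confForm hB h hf]
  simp only [scal, e2, ← Finset.mul_sum, Finset.sum_add_distrib, Finset.sum_sub_distrib,
    ← Finset.sum_mul, s1, s2, s3]
  ring

end Conformal

/-! ### The divergence -/

section Divergence

variable {B : E n → Form n} {f φ : E n → ℝ} {y : E n}

lemma differentiable_det :
    Differentiable ℝ (fun M : Fin n → Fin n → ℝ => (Matrix.of M).det) := by
  simp only [Matrix.det_apply, Matrix.of_apply]
  fun_prop

/-- Jacobi's formula. Along the line `M + t M'` the determinant factors as `det M · det(1 + t M⁻¹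
M')`, a polynomial in `t` whose linear coefficient is the trace. -/
lemma fderiv_det (M M' : Fin n → Fin n → ℝ) (hM : (Matrix.of M).det ≠ 0) :
    fderiv ℝ (fun M : Fin n → Fin n → ℝ => (Matrix.of M).det) M M'
      = (Matrix.of M).det * ((Matrix.of M)⁻¹ * Matrix.of M').trace := by
  have h1 := (differentiable_det M).lineDeriv_eq_fderiv (v := M')
  rw [← h1, lineDeriv]
  have h2 : ∀ t : ℝ, (Matrix.of (M + t • M')).det
      = (Matrix.of M).det * (1 + t • ((Matrix.of M)⁻¹ * Matrix.of M')).det := fun t => by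
    rw [← Matrix.det_mul, mul_add, mul_one, Matrix.mul_smul, ← mul_assoc,
      Matrix.mul_nonsing_inv _ (isUnit_iff_ne_zero.mpr hM), one_mul]
    rfl
  have h3 : ∀ (q : Polynomial ℝ) (c d : ℝ),
      deriv (fun t : ℝ => d * (1 + c * t + q.eval t * t ^ 2)) 0 = d * c := fun q c d => by
    have h4 := ((((hasDerivAt_id (0 : ℝ)).const_mul c).const_add 1).add
      ((q.hasDerivAt 0).mul ((hasDerivAt_id (0 : ℝ)).pow 2))).const_mul d
    have h5 := h4.deriv
    simp only [id] at h5
    refine h5.trans ?_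
    simp
  rw [← h3 _ _ _]
  congr 1
  ext t
  rw [h2, Matrix.det_one_add_smul]

lemma differentiableAt_matOf (hB : DifferentiableAt ℝ B y) :
    HasFDerivAt (fun y => (fun i j => matOf (B y) i j : Fin n → Fin n → ℝ))
      (ContinuousLinearMap.pi fun i => ContinuousLinearMap.pi fun j =>
        ((fderiv ℝ B y).flip (stdVec i)).flip (stdVec j)) y := by
  rw [hasFDerivAt_pi]
  intro i
  rw [hasFDerivAt_pi]
  intro j
  have h1 := (hB.hasFDerivAt.clm_apply (hasFDerivAt_const (stdVec i) y)).clm_apply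
    (hasFDerivAt_const (stdVec j) y)
  refine h1.congr_fderiv ?_
  ext v
  simp

lemma differentiableAt_det (hB : DifferentiableAt ℝ B y) :
    DifferentiableAt ℝ (fun y => (matOf (B y)).det) y :=
  (differentiable_det _).comp y (differentiableAt_matOf hB).differentiableAt

/-- By Jacobi's formula the derivative is the trace of `g⁻¹ ∂_u g`. In the trace of the Christoffel
map the other two Koszul terms cancel, because the inverse matrix is symmetric, leaving half of the
same trace. -/
lemma fderiv_det_matOf (hB : DifferentiableAt ℝ B y) (h : ∀ᶠ y' in 𝓝 y, IsInnerForm (B y'))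
    (u : E n) :
    fderiv ℝ (fun y => (matOf (B y)).det) y u = 2 * (matOf (B y)).det * tr (chr B y u) := by
  have h0 := h.self_of_nhds
  have h1 := ((differentiable_det (fun i j => matOf (B y) i j)).hasFDerivAt.comp y
    (differentiableAt_matOf hB)).fderiv
  have h2 : fderiv ℝ (fun y => (matOf (B y)).det) y = _ := h1
  rw [h2]
  refine (fderiv_det (fun i j => matOf (B y) i j) (fun i j => fderiv ℝ B y u (stdVec i) (stdVec j))
    (matOf_det_pos h0).ne').trans ?_
  have h3 : (Matrix.of fun i j => matOf (B y) i j) = matOf (B y) := rfl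
  rw [h3, mul_comm 2, mul_assoc]
  congr 1
  have h4 : tr (chr B y u) = ∑ j, ∑ k, (matOf (B y))⁻¹ j k * kos (fderiv ℝ B y) u (stdVec j)
      (stdVec k) := by
    rw [tr_eq_sum]
    refine Finset.sum_congr rfl fun j _ => ?_
    rw [chr_apply, sharp_eq_sum, ofLp_sum_apply]
    refine Finset.sum_congr rfl fun k _ => ?_
    rw [matOf_inv h0, PiLp.smul_apply, smul_eq_mul, mul_comm]
  have hs : ∀ j k, (matOf (B y))⁻¹ j k = (matOf (B y))⁻¹ k j := fun j k => by
    have := (matOf_posDef h0).inv.isHermitian.apply j k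
    simpa using this.symm
  have h5 : ∑ j, ∑ k, (matOf (B y))⁻¹ j k * fderiv ℝ B y (stdVec j) u (stdVec k)
      = ∑ j, ∑ k, (matOf (B y))⁻¹ j k * fderiv ℝ B y (stdVec k) u (stdVec j) := by
    rw [Finset.sum_comm]
    refine Finset.sum_congr rfl fun j _ => Finset.sum_congr rfl fun k _ => ?_
    rw [hs k j]
  rw [h4, Matrix.trace, Finset.mul_sum]
  simp only [Matrix.diag_apply, Matrix.mul_apply, kos_apply]
  rw [← Finset.mul_sum]
  have h6 : ∑ j, ∑ k, (matOf (B y))⁻¹ j k * (1 / 2 * (fderiv ℝ B y u (stdVec j) (stdVec k)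
      + fderiv ℝ B y (stdVec j) u (stdVec k) - fderiv ℝ B y (stdVec k) u (stdVec j)))
      = 1 / 2 * ∑ j, ∑ k, (matOf (B y))⁻¹ j k * fderiv ℝ B y u (stdVec j) (stdVec k) := by
    simp only [mul_add, mul_sub, Finset.sum_add_distrib, Finset.sum_sub_distrib]
    simp only [mul_left_comm _ (1 / 2 : ℝ), ← Finset.mul_sum]
    rw [h5]
    ring
  rw [h6]
  rw [← mul_assoc]
  norm_num
  refine Finset.sum_congr rfl fun j _ => Finset.sum_congr rfl fun k _ => ?_
  rw [fderiv_form_symm hB h]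

lemma fderiv_sqrt_det (hB : DifferentiableAt ℝ B y) (h : ∀ᶠ y' in 𝓝 y, IsInnerForm (B y'))
    (u : E n) :
    fderiv ℝ (fun y => √(matOf (B y)).det) y u = √(matOf (B y)).det * tr (chr B y u) := by
  have hp := matOf_det_pos h.self_of_nhds
  rw [fderiv_sqrt (differentiableAt_det hB) hp.ne', smul_apply,
    fderiv_det_matOf hB h, smul_eq_mul]
  have := Real.sq_sqrt hp.le
  have h2 : √(matOf (B y)).det ≠ 0 := (Real.sqrt_pos.mpr hp).ne'
  field_simp
  rw [this]

/-- `∂_i(√g φ ∇^i f) = √g (⟨dφ, df⟩ + φ Δf)`. -/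
lemma sum_partialDeriv_grad (hB : ContDiffAt ℝ ∞ B y) (h : ∀ᶠ y' in 𝓝 y, IsInnerForm (B y'))
    (hf : ContDiffAt ℝ ∞ f y) (hφ : DifferentiableAt ℝ φ y) :
    ∑ i, partialDeriv i (fun y => √(matOf (B y)).det * φ y * grad B f y i) y
      = √(matOf (B y)).det * (fderiv ℝ φ y (grad B f y) + φ y * lap B f y) := by
  have h0 := h.self_of_nhds
  have hBd : DifferentiableAt ℝ B y := hB.differentiableAt (by simp)
  have hN : DifferentiableAt ℝ (grad B f) y :=
    (contDiffAt_grad hB h0 hf).differentiableAt (by simp)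
  have hρ : DifferentiableAt ℝ (fun y => √(matOf (B y)).det) y :=
    (differentiableAt_det hBd).sqrt (matOf_det_pos h0).ne'
  have h1 : ∀ i, partialDeriv i (fun y => √(matOf (B y)).det * φ y * grad B f y i) y
      = √(matOf (B y)).det * φ y * fderiv ℝ (grad B f) y (stdVec i) i
        + √(matOf (B y)).det * (fderiv ℝ φ y (stdVec i) * grad B f y i)
        + √(matOf (B y)).det * φ y * (tr (chr B y (stdVec i)) * grad B f y i) := by
    intro i
    have h2 := ((hρ.hasFDerivAt.mul hφ.hasFDerivAt).mul
      (((coord i).hasFDerivAt (x := grad B f y)).comp y hN.hasFDerivAt)).fderiv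
    have h3 : fderiv ℝ (fun y => √(matOf (B y)).det * φ y * grad B f y i) y = _ := h2
    rw [partialDeriv, h3]
    simp only [add_apply, smul_apply, smul_eq_mul, ContinuousLinearMap.comp_apply,
      fderiv_sqrt_det hBd h]
    simp
    ring
  have e1 : ∀ a : E n →L[ℝ] ℝ, ∑ i, a (stdVec i) * grad B f y i = a (grad B f y) := fun a => by
    have := DFunLike.congr_fun (dual_eq_sum a) (grad B f y)
    simpa using this.symm
  have e2 : ∑ i, tr (chr B y (stdVec i)) * grad B f y i = tr ((chr B y).flip (grad B f y)) := by
    have e3 : (chr B y).flip (grad B f y) = chr B y (grad B f y) := by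
      ext1 u
      rw [ContinuousLinearMap.flip_apply, chr_symm hBd h]
    rw [e3]
    conv_rhs => rw [← sum_smul_stdVec (grad B f y)]
    simp only [tr_eq_sum, map_sum, map_smul, sum_apply, smul_apply, ofLp_sum_apply,
      PiLp.smul_apply, smul_eq_mul]
    simp only [Finset.sum_mul]
    rw [Finset.sum_comm]
    exact Finset.sum_congr rfl fun j _ => Finset.sum_congr rfl fun i _ => mul_comm _ _
  rw [Finset.sum_congr rfl fun i _ => h1 i]
  simp only [Finset.sum_add_distrib, ← Finset.mul_sum]
  rw [e1, e2]
  rw [lap, lapOp, tr_add, tr_eq_sum (fderiv ℝ (grad B f) y)]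
  ring

end Divergence

section Parametrization

variable {n : ℕ} {X : Type*} [TopologicalSpace X] [ChartedSpace (E n) X]
  [IsManifold 𝓘(ℝ, E n) ∞ X]

/-! ### Parametrizations -/

/-- The differential of `ψ` at `y`, as an endomorphism of `ℝⁿ`. -/
def dmap (ψ : E n → X) (y : E n) : E n →L[ℝ] E n := mfderiv 𝓘(ℝ, E n) 𝓘(ℝ, E n) ψ y

/-- The value of `g` at `x`, as a bilinear form on `ℝⁿ`. -/
def ginner (g : Metric n X) (x : X) : Form n := g.inner x

/-- The pull-back of `g` by `ψ`, as a bilinear form. -/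
def pform (g : Metric n X) (ψ : E n → X) (y : E n) : Form n :=
  pullForm (ginner g (ψ y)) (dmap ψ y)

lemma pform_apply (g : Metric n X) (ψ : E n → X) (y v w : E n) :
    pform g ψ y v w = pullback g ψ y v w := rfl

lemma isInnerForm_ginner (g : Metric n X) (x : X) : IsInnerForm (ginner g x) where
  symm v w := g.symm x v w
  pos v hv := g.pos x v hv

lemma coeff_eq (g : Metric n X) (x : X) :
    coeff g x = fun y => matOf (pform g (chartAt (E n) x).symm y) := rfl

/-- `ψ` is smooth and a local diffeomorphism near `y`. -/
def RegAt (ψ : E n → X) (y : E n) : Prop :=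
  ∀ᶠ y' in 𝓝 y, ContMDiffAt 𝓘(ℝ, E n) 𝓘(ℝ, E n) ∞ ψ y' ∧
    Function.Bijective (dmap ψ y')

omit [IsManifold 𝓘(ℝ, E n) ∞ X] in
lemma RegAt.eventually {ψ : E n → X} {y : E n} (h : RegAt ψ y) : ∀ᶠ y' in 𝓝 y, RegAt ψ y' :=
  eventually_eventually_nhds.mpr h

omit [IsManifold 𝓘(ℝ, E n) ∞ X] in
lemma RegAt.contMDiffAt {ψ : E n → X} {y : E n} (h : RegAt ψ y) :
    ContMDiffAt 𝓘(ℝ, E n) 𝓘(ℝ, E n) ∞ ψ y := h.self_of_nhds.1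

omit [IsManifold 𝓘(ℝ, E n) ∞ X] in
lemma RegAt.bijective {ψ : E n → X} {y : E n} (h : RegAt ψ y) :
    Function.Bijective (dmap ψ y) := h.self_of_nhds.2

omit [IsManifold 𝓘(ℝ, E n) ∞ X] in
lemma RegAt.of_isLocalDiffeomorphAt {ψ : E n → X} {y : E n}
    (h : IsLocalDiffeomorphAt 𝓘(ℝ, E n) 𝓘(ℝ, E n) ∞ ψ y) : RegAt ψ y := by
  obtain ⟨Φ, hy, he⟩ := h
  filter_upwards [Φ.open_source.mem_nhds hy] with y' hy'
  have h' : IsLocalDiffeomorphAt 𝓘(ℝ, E n) 𝓘(ℝ, E n) ∞ ψ y' := ⟨Φ, hy', he⟩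
  exact ⟨h'.contMDiffAt, (h'.mfderivToContinuousLinearEquiv (by simp)).bijective⟩

lemma RegAt.isInnerForm {ψ : E n → X} {y : E n} (h : RegAt ψ y) (g : Metric n X) :
    IsInnerForm (pform g ψ y) := (isInnerForm_ginner g _).pullForm h.bijective.injective

lemma RegAt.eventually_isInnerForm {ψ : E n → X} {y : E n} (h : RegAt ψ y) (g : Metric n X) :
    ∀ᶠ y' in 𝓝 y, IsInnerForm (pform g ψ y') := h.eventually.mono fun _ h => h.isInnerForm g

omit [IsManifold 𝓘(ℝ, E n) ∞ X] in
lemma dmap_comp {ψ ξ : E n → X} {θ : E n → E n} {y : E n}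
    (he : ψ =ᶠ[𝓝 y] ξ ∘ θ) (hξ : MDifferentiableAt 𝓘(ℝ, E n) 𝓘(ℝ, E n) ξ (θ y))
    (hθ : DifferentiableAt ℝ θ y) : dmap ψ y = (dmap ξ (θ y)).comp (fderiv ℝ θ y) := by
  have h1 : mfderiv 𝓘(ℝ, E n) 𝓘(ℝ, E n) (ξ ∘ θ) y = (mfderiv 𝓘(ℝ, E n) 𝓘(ℝ, E n) ξ (θ y)).comp
      (mfderiv 𝓘(ℝ, E n) 𝓘(ℝ, E n) θ y) := mfderiv_comp y hξ hθ.mdifferentiableAt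
  rw [mfderiv_eq_fderiv] at h1
  exact (he.mfderiv_eq (I := 𝓘(ℝ, E n)) (I' := 𝓘(ℝ, E n))).trans h1

lemma pform_comp (g : Metric n X) {ψ ξ : E n → X} {θ : E n → E n} {y : E n}
    (he : ψ =ᶠ[𝓝 y] ξ ∘ θ) (hξ : MDifferentiableAt 𝓘(ℝ, E n) 𝓘(ℝ, E n) ξ (θ y))
    (hθ : DifferentiableAt ℝ θ y) : pform g ψ y = pullForm (pform g ξ (θ y)) (fderiv ℝ θ y) := by
  rw [pform, pform, dmap_comp he hξ hθ, he.self_of_nhds]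
  rfl

/-- The transition map from the parametrization `ψ` to the chart at `x₀`. -/
def trans (x₀ : X) (ψ : E n → X) (y : E n) : E n := chartAt (E n) x₀ (ψ y)

variable {ψ : E n → X} {y : E n} {x₀ : X}

omit [IsManifold 𝓘(ℝ, E n) ∞ X] in
lemma eq_symm_comp_trans (hψ : ContinuousAt ψ y) (hx : ψ y ∈ (chartAt (E n) x₀).source) :
    ψ =ᶠ[𝓝 y] (chartAt (E n) x₀).symm ∘ trans x₀ ψ := by
  filter_upwards [hψ.eventually ((chartAt (E n) x₀).open_source.mem_nhds hx)] with y' h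
  exact ((chartAt (E n) x₀).left_inv h).symm

lemma contMDiffAt_chart_symm {z : E n} (hz : z ∈ (chartAt (E n) x₀).target) :
    ContMDiffAt 𝓘(ℝ, E n) 𝓘(ℝ, E n) ∞ (chartAt (E n) x₀).symm z :=
  (contMDiffOn_chart_symm (I := 𝓘(ℝ, E n))).contMDiffAt
    ((chartAt (E n) x₀).open_target.mem_nhds hz)

lemma contMDiffAt_chart {x : X} (hx : x ∈ (chartAt (E n) x₀).source) :
    ContMDiffAt 𝓘(ℝ, E n) 𝓘(ℝ, E n) ∞ (chartAt (E n) x₀) x :=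
  (contMDiffOn_chart (I := 𝓘(ℝ, E n))).contMDiffAt
    ((chartAt (E n) x₀).open_source.mem_nhds hx)

lemma contDiffAt_trans (hψ : ContMDiffAt 𝓘(ℝ, E n) 𝓘(ℝ, E n) ∞ ψ y)
    (hx : ψ y ∈ (chartAt (E n) x₀).source) : ContDiffAt ℝ ∞ (trans x₀ ψ) y :=
  contMDiffAt_iff_contDiffAt.mp ((contMDiffAt_chart hx).comp y hψ)

lemma mfderiv_chart_bijective {x : X} (hx : x ∈ (chartAt (E n) x₀).source) :
    Function.Bijective (mfderiv 𝓘(ℝ, E n) 𝓘(ℝ, E n) (chartAt (E n) x₀) x) :=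
  (isInvertible_mfderiv_extChartAt (I := 𝓘(ℝ, E n)) (x := x₀) (y := x)
    (by simpa using hx)).bijective

lemma fderiv_trans_bijective (h : RegAt ψ y) (hx : ψ y ∈ (chartAt (E n) x₀).source) :
    Function.Bijective (fderiv ℝ (trans x₀ ψ) y) := by
  have h1 : mfderiv 𝓘(ℝ, E n) 𝓘(ℝ, E n) (chartAt (E n) x₀ ∘ ψ) y
      = (mfderiv 𝓘(ℝ, E n) 𝓘(ℝ, E n) (chartAt (E n) x₀) (ψ y)).comp
      (mfderiv 𝓘(ℝ, E n) 𝓘(ℝ, E n) ψ y) :=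
    mfderiv_comp y ((contMDiffAt_chart hx).mdifferentiableAt (by simp))
      (h.contMDiffAt.mdifferentiableAt (by simp))
  rw [mfderiv_eq_fderiv] at h1
  have h2 : fderiv ℝ (trans x₀ ψ) y = _ := h1
  rw [h2]
  exact (mfderiv_chart_bijective hx).comp h.bijective

lemma pform_eq_trans (g : Metric n X) (hψ : ContMDiffAt 𝓘(ℝ, E n) 𝓘(ℝ, E n) ∞ ψ y)
    (hx : ψ y ∈ (chartAt (E n) x₀).source) :
    pform g ψ y = pullForm (pform g (chartAt (E n) x₀).symm (trans x₀ ψ y))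
      (fderiv ℝ (trans x₀ ψ) y) :=
  pform_comp g (eq_symm_comp_trans hψ.continuousAt hx)
    ((contMDiffAt_chart_symm ((chartAt (E n) x₀).map_source hx)).mdifferentiableAt (by simp))
    ((contDiffAt_trans hψ hx).differentiableAt (by simp))

lemma regAt_chart_symm {z : E n} (hz : z ∈ (chartAt (E n) x₀).target) :
    RegAt (chartAt (E n) x₀).symm z := by
  filter_upwards [(chartAt (E n) x₀).open_target.mem_nhds hz] with z' hz'
  refine ⟨contMDiffAt_chart_symm hz', ?_⟩
  have h := isInvertible_mfderivWithin_extChartAt_symm (I := 𝓘(ℝ, E n)) (x := x₀) (y := z')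
    (by simpa using hz')
  rw [modelWithCornersSelf_coe, Set.range_id, mfderivWithin_univ] at h
  exact h.bijective

/-- The coordinate expression of a field of bilinear forms in the chart at `x₀`. -/
def formInChart (s : X → Form n) (x₀ : X) (x : X) : Form n :=
  pullForm (s x) (dmap (chartAt (E n) x₀).symm (chartAt (E n) x₀ x))

/-- In the tangent trivialization centred at `x₀` the inverse is the differential of the inverse
chart. Smoothness of a section of the bundle of forms thereby becomes smoothness of a function with
values in the fixed space of forms. -/
lemma contMDiffAt_section_iff (s : ∀ x : X, TangentSpace 𝓘(ℝ, E n) x →L[ℝ]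
    TangentSpace 𝓘(ℝ, E n) x →L[ℝ] ℝ) (x₀ : X) :
    ContMDiffAt 𝓘(ℝ, E n) (𝓘(ℝ, E n).prod 𝓘(ℝ, E n →L[ℝ] E n →L[ℝ] ℝ)) ∞
      (fun x => Bundle.TotalSpace.mk' (E n →L[ℝ] E n →L[ℝ] ℝ)
        (E := fun x : X => TangentSpace 𝓘(ℝ, E n) x →L[ℝ] TangentSpace 𝓘(ℝ, E n) x →L[ℝ] ℝ)
        x (s x)) x₀
      ↔ ContMDiffAt 𝓘(ℝ, E n) 𝓘(ℝ, Form n) ∞ (formInChart (fun x => (s x : Form n)) x₀) x₀ := by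
  rw [contMDiffAt_hom_bundle]
  have H : (fun x => ContinuousLinearMap.inCoordinates (E n) (TangentSpace 𝓘(ℝ, E n)) (E n →L[ℝ] ℝ)
      (fun x : X => TangentSpace 𝓘(ℝ, E n) x →L[ℝ] ℝ) x₀ x x₀ x (s x))
      =ᶠ[𝓝 x₀] formInChart (fun x => (s x : Form n)) x₀ := by
    filter_upwards [(chartAt (E n) x₀).open_source.mem_nhds (mem_chart_source (E n) x₀)] with x hx
    have hs : (trivializationAt (E n) (TangentSpace 𝓘(ℝ, E n)) x₀).symmL ℝ x
        = dmap (chartAt (E n) x₀).symm (chartAt (E n) x₀ x) := by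
      rw [TangentBundle.symmL_trivializationAt hx, modelWithCornersSelf_coe, Set.range_id,
        mfderivWithin_univ]
      rfl
    have hx' : x ∈ (trivializationAt (E n →L[ℝ] ℝ)
        (fun x : X => TangentSpace 𝓘(ℝ, E n) x →L[ℝ] ℝ) x₀).baseSet := by
      simpa using hx
    ext v w
    rw [ContinuousLinearMap.inCoordinates]
    simp only [ContinuousLinearMap.comp_apply]
    rw [Bundle.Trivialization.continuousLinearMapAt_apply, Bundle.Trivialization.linearMapAt_apply,
      if_pos hx', hom_trivializationAt_apply, ContinuousLinearMap.inCoordinates]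
    simp only [ContinuousLinearMap.comp_apply]
    rw [hs]
    simp
    rfl
  exact ⟨fun h => h.2.congr_of_eventuallyEq H.symm,
    fun h => ⟨contMDiffAt_id, h.congr_of_eventuallyEq H⟩⟩

end Parametrization

/-! ### Scalar curvature, gradient and Laplacian in arbitrary parametrizations. -/

section Invariants

variable {n : ℕ} {X : Type*} [TopologicalSpace X] [ChartedSpace (E n) X]
  [IsManifold 𝓘(ℝ, E n) ∞ X]

variable {g : Metric n X} {ψ : E n → X} {y : E n} {x₀ : X}

lemma contDiffAt_pform_chart (g : Metric n X) (x₀ : X) :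
    ContDiffAt ℝ ∞ (pform g (chartAt (E n) x₀).symm) (chartAt (E n) x₀ x₀) := by
  have h1 := (contMDiffAt_section_iff g.inner x₀).mp g.contMDiff.contMDiffAt
  have hz : chartAt (E n) x₀ x₀ ∈ (chartAt (E n) x₀).target := mem_chart_target (E n) x₀
  have h2 : ContMDiffAt 𝓘(ℝ, E n) 𝓘(ℝ, Form n) ∞ (formInChart (ginner g) x₀ ∘
      (chartAt (E n) x₀).symm) (chartAt (E n) x₀ x₀) := by
    refine ContMDiffAt.comp _ ?_ (contMDiffAt_chart_symm hz)
    rw [(chartAt (E n) x₀).left_inv (mem_chart_source (E n) x₀)]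
    exact h1
  refine (contMDiffAt_iff_contDiffAt.mp h2).congr_of_eventuallyEq ?_
  filter_upwards [(chartAt (E n) x₀).open_target.mem_nhds hz] with z hz
  rw [Function.comp_apply, formInChart, (chartAt (E n) x₀).right_inv hz]
  rfl

lemma contMDiffAt_section_of_chart (s : ∀ x : X, TangentSpace 𝓘(ℝ, E n) x →L[ℝ]
    TangentSpace 𝓘(ℝ, E n) x →L[ℝ] ℝ) (x₀ : X)
    (h : ContDiffAt ℝ ∞ (fun z => pullForm (s ((chartAt (E n) x₀).symm z) : Form n)
      (dmap (chartAt (E n) x₀).symm z)) (chartAt (E n) x₀ x₀)) :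
    ContMDiffAt 𝓘(ℝ, E n) (𝓘(ℝ, E n).prod 𝓘(ℝ, E n →L[ℝ] E n →L[ℝ] ℝ)) ∞
      (fun x => Bundle.TotalSpace.mk' (E n →L[ℝ] E n →L[ℝ] ℝ)
        (E := fun x : X => TangentSpace 𝓘(ℝ, E n) x →L[ℝ] TangentSpace 𝓘(ℝ, E n) x →L[ℝ] ℝ)
        x (s x)) x₀ := by
  rw [contMDiffAt_section_iff]
  have h1 := (contMDiffAt_iff_contDiffAt.mpr h).comp x₀
    (contMDiffAt_chart (mem_chart_source (E n) x₀))
  refine h1.congr_of_eventuallyEq ?_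
  filter_upwards [(chartAt (E n) x₀).open_source.mem_nhds (mem_chart_source (E n) x₀)] with x hx
  -- The type of `s x` depends on `x`, so the equality of base points is eliminated by cases instead
  -- of being rewritten.
  have e : ∀ x', x' = x → pullForm (s x : Form n) (dmap (chartAt (E n) x₀).symm (chartAt (E n) x₀ x))
      = pullForm (s x' : Form n) (dmap (chartAt (E n) x₀).symm (chartAt (E n) x₀ x)) := by
    rintro _ rfl
    rfl
  exact e _ ((chartAt (E n) x₀).left_inv hx)

lemma RegAt.eventuallyEq_pullForm (h : RegAt ψ y) (g : Metric n X)
    (hx : ψ y ∈ (chartAt (E n) x₀).source) :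
    pform g ψ =ᶠ[𝓝 y] fun y => pullForm (pform g (chartAt (E n) x₀).symm (trans x₀ ψ y))
      (fderiv ℝ (trans x₀ ψ) y) := by
  filter_upwards [h, h.contMDiffAt.continuousAt.eventually
    ((chartAt (E n) x₀).open_source.mem_nhds hx)] with y' h1 h2
  exact pform_eq_trans g h1.1 h2

lemma RegAt.eventually_contDiffAt_trans (h : RegAt ψ y) (hx : ψ y ∈ (chartAt (E n) x₀).source) :
    ∀ᶠ y' in 𝓝 y, ContDiffAt ℝ ∞ (trans x₀ ψ) y' := by
  filter_upwards [h, h.contMDiffAt.continuousAt.eventually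
    ((chartAt (E n) x₀).open_source.mem_nhds hx)] with y' h1 h2
  exact contDiffAt_trans h1.1 h2

lemma RegAt.eventually_bijective_trans (h : RegAt ψ y) (hx : ψ y ∈ (chartAt (E n) x₀).source) :
    ∀ᶠ y' in 𝓝 y, Function.Bijective (fderiv ℝ (trans x₀ ψ) y') := by
  filter_upwards [h.eventually, h.contMDiffAt.continuousAt.eventually
    ((chartAt (E n) x₀).open_source.mem_nhds hx)] with y' h1 h2
  exact fderiv_trans_bijective h1 h2

lemma RegAt.contDiffAt_pform (h : RegAt ψ y) (g : Metric n X) : ContDiffAt ℝ ∞ (pform g ψ) y := by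
  have hx := mem_chart_source (E n) (ψ y)
  exact (contDiffAt_pullForm (contDiffAt_pform_chart g (ψ y))
    (h.eventually_contDiffAt_trans hx).self_of_nhds).congr_of_eventuallyEq
    (h.eventuallyEq_pullForm g hx)

/-- The scalar curvature in an arbitrary parametrization. -/
lemma RegAt.scalarCurvature_eq (h : RegAt ψ y) (g : Metric n X) :
    scalarCurvature g (ψ y) = scal (pform g ψ) y := by
  have hx := mem_chart_source (E n) (ψ y)
  have hr := regAt_chart_symm (mem_chart_target (E n) (ψ y))
  rw [scalarCurvature, coeff_eq, scalarCoord_matOf (contDiffAt_pform_chart g (ψ y))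
    (hr.eventually_isInnerForm g)]
  exact (scal_pullForm (ψ := trans (ψ y) ψ) (contDiffAt_pform_chart g (ψ y))
    (h.eventually_contDiffAt_trans hx) (h.eventuallyEq_pullForm g hx)
    (hr.eventually_isInnerForm g) (h.eventually_bijective_trans hx)).symm

/-- The differential of a function, as a linear form on `ℝⁿ`. -/
def dX (u : X → ℝ) (x : X) : E n →L[ℝ] ℝ := mfderiv 𝓘(ℝ, E n) 𝓘(ℝ, ℝ) u x

/-- The inner product `⟨du, dv⟩` of two differentials. -/
def gradInner (g : Metric n X) (u v : X → ℝ) (x : X) : ℝ := dX u x (sharp (ginner g x) (dX v x))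

omit [IsManifold 𝓘(ℝ, E n) ∞ X] in
lemma fderiv_comp_param {u : X → ℝ} (hu : MDifferentiableAt 𝓘(ℝ, E n) 𝓘(ℝ, ℝ) u (ψ y))
    (hψ : MDifferentiableAt 𝓘(ℝ, E n) 𝓘(ℝ, E n) ψ y) :
    fderiv ℝ (u ∘ ψ) y = (dX u (ψ y)).comp (dmap ψ y) := by
  have h1 : mfderiv 𝓘(ℝ, E n) 𝓘(ℝ, ℝ) (u ∘ ψ) y = (mfderiv 𝓘(ℝ, E n) 𝓘(ℝ, ℝ) u (ψ y)).comp
      (mfderiv 𝓘(ℝ, E n) 𝓘(ℝ, E n) ψ y) := mfderiv_comp y hu hψ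
  rw [mfderiv_eq_fderiv] at h1
  exact h1

/-- Gradients push forward: both sides represent the same linear form with respect to `B`, as seen
by testing on the image of `A`. -/
lemma sharp_pullForm {B : Form n} (h : IsInnerForm B) {A : E n →L[ℝ] E n}
    (hA : Function.Bijective A) (a : E n →L[ℝ] ℝ) :
    A (sharp (pullForm B A) (a.comp A)) = sharp B a := by
  refine h.eq_of_forall fun z' => ?_
  obtain ⟨z, rfl⟩ := hA.surjective z'
  rw [apply_sharp h]
  exact DFunLike.congr_fun (apply_sharp (h.pullForm hA.injective) (a.comp A)) z

lemma RegAt.gradInner_eq (h : RegAt ψ y) (g : Metric n X) {u v : X → ℝ}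
    (hu : MDifferentiableAt 𝓘(ℝ, E n) 𝓘(ℝ, ℝ) u (ψ y))
    (hv : MDifferentiableAt 𝓘(ℝ, E n) 𝓘(ℝ, ℝ) v (ψ y)) :
    gradInner g u v (ψ y) = fderiv ℝ (u ∘ ψ) y (grad (pform g ψ) (v ∘ ψ) y) := by
  have hψ := h.contMDiffAt.mdifferentiableAt (by simp)
  rw [gradInner, grad, fderiv_comp_param hu hψ, fderiv_comp_param hv hψ, pform,
    ContinuousLinearMap.comp_apply, sharp_pullForm (isInnerForm_ginner g _) h.bijective]

lemma gradSq_eq (g : Metric n X) {u : X → ℝ} {x : X}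
    (hu : MDifferentiableAt 𝓘(ℝ, E n) 𝓘(ℝ, ℝ) u x) : gradSq g u x = gradInner g u u x := by
  have hr := regAt_chart_symm (mem_chart_target (E n) x)
  have hx : (chartAt (E n) x).symm (chartAt (E n) x x) = x :=
    (chartAt (E n) x).left_inv (mem_chart_source (E n) x)
  have h1 := hr.gradInner_eq g (u := u) (v := u) (by rwa [hx]) (by rwa [hx])
  rw [hx] at h1
  rw [h1, gradSq, coeff_eq]
  have h2 : (fun y => u ((chartAt (E n) x).symm y)) = u ∘ (chartAt (E n) x).symm := rfl
  rw [h2, grad, sharp_eq_sum]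
  simp only [map_sum, map_smul, smul_eq_mul]
  rw [Finset.sum_comm]
  refine Finset.sum_congr rfl fun j _ => ?_
  have h3 := DFunLike.congr_fun
    (dual_eq_sum (fderiv ℝ (u ∘ (chartAt (E n) x).symm) (chartAt (E n) x x)))
    (sharp (pform g (chartAt (E n) x).symm (chartAt (E n) x x)) (coord j))
  rw [h3]
  simp only [sum_apply, smul_apply, smul_eq_mul, matOf_inv (hr.isInnerForm g), Finset.mul_sum]
  refine Finset.sum_congr rfl fun i _ => ?_
  rw [partialDeriv, partialDeriv, PiLp.proj_apply]
  ring

lemma gradInner_self_nonneg (g : Metric n X) (u : X → ℝ) (x : X) : 0 ≤ gradInner g u u x := by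
  rw [gradInner, ← DFunLike.congr_fun (apply_sharp (isInnerForm_ginner g x) (dX u x))]
  exact (isInnerForm_ginner g x).nonneg _

/-- The Laplacian `Δ_g f`. -/
def lapX (g : Metric n X) (f : X → ℝ) (x : X) : ℝ :=
  lap (pform g (chartAt (E n) x).symm) (f ∘ (chartAt (E n) x).symm) (chartAt (E n) x x)

/-- No second-order computation is needed. The conformal law expresses `Δf` through the scalar
curvatures of `B` and `e^{2f} B` and through `|df|²`, all already known to be invariant. Solving for
the Laplacian divides by `n - 1`. -/
lemma lap_pullForm (hn : n ≠ 1) {H B : E n → Form n} {θ : E n → E n} {f : E n → ℝ} {y : E n}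
    (hH : ContDiffAt ℝ ∞ H (θ y)) (hf : ContDiffAt ℝ ∞ f (θ y))
    (hθ : ∀ᶠ y' in 𝓝 y, ContDiffAt ℝ ∞ θ y')
    (hB : B =ᶠ[𝓝 y] fun y => pullForm (H (θ y)) (fderiv ℝ θ y))
    (hi : ∀ᶠ x in 𝓝 (θ y), IsInnerForm (H x))
    (hA : ∀ᶠ y' in 𝓝 y, Function.Bijective (fderiv ℝ θ y')) :
    lap B (f ∘ θ) y = lap H f (θ y) := by
  have hBy := hB.self_of_nhds
  have hBd : ContDiffAt ℝ ∞ B y :=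
    (contDiffAt_pullForm hH hθ.self_of_nhds).congr_of_eventuallyEq hB
  have hiB : ∀ᶠ y' in 𝓝 y, IsInnerForm (B y') := by
    filter_upwards [hB, hA, hθ.self_of_nhds.continuousAt.eventually hi] with y' h1 h2 h3
    rw [h1]
    exact h3.pullForm h2.injective
  have hfθ : ContDiffAt ℝ ∞ (f ∘ θ) y := hf.comp y hθ.self_of_nhds
  have h1 := scal_pullForm hH hθ hB hi hA
  have h2 : scal (confForm (f ∘ θ) B) y = scal (confForm f H) (θ y) := by
    refine scal_pullForm (contDiffAt_confForm hH hf) hθ ?_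
      (hi.mono fun x h => isInnerForm_smul h (Real.exp_pos _)) hA
    filter_upwards [hB] with y' h
    rw [confForm, h]
    rfl
  rw [scal_confForm hBd hiB hfθ, scal_confForm hH hi hf, h1] at h2
  have h3 : fderiv ℝ (f ∘ θ) y (grad B (f ∘ θ) y) = fderiv ℝ f (θ y) (grad H f (θ y)) := by
    have h4 : fderiv ℝ (f ∘ θ) y = (fderiv ℝ f (θ y)).comp (fderiv ℝ θ y) :=
      fderiv_comp y (hf.differentiableAt (by simp))
        (hθ.self_of_nhds.differentiableAt (by simp))
    rw [grad, h4, hBy, ContinuousLinearMap.comp_apply, sharp_pullForm hi.self_of_nhds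
      hA.self_of_nhds]
    rfl
  rw [h3] at h2
  have h5 := mul_left_cancel₀ (inv_ne_zero (Real.exp_pos _).ne') h2
  have h6 : (n : ℝ) - 1 ≠ 0 := sub_ne_zero.mpr (by exact_mod_cast hn)
  have h7 : 2 * ((n : ℝ) - 1) * lap B (f ∘ θ) y = 2 * ((n : ℝ) - 1) * lap H f (θ y) := by
    linarith
  exact mul_left_cancel₀ (mul_ne_zero two_ne_zero h6) h7

lemma RegAt.lapX_eq (hn : n ≠ 1) (h : RegAt ψ y) (g : Metric n X) {f : X → ℝ}
    (hf : ContMDiffAt 𝓘(ℝ, E n) 𝓘(ℝ, ℝ) ∞ f (ψ y)) :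
    lapX g f (ψ y) = lap (pform g ψ) (f ∘ ψ) y := by
  have hx := mem_chart_source (E n) (ψ y)
  have hr := regAt_chart_symm (mem_chart_target (E n) (ψ y))
  have hf' : ContDiffAt ℝ ∞ (f ∘ (chartAt (E n) (ψ y)).symm) (chartAt (E n) (ψ y) (ψ y)) := by
    rw [← contMDiffAt_iff_contDiffAt]
    refine ContMDiffAt.comp _ ?_ hr.contMDiffAt
    rwa [(chartAt (E n) (ψ y)).left_inv hx]
  have h1 := lap_pullForm hn (θ := trans (ψ y) ψ) (contDiffAt_pform_chart g (ψ y)) hf'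
    (h.eventually_contDiffAt_trans hx) (h.eventuallyEq_pullForm g hx)
    (hr.eventually_isInnerForm g) (h.eventually_bijective_trans hx)
  refine h1.symm.trans ?_
  have h2 : (f ∘ (chartAt (E n) (ψ y)).symm) ∘ trans (ψ y) ψ =ᶠ[𝓝 y] f ∘ ψ := by
    filter_upwards [eq_symm_comp_trans h.contMDiffAt.continuousAt hx] with y' h
    exact congrArg f h.symm
  have h3 : grad (pform g ψ) ((f ∘ (chartAt (E n) (ψ y)).symm) ∘ trans (ψ y) ψ)
      =ᶠ[𝓝 y] grad (pform g ψ) (f ∘ ψ) := by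
    filter_upwards [h2.fderiv (𝕜 := ℝ)] with y' h
    rw [grad, grad, h]
  rw [lap, lap, lapOp, lapOp, h3.fderiv_eq, h3.self_of_nhds]

end Invariants

/-! ### Conformal metrics on a manifold and the conformal law of the energy density. -/

section ConformalMetric

variable {n : ℕ}

/-- Compactness of the unit sphere and homogeneity. The bound supplies the boundedness of unit balls
required of a bundled metric, and later measures closeness of inner products. -/
lemma IsInnerForm.exists_lower_bound {B : Form n} (h : IsInnerForm B) :
    ∃ c > 0, ∀ v, c * ‖v‖ ^ 2 ≤ B v v := by
  have hc : IsCompact (Metric.sphere (0 : E n) 1) := isCompact_sphere 0 1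
  have hcont : Continuous fun v : E n => B v v := by fun_prop
  obtain ⟨c, hc0, hcb⟩ : ∃ c > 0, ∀ v ∈ Metric.sphere (0 : E n) 1, c ≤ B v v := by
    by_cases hne : (Metric.sphere (0 : E n) 1).Nonempty
    · obtain ⟨v0, hv0, hmin⟩ := hc.exists_isMinOn hne hcont.continuousOn
      refine ⟨B v0 v0, h.pos v0 ?_, fun v hv => hmin hv⟩
      rintro rfl
      simp at hv0
    -- The sphere is empty when `n = 0`; any constant then works.
    · exact ⟨1, one_pos, fun v hv => absurd ⟨v, hv⟩ hne⟩
  refine ⟨c, hc0, fun v => ?_⟩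
  by_cases hv : v = 0
  · simp [hv]
  have hn : ‖v‖ ≠ 0 := norm_ne_zero_iff.mpr hv
  have h1 := hcb (‖v‖⁻¹ • v) (by simp [norm_smul, hn])
  simp only [map_smul, smul_apply, smul_eq_mul] at h1
  have h2 : ‖v‖⁻¹ * (‖v‖⁻¹ * B v v) * ‖v‖ ^ 2 = B v v := by field_simp
  rw [← h2]
  gcongr

variable {X : Type*} [TopologicalSpace X] [ChartedSpace (E n) X] [IsManifold 𝓘(ℝ, E n) ∞ X]

/-- A smooth Riemannian metric from a smooth field of inner products. -/
def mkMetric (s : ∀ x : X, TangentSpace 𝓘(ℝ, E n) x →L[ℝ] TangentSpace 𝓘(ℝ, E n) x →L[ℝ] ℝ)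
    (hs : ∀ x, IsInnerForm (n := n) (s x))
    (hc : ContMDiff 𝓘(ℝ, E n) (𝓘(ℝ, E n).prod 𝓘(ℝ, E n →L[ℝ] E n →L[ℝ] ℝ)) ∞
      (fun x => Bundle.TotalSpace.mk' (E n →L[ℝ] E n →L[ℝ] ℝ)
        (E := fun x : X => TangentSpace 𝓘(ℝ, E n) x →L[ℝ] TangentSpace 𝓘(ℝ, E n) x →L[ℝ] ℝ)
        x (s x))) : Metric n X where
  inner := s
  symm x v w := (hs x).symm v w
  pos x v hv := (hs x).pos v hv
  isVonNBounded x := by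
    obtain ⟨c, hc, h⟩ := (hs x).exists_lower_bound
    have h1 : Bornology.IsVonNBounded ℝ {v : E n | (s x : Form n) v v < 1} := by
      rw [NormedSpace.isVonNBounded_iff, Metric.isBounded_iff_subset_closedBall 0]
      refine ⟨√(c⁻¹), fun v hv => ?_⟩
      rw [mem_closedBall_zero_iff]
      refine Real.le_sqrt_of_sq_le ?_
      rw [← one_div, le_div_iff₀ hc, mul_comm]
      exact (h v).trans hv.le
    exact h1
  contMDiff := hc

/-- The conformal metric `e^{2f} g`. -/
def confMetric (f : X → ℝ) (hf : ContMDiff 𝓘(ℝ, E n) 𝓘(ℝ, ℝ) ∞ f) (g : Metric n X) :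
    Metric n X :=
  mkMetric (fun x => Real.exp (2 * f x) • g.inner x)
    (fun x => isInnerForm_smul (isInnerForm_ginner g x) (Real.exp_pos _))
    (by
      have h1 : ContMDiff 𝓘(ℝ, E n) 𝓘(ℝ, ℝ) ∞ fun x => Real.exp (2 * f x) :=
        (Real.contDiff_exp.comp (contDiff_const.mul contDiff_id)).contMDiff.comp hf
      exact h1.smul_section g.contMDiff)

variable {f : X → ℝ} {hf : ContMDiff 𝓘(ℝ, E n) 𝓘(ℝ, ℝ) ∞ f} {g : Metric n X}

lemma ginner_confMetric (x : X) :
    ginner (confMetric f hf g) x = Real.exp (2 * f x) • ginner g x := rfl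

lemma pform_confMetric (ψ : E n → X) :
    pform (confMetric f hf g) ψ = confForm (f ∘ ψ) (pform g ψ) := rfl

lemma metric_ext {g g' : Metric n X} (h : ∀ x v w, g.inner x v w = g'.inner x v w) : g = g' := by
  cases g
  cases g'
  congr
  ext x v w
  exact h x v w

lemma gradInner_confMetric (u v : X → ℝ) (x : X) :
    gradInner (confMetric f hf g) u v x = (Real.exp (2 * f x))⁻¹ * gradInner g u v x := by
  rw [gradInner, ginner_confMetric, sharp_smul (isInnerForm_ginner g x) (Real.exp_pos _)]
  simp [gradInner]

lemma contDiffAt_comp_param {u : X → ℝ} (hu : ContMDiff 𝓘(ℝ, E n) 𝓘(ℝ, ℝ) ∞ u) {ψ : E n → X}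
    {y : E n} (h : RegAt ψ y) : ContDiffAt ℝ ∞ (u ∘ ψ) y :=
  contMDiffAt_iff_contDiffAt.mp (hu.contMDiffAt.comp y h.contMDiffAt)

lemma eq_chart_symm (x : X) : (chartAt (E n) x).symm (chartAt (E n) x x) = x :=
  (chartAt (E n) x).left_inv (mem_chart_source (E n) x)

lemma regAt_center (x : X) : RegAt (chartAt (E n) x).symm (chartAt (E n) x x) :=
  regAt_chart_symm (mem_chart_target (E n) x)

lemma scalarCurvature_confMetric (hn : n ≠ 1) (x : X) :
    scalarCurvature (confMetric f hf g) x = (Real.exp (2 * f x))⁻¹ *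
      (scalarCurvature g x - 2 * (n - 1) * lapX g f x
        - (n - 1) * (n - 2) * gradInner g f f x) := by
  have hr := regAt_center (n := n) x
  have hfm : MDifferentiableAt 𝓘(ℝ, E n) 𝓘(ℝ, ℝ) f
      ((chartAt (E n) x).symm (chartAt (E n) x x)) := hf.contMDiffAt.mdifferentiableAt (by simp)
  have h1 := hr.scalarCurvature_eq (confMetric f hf g)
  have h2 := hr.scalarCurvature_eq g
  have h3 := hr.gradInner_eq g hfm hfm
  have h4 := hr.lapX_eq hn g (f := f) hf.contMDiffAt
  rw [pform_confMetric, scal_confForm (hr.contDiffAt_pform g) (hr.eventually_isInnerForm g)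
    (contDiffAt_comp_param hf hr), ← h2, ← h3, ← h4] at h1
  simp only [Function.comp_apply, eq_chart_symm] at h1
  exact h1

lemma gradInner_symm (u v : X → ℝ) (x : X) : gradInner g u v x = gradInner g v u x := by
  have h := isInnerForm_ginner g x
  rw [gradInner, gradInner, ← DFunLike.congr_fun (apply_sharp h (dX u x)) (sharp _ (dX v x)),
    ← DFunLike.congr_fun (apply_sharp h (dX v x)) (sharp _ (dX u x)), h.symm]

lemma dX_mul {u v : X → ℝ} (hu : ContMDiff 𝓘(ℝ, E n) 𝓘(ℝ, ℝ) ∞ u)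
    (hv : ContMDiff 𝓘(ℝ, E n) 𝓘(ℝ, ℝ) ∞ v) (x : X) :
    dX (n := n) (fun x => u x * v x) x = u x • dX v x + v x • dX u x := by
  have h1 := (hu.contMDiffAt (x := x)).mdifferentiableAt (by simp)
  have h2 := (hv.contMDiffAt (x := x)).mdifferentiableAt (by simp)
  exact (h1.hasMFDerivAt.mul h2.hasMFDerivAt).mfderiv

lemma dX_comp {u : X → ℝ} (hu : ContMDiff 𝓘(ℝ, E n) 𝓘(ℝ, ℝ) ∞ u) {F : ℝ → ℝ} {F' : ℝ} {x : X}
    (hF : HasDerivAt F F' (u x)) : dX (n := n) (fun x => F (u x)) x = F' • dX u x := by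
  have h1 := (hu.contMDiffAt (x := x)).mdifferentiableAt (by simp)
  have h2 := (hF.hasFDerivAt.hasMFDerivAt.comp x h1.hasMFDerivAt).mfderiv
  have h3 : dX (n := n) (fun x => F (u x)) x = _ := h2
  rw [h3]
  have key : ∀ L : E n →L[ℝ] ℝ, (ContinuousLinearMap.toSpanSingleton ℝ F').comp L = F' • L := by
    intro L
    ext v
    simp [mul_comm]
  exact key _

/-- The weight `e^{(n-2)f/2}`. -/
def weight (n : ℕ) (f : X → ℝ) (x : X) : ℝ := Real.exp (((n : ℝ) - 2) / 2 * f x)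

lemma weight_pos (f : X → ℝ) (x : X) : 0 < weight n f x := Real.exp_pos _

lemma contMDiff_weight (hf : ContMDiff 𝓘(ℝ, E n) 𝓘(ℝ, ℝ) ∞ f) :
    ContMDiff 𝓘(ℝ, E n) 𝓘(ℝ, ℝ) ∞ (weight n f) :=
  (Real.contDiff_exp.comp (contDiff_const.mul contDiff_id)).contMDiff.comp hf

lemma dX_weight (hf : ContMDiff 𝓘(ℝ, E n) 𝓘(ℝ, ℝ) ∞ f) (x : X) :
    dX (n := n) (weight n f) x = (((n : ℝ) - 2) / 2 * weight n f x) • dX f x := by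
  refine dX_comp (F := fun t => Real.exp (((n : ℝ) - 2) / 2 * t)) hf ?_
  have := ((hasDerivAt_id (f x)).const_mul (((n : ℝ) - 2) / 2)).exp
  simpa [weight, mul_comm] using this

/-- The integrand of the numerator of the Yamabe functional. -/
def energyDensity (g : Metric n X) (u : X → ℝ) (x : X) : ℝ :=
  4 * ((n : ℝ) - 1) / ((n : ℝ) - 2) * gradInner g u u x + scalarCurvature g x * u x ^ 2

/-- The conformal transformation law of the energy density. -/
lemma energyDensity_confMetric (hn : 3 ≤ n) {u : X → ℝ}
    (hu : ContMDiff 𝓘(ℝ, E n) 𝓘(ℝ, ℝ) ∞ u) (x : X) :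
    Real.exp (n * f x) * energyDensity (confMetric f hf g) u x
      = energyDensity g (fun x => weight n f x * u x) x
        - 2 * (n - 1) * (gradInner g (fun x => (weight n f x * u x) ^ 2) f x
          + (weight n f x * u x) ^ 2 * lapX g f x) := by
  have hn2 : (n : ℝ) - 2 ≠ 0 := by
    have : (3 : ℝ) ≤ n := by exact_mod_cast hn
    linarith
  have hw := contMDiff_weight hf
  have hwu : ContMDiff 𝓘(ℝ, E n) 𝓘(ℝ, ℝ) ∞ (fun x => weight n f x * u x) := hw.mul hu
  have h1 : dX (n := n) (fun x => weight n f x * u x) x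
      = weight n f x • dX u x + u x • (((n : ℝ) - 2) / 2 * weight n f x) • dX f x := by
    rw [dX_mul hw hu, dX_weight hf]
  have h2 : dX (n := n) (fun x => (weight n f x * u x) ^ 2) x
      = (2 * (weight n f x * u x)) • dX (fun x => weight n f x * u x) x :=
    dX_comp (F := fun t => t ^ 2) hwu (by simpa using hasDerivAt_pow 2 (weight n f x * u x))
  -- The volume factor `e^{nf}` and the factor `e^{-2f}` from the inverse metric combine to the
  -- square of the weight, which is where the exponent `(n-2)/2` comes from.
  have hexp : Real.exp (n * f x) * (Real.exp (2 * f x))⁻¹ = weight n f x ^ 2 := by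
    rw [weight, ← Real.exp_neg, ← Real.exp_add, ← Real.exp_nat_mul]
    congr 1
    push_cast
    ring
  have hs : dX u x (sharp (ginner g x) (dX f x)) = dX f x (sharp (ginner g x) (dX u x)) :=
    gradInner_symm u f x
  rw [energyDensity, gradInner_confMetric, scalarCurvature_confMetric (by omega), energyDensity]
  simp only [gradInner, h2, h1, map_add, map_smul, add_apply, smul_apply, smul_eq_mul]
  rw [hs]
  have e : ∀ a b c d : ℝ, a * (b * (d * c) + d * c) = a * d * (b * c + c) := by intros; ring
  calc _ = (Real.exp (n * f x) * (Real.exp (2 * f x))⁻¹) *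
      (4 * ((n : ℝ) - 1) / ((n : ℝ) - 2) * dX u x (sharp (ginner g x) (dX u x))
        + (scalarCurvature g x - 2 * (n - 1) * lapX g f x
        - (n - 1) * (n - 2) * dX f x (sharp (ginner g x) (dX f x))) * u x ^ 2) := by ring
    _ = _ := by
      rw [hexp]
      field_simp
      ring

lemma continuous_of_param {F : X → ℝ}
    (h : ∀ x : X, ContinuousAt (F ∘ (chartAt (E n) x).symm) (chartAt (E n) x x)) :
    Continuous F := by
  rw [continuous_iff_continuousAt]
  intro x
  have h1 : ContinuousAt ((F ∘ (chartAt (E n) x).symm) ∘ chartAt (E n) x) x :=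
    (h x).comp ((chartAt (E n) x).continuousAt (mem_chart_source (E n) x))
  refine h1.congr ?_
  filter_upwards [(chartAt (E n) x).open_source.mem_nhds (mem_chart_source (E n) x)] with x' hx'
  simp [(chartAt (E n) x).left_inv hx']

/-- The definition uses a chart that changes with the point. Invariance rewrites all values near a
given point in the single chart centred there. -/
lemma continuous_scalarCurvature (g : Metric n X) : Continuous (scalarCurvature g) := by
  refine continuous_of_param (n := n) fun x => ?_
  have hr := regAt_center (n := n) x
  refine (contDiffAt_scal' (hr.contDiffAt_pform g) (hr.isInnerForm g)).continuousAt.congr ?_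
  filter_upwards [hr.eventually] with y h
  exact (h.scalarCurvature_eq g).symm

lemma continuous_gradInner (g : Metric n X) {u v : X → ℝ}
    (hu : ContMDiff 𝓘(ℝ, E n) 𝓘(ℝ, ℝ) ∞ u) (hv : ContMDiff 𝓘(ℝ, E n) 𝓘(ℝ, ℝ) ∞ v) :
    Continuous (gradInner g u v) := by
  refine continuous_of_param (n := n) fun x => ?_
  have hr := regAt_center (n := n) x
  have h1 := (contDiffAt_fderiv (contDiffAt_comp_param hu hr)).clm_apply
    (contDiffAt_grad (hr.contDiffAt_pform g) (hr.isInnerForm g) (contDiffAt_comp_param hv hr))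
  refine h1.continuousAt.congr ?_
  filter_upwards [hr.eventually] with y h
  exact (h.gradInner_eq g (hu.contMDiffAt.mdifferentiableAt (by simp))
    (hv.contMDiffAt.mdifferentiableAt (by simp))).symm

/-- The Laplacian is again read off from the conformal law of the scalar curvature, whose other
terms are already known to be continuous. -/
lemma continuous_lapX (hn : n ≠ 1) (g : Metric n X) {f : X → ℝ}
    (hf : ContMDiff 𝓘(ℝ, E n) 𝓘(ℝ, ℝ) ∞ f) : Continuous (lapX g f) := by
  have h1 : (fun x => 2 * ((n : ℝ) - 1) * lapX g f x) = fun x => scalarCurvature g x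
      - (n - 1) * (n - 2) * gradInner g f f x
      - Real.exp (2 * f x) * scalarCurvature (confMetric f hf g) x := by
    ext x
    rw [scalarCurvature_confMetric hn]
    field_simp
    ring
  have h2 : Continuous fun x => 2 * ((n : ℝ) - 1) * lapX g f x := by
    rw [h1]
    exact ((continuous_scalarCurvature g).sub (continuous_const.mul
      (continuous_gradInner g hf hf))).sub ((Real.continuous_exp.comp
      (continuous_const.mul hf.continuous)).mul (continuous_scalarCurvature _))
  have h6 : 2 * ((n : ℝ) - 1) ≠ 0 :=
    mul_ne_zero two_ne_zero (sub_ne_zero.mpr (by exact_mod_cast hn))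
  have h3 := h2.const_mul (2 * ((n : ℝ) - 1))⁻¹
  simp only [inv_mul_cancel_left₀ h6] at h3
  exact h3

lemma continuous_energyDensity (g : Metric n X) {u : X → ℝ}
    (hu : ContMDiff 𝓘(ℝ, E n) 𝓘(ℝ, ℝ) ∞ u) : Continuous (energyDensity g u) :=
  (continuous_const.mul (continuous_gradInner g hu hu)).add
    ((continuous_scalarCurvature g).mul (hu.continuous.pow 2))

end ConformalMetric

section Volume

variable {n : ℕ} {X : Type*} [TopologicalSpace X] [ChartedSpace (E n) X]
  [IsManifold 𝓘(ℝ, E n) ∞ X] [MeasurableSpace X] [BorelSpace X]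

/-! ### The volume measure -/

lemma matOf_pullForm (B : Form n) (A : E n →L[ℝ] E n) :
    matOf (pullForm B A) = (LinearMap.toMatrix (EuclideanSpace.basisFun (Fin n) ℝ).toBasis
      (EuclideanSpace.basisFun (Fin n) ℝ).toBasis (A : E n →ₗ[ℝ] E n)).transpose * matOf B *
      LinearMap.toMatrix (EuclideanSpace.basisFun (Fin n) ℝ).toBasis
      (EuclideanSpace.basisFun (Fin n) ℝ).toBasis (A : E n →ₗ[ℝ] E n) := by
  ext i j
  have h1 : matOf (pullForm B A) i j = B (A (stdVec i)) (A (stdVec j)) := rfl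
  rw [h1, form_apply_eq_sum, Matrix.mul_apply]
  simp only [Matrix.mul_apply, Matrix.transpose_apply, Finset.sum_mul]
  rw [Finset.sum_comm]
  refine Finset.sum_congr rfl fun k _ => Finset.sum_congr rfl fun l _ => ?_
  simp only [LinearMap.toMatrix_apply, OrthonormalBasis.coe_toBasis_repr_apply,
    OrthonormalBasis.coe_toBasis, EuclideanSpace.basisFun_repr, EuclideanSpace.basisFun_apply,
    ContinuousLinearMap.coe_coe, stdVec]
  ring

/-- The volume density `√det` of a form. -/
def dens (B : Form n) : ℝ := √(matOf B).det

lemma dens_pullForm (B : Form n) (A : E n →L[ℝ] E n) :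
    dens (pullForm B A) = |A.det| * dens B := by
  rw [dens, dens, matOf_pullForm, Matrix.det_mul, Matrix.det_mul, Matrix.det_transpose,
    LinearMap.det_toMatrix]
  have : LinearMap.det (A : E n →ₗ[ℝ] E n) = A.det := rfl
  rw [this, mul_right_comm, ← sq, Real.sqrt_mul (sq_nonneg _), Real.sqrt_sq_eq_abs]

lemma dens_nonneg (B : Form n) : 0 ≤ dens B := Real.sqrt_nonneg _

lemma dens_pos {B : Form n} (h : IsInnerForm B) : 0 < dens B :=
  Real.sqrt_pos.mpr (matOf_det_pos h)

/-- The density of the Riemannian volume in the chart at `x`. -/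
def chartDens (g : Metric n X) (x : X) (y : E n) : ENNReal :=
  ENNReal.ofReal (dens (pform g (chartAt (E n) x).symm y))

variable (g : Metric n X) (x : X)

lemma chartVolume_eq : chartVolume g x = ((volume.restrict (chartAt (E n) x).target).withDensity
    (chartDens g x)).map (chartAt (E n) x).symm := rfl

lemma measurableSet_source : MeasurableSet (chartAt (E n) x).source :=
  (chartAt (E n) x).open_source.measurableSet

lemma measurableSet_target : MeasurableSet (chartAt (E n) x).target :=
  (chartAt (E n) x).open_target.measurableSet

lemma aemeasurable_chart_symm : AEMeasurable (chartAt (E n) x).symm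
    ((volume.restrict (chartAt (E n) x).target).withDensity (chartDens g x)) :=
  ((chartAt (E n) x).continuousOn_symm.aemeasurable (measurableSet_target x)).mono_ac
    (withDensity_absolutelyContinuous _ _)

lemma chartVolume_apply {s : Set X} (hs : MeasurableSet s) :
    chartVolume g x s = ∫⁻ y in (chartAt (E n) x).symm ⁻¹' s ∩ (chartAt (E n) x).target,
      chartDens g x y := by
  rw [chartVolume_eq, Measure.map_apply_of_aemeasurable (aemeasurable_chart_symm g x) hs,
    withDensity_apply', Measure.restrict_restrict' (measurableSet_target x)]

lemma chartVolume_inter_source {s : Set X} (hs : MeasurableSet s) :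
    chartVolume g x (s ∩ (chartAt (E n) x).source) = chartVolume g x s := by
  rw [chartVolume_apply g x hs, chartVolume_apply g x (hs.inter (measurableSet_source x))]
  congr 2
  ext y
  simp only [Set.mem_inter_iff, Set.mem_preimage]
  constructor
  · rintro ⟨⟨h1, -⟩, h2⟩
    exact ⟨h1, h2⟩
  · rintro ⟨h1, h2⟩
    exact ⟨⟨h1, (chartAt (E n) x).map_target h2⟩, h2⟩

lemma measurableSet_inter_preimage {Y Z : Type*} [TopologicalSpace Y] [TopologicalSpace Z]
    [MeasurableSpace Y] [BorelSpace Y] [MeasurableSpace Z] [BorelSpace Z] {f : Y → Z} {O : Set Y}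
    (hf : ContinuousOn f O) (hO : IsOpen O) {s : Set Z} (hs : MeasurableSet s) :
    MeasurableSet (O ∩ f ⁻¹' s) := by
  have h1 : Measurable (O.domRestrict f) := (continuousOn_iff_continuous_domRestrict.mp hf).measurable
  have h2 := (MeasurableEmbedding.subtype_coe hO.measurableSet).measurableSet_image' (h1 hs)
  convert! h2 using 1
  ext y
  simp
  tauto

variable {g x} {ψ : E n → X} {T : Set (E n)}

lemma hasFDerivWithinAt_trans (hψ : ∀ y ∈ T, RegAt ψ y)
    (hm : Set.MapsTo ψ T (chartAt (E n) x).source) :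
    ∀ y ∈ T, HasFDerivWithinAt (trans x ψ) (fderiv ℝ (trans x ψ) y) T y := fun y hy =>
  ((contDiffAt_trans (hψ y hy).contMDiffAt (hm hy)).differentiableAt
    (by simp)).hasFDerivAt.hasFDerivWithinAt

lemma injOn_trans (hi : Set.InjOn ψ T) (hm : Set.MapsTo ψ T (chartAt (E n) x).source) :
    Set.InjOn (trans x ψ) T := fun _ hy _ hz h =>
  hi hy hz ((chartAt (E n) x).injOn (hm hy) (hm hz) h)

lemma image_eq_inter_preimage (hm : Set.MapsTo ψ T (chartAt (E n) x).source) :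
    ψ '' T = (chartAt (E n) x).source ∩ chartAt (E n) x ⁻¹' (trans x ψ '' T) := by
  ext z
  constructor
  · rintro ⟨y, hy, rfl⟩
    exact ⟨hm hy, y, hy, rfl⟩
  · rintro ⟨h1, y, hy, h2⟩
    exact ⟨y, hy, (chartAt (E n) x).injOn (hm hy) h1 h2⟩

/-- In the chart the set is the image of a measurable set under an injective differentiable map, and
such images are measurable. -/
lemma measurableSet_image (hT : MeasurableSet T) (hψ : ∀ y ∈ T, RegAt ψ y) (hi : Set.InjOn ψ T)
    (hm : Set.MapsTo ψ T (chartAt (E n) x).source) : MeasurableSet (ψ '' T) := by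
  rw [image_eq_inter_preimage hm]
  exact measurableSet_inter_preimage (chartAt (E n) x).continuousOn (chartAt (E n) x).open_source
    (measurable_image_of_fderivWithin hT (hasFDerivWithinAt_trans hψ hm) (injOn_trans hi hm))

/-- Change of variables. -/
lemma chartVolume_image (g : Metric n X) (hT : MeasurableSet T) (hψ : ∀ y ∈ T, RegAt ψ y)
    (hi : Set.InjOn ψ T) (hm : Set.MapsTo ψ T (chartAt (E n) x).source) :
    chartVolume g x (ψ '' T) = ∫⁻ y in T, ENNReal.ofReal (dens (pform g ψ y)) := by
  have h1 : (chartAt (E n) x).symm ⁻¹' (ψ '' T) ∩ (chartAt (E n) x).target = trans x ψ '' T := by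
    ext z
    constructor
    · rintro ⟨⟨y, hy, hyz⟩, hz⟩
      refine ⟨y, hy, ?_⟩
      rw [trans, hyz, (chartAt (E n) x).right_inv hz]
    · rintro ⟨y, hy, rfl⟩
      refine ⟨⟨y, hy, ((chartAt (E n) x).left_inv (hm hy)).symm⟩, ?_⟩
      exact (chartAt (E n) x).map_source (hm hy)
  rw [chartVolume_apply g x (measurableSet_image hT hψ hi hm), h1,
    lintegral_image_eq_lintegral_abs_det_fderiv_mul volume hT (hasFDerivWithinAt_trans hψ hm)
      (injOn_trans hi hm)]
  refine setLIntegral_congr_fun hT fun y hy => ?_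
  rw [chartDens, ← ENNReal.ofReal_mul (abs_nonneg _), pform_eq_trans g (hψ y hy).contMDiffAt (hm hy),
    dens_pullForm]

/-- Parametrizing `s` by the inverse of the first chart and applying the change of variables formula
to both measures gives the same integral. -/
lemma chartVolume_congr (g : Metric n X) {x x' : X} {s : Set X} (hs : MeasurableSet s)
    (h : s ⊆ (chartAt (E n) x).source) (h' : s ⊆ (chartAt (E n) x').source) :
    chartVolume g x s = chartVolume g x' s := by
  set T := (chartAt (E n) x).target ∩ (chartAt (E n) x).symm ⁻¹' s with hT
  have hTm : MeasurableSet T := measurableSet_inter_preimage (chartAt (E n) x).continuousOn_symm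
    (chartAt (E n) x).open_target hs
  have hsT : (chartAt (E n) x).symm '' T = s := by
    ext z
    constructor
    · rintro ⟨y, hy, rfl⟩
      exact hy.2
    · intro hz
      refine ⟨chartAt (E n) x z, ⟨(chartAt (E n) x).map_source (h hz), ?_⟩,
        (chartAt (E n) x).left_inv (h hz)⟩
      simpa [(chartAt (E n) x).left_inv (h hz)] using hz
  have hreg : ∀ y ∈ T, RegAt (chartAt (E n) x).symm y := fun y hy => regAt_chart_symm hy.1
  have hinj : Set.InjOn (chartAt (E n) x).symm T :=
    (chartAt (E n) x).symm.injOn.mono Set.inter_subset_left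
  conv_lhs => rw [← hsT]
  conv_rhs => rw [← hsT]
  rw [chartVolume_image g hTm hreg hinj fun y hy => h hy.2,
    chartVolume_image g hTm hreg hinj fun y hy => h' hy.2]

end Volume

/-! ### Gluing the chart volumes into one measure. -/

section GlobalVolume

variable {n : ℕ} {X : Type*} [TopologicalSpace X] [ChartedSpace (E n) X]
  [IsManifold 𝓘(ℝ, E n) ∞ X] [MeasurableSpace X] [BorelSpace X]

/-- A countable measurable partition of `X` into parts of chart domains. -/
structure ChartPartition (n : ℕ) (X : Type*) [TopologicalSpace X] [ChartedSpace (E n) X]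
    [MeasurableSpace X] where
  pt : ℕ → X
  set : ℕ → Set X
  measurableSet : ∀ k, MeasurableSet (set k)
  disjoint : Pairwise (Function.onFun Disjoint set)
  iUnion_eq : ⋃ k, set k = Set.univ
  subset : ∀ k, set k ⊆ (chartAt (E n) (pt k)).source

variable (n X) in
lemma nonempty_chartPartition [SigmaCompactSpace X] [Nonempty X] :
    Nonempty (ChartPartition n X) := by
  obtain ⟨s, hs, hsu⟩ := countable_cover_nhds_of_sigmaCompact
    (fun x : X => (chartAt (E n) x).open_source.mem_nhds (mem_chart_source (E n) x))
  have hne : s.Nonempty := by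
    by_contra h
    rw [Set.not_nonempty_iff_eq_empty] at h
    rw [h] at hsu
    simp only [Set.mem_empty_iff_false, Set.iUnion_of_empty, Set.iUnion_empty] at hsu
    exact Set.empty_ne_univ hsu
  obtain ⟨f, rfl⟩ := hs.exists_eq_range hne
  refine ⟨⟨f, disjointed fun k => (chartAt (E n) (f k)).source,
    fun k => MeasurableSet.disjointed (fun k => measurableSet_source (f k)) k,
    disjoint_disjointed _, ?_, fun k => disjointed_subset _ k⟩⟩
  rw [iUnion_disjointed, ← hsu]
  simp

lemma ChartPartition.measure_eq (P : ChartPartition n X) (μ : Measure X) {s : Set X}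
    (hs : MeasurableSet s) : μ s = ∑' k, μ (s ∩ P.set k) := by
  rw [← measure_iUnion, ← Set.inter_iUnion, P.iUnion_eq, Set.inter_univ]
  · exact fun i j h => (P.disjoint h).mono Set.inter_subset_right Set.inter_subset_right
  · exact fun k => hs.inter (P.measurableSet k)

/-- On each part of the partition every chart volume agrees with that of the chosen chart where both
live and vanishes elsewhere, so the supremum of measures is computed part by part. -/
lemma vol_eq_sum (P : ChartPartition n X) (g : Metric n X) :
    vol g = Measure.sum fun k => (chartVolume g (P.pt k)).restrict (P.set k) := by
  refine le_antisymm (iSup_le fun x => ?_) ?_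
  · refine Measure.le_intro fun s hs _ => ?_
    rw [Measure.sum_apply _ hs, P.measure_eq _ hs]
    refine ENNReal.tsum_le_tsum fun k => ?_
    have hm := hs.inter (P.measurableSet k)
    rw [Measure.restrict_apply hs, ← chartVolume_inter_source g x hm,
      chartVolume_congr g (x' := P.pt k) (hm.inter (measurableSet_source x)) Set.inter_subset_right
      (Set.inter_subset_left.trans (Set.inter_subset_right.trans (P.subset k)))]
    exact measure_mono Set.inter_subset_left
  · refine Measure.le_intro fun s hs _ => ?_
    rw [Measure.sum_apply _ hs, P.measure_eq _ hs]
    refine ENNReal.tsum_le_tsum fun k => ?_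
    rw [Measure.restrict_apply hs]
    exact (le_iSup (chartVolume g) (P.pt k)) _

variable [SigmaCompactSpace X] [Nonempty X]

lemma vol_apply_of_subset (g : Metric n X) {x : X} {s : Set X} (hs : MeasurableSet s)
    (h : s ⊆ (chartAt (E n) x).source) : vol g s = chartVolume g x s := by
  obtain ⟨P⟩ := nonempty_chartPartition n X
  rw [vol_eq_sum P, Measure.sum_apply _ hs, P.measure_eq _ hs]
  congr 1
  ext k
  rw [Measure.restrict_apply hs]
  exact chartVolume_congr g (hs.inter (P.measurableSet k))
    (Set.inter_subset_right.trans (P.subset k)) (Set.inter_subset_left.trans h)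

lemma vol_restrict_source (g : Metric n X) (x : X) :
    (vol g).restrict (chartAt (E n) x).source = chartVolume g x := by
  ext s hs
  rw [Measure.restrict_apply hs, vol_apply_of_subset g (hs.inter (measurableSet_source x))
    Set.inter_subset_right, chartVolume_inter_source g x hs]

/-- Only an inequality holds, because `ψ` may be many-to-one, as the uniformizing map is: its fibres
are `Γ`-orbits. The domain is cut into countably many pieces on which `ψ` is injective, and
countable subadditivity handles overlapping images. -/
lemma vol_image_le (g : Metric n X) {ψ : E n → X} {T : Set (E n)} (hT : MeasurableSet T)
    (hψ : ∀ y ∈ T, IsLocalDiffeomorphAt 𝓘(ℝ, E n) 𝓘(ℝ, E n) ∞ ψ y) :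
    vol g (ψ '' T) ≤ ∫⁻ y in T, ENNReal.ofReal (dens (pform g ψ y)) := by
  rcases T.eq_empty_or_nonempty with rfl | hne
  · simp
  have h1 : ∀ y ∈ T, ∃ O : Set (E n), IsOpen O ∧ y ∈ O ∧ Set.InjOn ψ O ∧
      Set.MapsTo ψ O (chartAt (E n) (ψ y)).source := by
    intro y hy
    have hc := (hψ y hy).contMDiffAt.continuousAt
    obtain ⟨Φ, hyΦ, he⟩ := hψ y hy
    obtain ⟨O', hO', hO'o, hyO'⟩ := eventually_nhds_iff.mp (hc.eventually
      ((chartAt (E n) (ψ y)).open_source.mem_nhds (mem_chart_source (E n) (ψ y))))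
    refine ⟨O' ∩ Φ.source, hO'o.inter Φ.open_source, ⟨hyO', hyΦ⟩, ?_, fun z hz => hO' z hz.1⟩
    intro z hz w hw hzw
    rw [he hz.2, he hw.2] at hzw
    exact Φ.injOn hz.2 hw.2 hzw
  choose! O hO hyO hOi hOm using h1
  obtain ⟨t, htT, htc, htu⟩ := TopologicalSpace.countable_cover_nhdsWithin (s := T) (f := O)
    (fun y hy => mem_nhdsWithin_of_mem_nhds ((hO y hy).mem_nhds (hyO y hy)))
  have htne : t.Nonempty := by
    obtain ⟨y, hy⟩ := hne
    have := htu hy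
    simp only [Set.mem_iUnion] at this
    obtain ⟨z, hz, -⟩ := this
    exact ⟨z, hz⟩
  obtain ⟨f, rfl⟩ := htc.exists_eq_range htne
  have hfT : ∀ k, f k ∈ T := fun k => htT ⟨k, rfl⟩
  set A : ℕ → Set (E n) := disjointed fun k => T ∩ O (f k) with hA
  have hAm : ∀ k, MeasurableSet (A k) :=
    fun k => MeasurableSet.disjointed (fun k => hT.inter (hO _ (hfT k)).measurableSet) k
  have hAs : ∀ k, A k ⊆ T ∩ O (f k) := fun k => disjointed_subset _ k
  have hAu : ⋃ k, A k = T := by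
    rw [hA, iUnion_disjointed, ← Set.inter_iUnion, Set.inter_eq_left]
    refine htu.trans ?_
    simp
  have hreg : ∀ k, ∀ y ∈ A k, RegAt ψ y := fun k y hy =>
    RegAt.of_isLocalDiffeomorphAt (hψ y (hAs k hy).1)
  have hinj : ∀ k, Set.InjOn ψ (A k) := fun k => (hOi _ (hfT k)).mono fun y hy => (hAs k hy).2
  have hmaps : ∀ k, Set.MapsTo ψ (A k) (chartAt (E n) (ψ (f k))).source := fun k y hy =>
    hOm _ (hfT k) (hAs k hy).2
  calc vol g (ψ '' T) = vol g (⋃ k, ψ '' A k) := by rw [← Set.image_iUnion, hAu]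
    _ ≤ ∑' k, vol g (ψ '' A k) := measure_iUnion_le _
    _ = ∑' k, ∫⁻ y in A k, ENNReal.ofReal (dens (pform g ψ y)) := by
      congr 1
      ext k
      rw [vol_apply_of_subset g (measurableSet_image (hAm k) (hreg k) (hinj k) (hmaps k))
        (hmaps k).image_subset, chartVolume_image g (hAm k) (hreg k) (hinj k) (hmaps k)]
    _ = ∫⁻ y in T, ENNReal.ofReal (dens (pform g ψ y)) := by
      rw [← lintegral_iUnion hAm (disjoint_disjointed _), hAu]

end GlobalVolume

/-! ### Relative densities of volume measures. -/

section VolumeRatio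

variable {n : ℕ} {X : Type*} [TopologicalSpace X] [ChartedSpace (E n) X]
  [IsManifold 𝓘(ℝ, E n) ∞ X]

lemma continuous_dens : Continuous (dens (n := n)) := by
  unfold dens
  refine Real.continuous_sqrt.comp (Continuous.matrix_det ?_)
  refine continuous_matrix fun i j => ?_
  exact ((continuous_id.clm_apply continuous_const).clm_apply continuous_const)

/-- The ratio of the volume densities of two metrics. -/
def volRatio (g g' : Metric n X) (x : X) : ℝ := dens (ginner g' x) / dens (ginner g x)

lemma volRatio_pos (g g' : Metric n X) (x : X) : 0 < volRatio g g' x :=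
  div_pos (dens_pos (isInnerForm_ginner g' x)) (dens_pos (isInnerForm_ginner g x))

/-- The factor `|det dψ|` is common to both densities, so their ratio is a function on the manifold,
independent of the parametrization. -/
lemma dens_pform_eq (g g' : Metric n X) (ψ : E n → X) (y : E n) :
    dens (pform g' ψ y) = volRatio g g' (ψ y) * dens (pform g ψ y) := by
  rw [pform, pform, dens_pullForm, dens_pullForm, volRatio]
  field_simp [(dens_pos (isInnerForm_ginner g (ψ y))).ne']

lemma RegAt.dens_pos {ψ : E n → X} {y : E n} (h : RegAt ψ y) (g : Metric n X) :
    0 < dens (pform g ψ y) := OrbifoldYamabe.dens_pos (h.isInnerForm g)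

lemma RegAt.continuousAt_dens {ψ : E n → X} {y : E n} (h : RegAt ψ y) (g : Metric n X) :
    ContinuousAt (fun y => dens (pform g ψ y)) y :=
  continuous_dens.continuousAt.comp (h.contDiffAt_pform g).continuousAt

lemma continuous_volRatio (g g' : Metric n X) : Continuous (volRatio g g') := by
  refine continuous_of_param (n := n) fun x => ?_
  have hr := regAt_center (n := n) x
  refine ((hr.continuousAt_dens g').div (hr.continuousAt_dens g) (hr.dens_pos g).ne').congr ?_
  filter_upwards [hr.eventually] with y h
  rw [Pi.div_apply, dens_pform_eq g g', Function.comp_apply, mul_div_cancel_right₀ _ (h.dens_pos g).ne']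

lemma dens_smul {c : ℝ} (hc : 0 ≤ c) (B : Form n) : dens (c • B) = √c ^ n * dens B := by
  have h1 : matOf (c • B) = c • matOf B := by ext i j; simp [matOf]
  have h2 : √(c ^ n) = √c ^ n := by
    rw [← Real.sqrt_sq (pow_nonneg (Real.sqrt_nonneg c) n), ← pow_mul, mul_comm, pow_mul,
      Real.sq_sqrt hc]
  rw [dens, h1, Matrix.det_smul, Fintype.card_fin, Real.sqrt_mul (pow_nonneg hc n), dens, h2]

lemma volRatio_confMetric (g : Metric n X) {f : X → ℝ} (hf : ContMDiff 𝓘(ℝ, E n) 𝓘(ℝ, ℝ) ∞ f)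
    (x : X) : volRatio g (confMetric f hf g) x = Real.exp (n * f x) := by
  have h : √(Real.exp (2 * f x)) = Real.exp (f x) := by
    rw [Real.sqrt_eq_iff_mul_self_eq (Real.exp_pos _).le (Real.exp_pos _).le, ← Real.exp_add]
    congr 1
    ring
  rw [volRatio, ginner_confMetric, dens_smul (Real.exp_pos _).le, h,
    mul_div_cancel_right₀ _ (dens_pos (isInnerForm_ginner g x)).ne', ← Real.exp_nat_mul]

variable [MeasurableSpace X] [BorelSpace X]

lemma aemeasurable_chartDens (g : Metric n X) (x : X) :
    AEMeasurable (chartDens g x) (volume.restrict (chartAt (E n) x).target) := by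
  refine AEMeasurable.ennreal_ofReal (ContinuousOn.aemeasurable ?_ (measurableSet_target x))
  exact fun y hy => ((regAt_chart_symm hy).continuousAt_dens g).continuousWithinAt

lemma lintegral_chartVolume (g : Metric n X) (x : X) {F : X → ENNReal} (hF : Measurable F) :
    ∫⁻ z, F z ∂(chartVolume g x) = ∫⁻ y in (chartAt (E n) x).target,
      chartDens g x y * F ((chartAt (E n) x).symm y) := by
  rw [chartVolume_eq, lintegral_map' hF.aemeasurable (aemeasurable_chart_symm g x),
    lintegral_withDensity_eq_lintegral_mul₀ (aemeasurable_chartDens g x)]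
  · rfl
  · exact hF.comp_aemeasurable ((chartAt (E n) x).continuousOn_symm.aemeasurable
      (measurableSet_target x))

lemma integral_chartVolume (g : Metric n X) (x : X) {F : X → ℝ} (hF : Continuous F) :
    ∫ z, F z ∂(chartVolume g x) = ∫ y in (chartAt (E n) x).target,
      dens (pform g (chartAt (E n) x).symm y) * F ((chartAt (E n) x).symm y) := by
  rw [chartVolume_eq, integral_map (aemeasurable_chart_symm g x) hF.aestronglyMeasurable,
    integral_withDensity_eq_integral_toReal_smul₀ (aemeasurable_chartDens g x)
      (Eventually.of_forall fun _ => ENNReal.ofReal_lt_top)]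
  simp only [chartDens, ENNReal.toReal_ofReal (dens_nonneg _), smul_eq_mul]

lemma chartVolume_withDensity (g g' : Metric n X) (x : X) :
    chartVolume g' x = (chartVolume g x).withDensity
      fun z => ENNReal.ofReal (volRatio g g' z) := by
  have hm : Measurable fun z => ENNReal.ofReal (volRatio g g' z) :=
    (continuous_volRatio g g').measurable.ennreal_ofReal
  ext s hs
  rw [withDensity_apply _ hs, ← lintegral_indicator hs, lintegral_chartVolume g x
    (hm.indicator hs), ← lintegral_indicator_one hs, lintegral_chartVolume g' x
    (measurable_one.indicator hs)]
  refine lintegral_congr fun y => ?_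
  by_cases h : (chartAt (E n) x).symm y ∈ s
  · rw [Set.indicator_of_mem h, Set.indicator_of_mem h, chartDens, chartDens, dens_pform_eq g g',
      ENNReal.ofReal_mul (volRatio_pos _ _ _).le, mul_comm]
    simp [mul_comm]
  · rw [Set.indicator_of_notMem h, Set.indicator_of_notMem h, mul_zero, mul_zero]

variable [SigmaCompactSpace X] [Nonempty X]

lemma vol_withDensity (g g' : Metric n X) :
    vol g' = (vol g).withDensity fun z => ENNReal.ofReal (volRatio g g' z) := by
  obtain ⟨P⟩ := nonempty_chartPartition n X
  rw [vol_eq_sum P, vol_eq_sum P, withDensity_sum]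
  congr 1
  ext1 k
  rw [chartVolume_withDensity g g', restrict_withDensity (P.measurableSet k)]

lemma integral_vol (g g' : Metric n X) (F : X → ℝ) :
    ∫ x, F x ∂(vol g') = ∫ x, volRatio g g' x * F x ∂(vol g) := by
  rw [vol_withDensity g g', integral_withDensity_eq_integral_toReal_smul
    (continuous_volRatio g g').measurable.ennreal_ofReal
    (Eventually.of_forall fun _ => ENNReal.ofReal_lt_top)]
  simp only [ENNReal.toReal_ofReal (volRatio_pos _ _ _).le, smul_eq_mul]

instance isLocallyFiniteMeasure_vol (g : Metric n X) : IsLocallyFiniteMeasure (vol g) := by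
  refine ⟨fun x => ?_⟩
  have hr := regAt_center (n := n) x
  obtain ⟨r, hr0, hr1⟩ := Metric.eventually_nhds_iff_ball.mp
    (((hr.continuousAt_dens g).eventually (gt_mem_nhds (lt_add_one _))).and
    ((chartAt (E n) x).open_target.mem_nhds (mem_chart_target (E n) x)))
  set b := Metric.ball (chartAt (E n) x x) r with hb
  refine ⟨(chartAt (E n) x).source ∩ chartAt (E n) x ⁻¹' b,
    ((chartAt (E n) x).isOpen_inter_preimage Metric.isOpen_ball).mem_nhds
      ⟨mem_chart_source (E n) x, Metric.mem_ball_self hr0⟩, ?_⟩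
  have hm : MeasurableSet ((chartAt (E n) x).source ∩ chartAt (E n) x ⁻¹' b) :=
    ((chartAt (E n) x).isOpen_inter_preimage Metric.isOpen_ball).measurableSet
  rw [vol_apply_of_subset g hm Set.inter_subset_left, chartVolume_apply g x hm]
  set c : ℝ := dens (pform g (chartAt (E n) x).symm (chartAt (E n) x x)) + 1 with hc
  calc _ ≤ ∫⁻ y in b, chartDens g x y := lintegral_mono_set (by
        rintro y ⟨⟨-, h⟩, hy⟩
        simpa [(chartAt (E n) x).right_inv hy] using h)
    _ ≤ ∫⁻ y in b, ENNReal.ofReal c := setLIntegral_mono measurable_const fun y hy =>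
        ENNReal.ofReal_le_ofReal (hr1 y hy).1.le
    _ < ⊤ := by
      rw [setLIntegral_const]
      exact ENNReal.mul_lt_top ENNReal.ofReal_lt_top measure_ball_lt_top

instance isOpenPosMeasure_vol (g : Metric n X) : (vol g).IsOpenPosMeasure := by
  refine ⟨fun U hU ⟨x, hx⟩ h0 => ?_⟩
  have ho := hU.inter (chartAt (E n) x).open_source
  have h1 : vol g (U ∩ (chartAt (E n) x).source) = 0 := measure_mono_null Set.inter_subset_left h0
  rw [vol_apply_of_subset g ho.measurableSet Set.inter_subset_right,
    chartVolume_apply g x ho.measurableSet] at h1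
  set T := (chartAt (E n) x).symm ⁻¹' (U ∩ (chartAt (E n) x).source) ∩ (chartAt (E n) x).target
    with hT
  have hTo : IsOpen T := by
    rw [hT, Set.inter_comm]
    exact (chartAt (E n) x).isOpen_inter_preimage_symm ho
  have hTs : T ⊆ (chartAt (E n) x).target := Set.inter_subset_right
  have hTne : T.Nonempty := ⟨chartAt (E n) x x, by
    simp [hT, (eq_chart_symm (n := n) x), hx]⟩
  rw [lintegral_eq_zero_iff' ((aemeasurable_chartDens g x).mono_set hTs)] at h1
  have h2 : ∀ᵐ y ∂(volume.restrict T), False := by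
    filter_upwards [h1, ae_restrict_mem hTo.measurableSet] with y h3 h4
    have := (regAt_chart_symm (hTs h4)).dens_pos g
    simp [chartDens] at h3
    linarith
  have h3 := hTo.measure_pos volume hTne
  rw [eventually_false_iff_eq_bot, ae_eq_bot, Measure.restrict_eq_zero] at h2
  exact h3.ne' h2

end VolumeRatio

/-! ### The divergence theorem. -/

section Divergence

variable {n : ℕ} {X : Type*} [TopologicalSpace X] [ChartedSpace (E n) X]
  [IsManifold 𝓘(ℝ, E n) ∞ X]

/-- The divergence of `φ grad f`. -/
def divGrad (g : Metric n X) (φ f : X → ℝ) (x : X) : ℝ :=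
  gradInner g φ f x + φ x * lapX g f x

variable (g : Metric n X) {φ ξ f : X → ℝ}

lemma continuous_divGrad (hn : n ≠ 1) (hφ : ContMDiff 𝓘(ℝ, E n) 𝓘(ℝ, ℝ) ∞ φ)
    (hf : ContMDiff 𝓘(ℝ, E n) 𝓘(ℝ, ℝ) ∞ f) : Continuous (divGrad g φ f) :=
  (continuous_gradInner g hφ hf).add (hφ.continuous.mul (continuous_lapX hn g hf))

lemma dX_congr {x : X} (h : φ =ᶠ[𝓝 x] ξ) : dX (n := n) φ x = dX ξ x := h.mfderiv_eq

lemma dX_const (c : ℝ) (x : X) : dX (n := n) (fun _ => c) x = 0 := mfderiv_const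

lemma dX_eq_zero_of_notMem {x : X} (h : x ∉ tsupport φ) : dX (n := n) φ x = 0 := by
  rw [← dX_const (0 : ℝ) x]
  exact dX_congr (notMem_tsupport_iff_eventuallyEq.mp h)

lemma dX_add {x : X} (hφ : ContMDiff 𝓘(ℝ, E n) 𝓘(ℝ, ℝ) ∞ φ)
    (hξ : ContMDiff 𝓘(ℝ, E n) 𝓘(ℝ, ℝ) ∞ ξ) :
    dX (n := n) (fun x => φ x + ξ x) x = dX φ x + dX ξ x := by
  have h1 := (hφ.contMDiffAt (x := x)).mdifferentiableAt (by simp)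
  have h2 := (hξ.contMDiffAt (x := x)).mdifferentiableAt (by simp)
  exact (h1.hasMFDerivAt.add h2.hasMFDerivAt).mfderiv

lemma divGrad_add (hφ : ContMDiff 𝓘(ℝ, E n) 𝓘(ℝ, ℝ) ∞ φ)
    (hξ : ContMDiff 𝓘(ℝ, E n) 𝓘(ℝ, ℝ) ∞ ξ) (x : X) :
    divGrad g (fun x => φ x + ξ x) f x = divGrad g φ f x + divGrad g ξ f x := by
  simp only [divGrad, gradInner, dX_add hφ hξ, add_apply]
  ring

lemma divGrad_eq_zero {x : X} (h : x ∉ tsupport φ) : divGrad g φ f x = 0 := by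
  rw [divGrad, gradInner, dX_eq_zero_of_notMem h, image_eq_zero_of_notMem_tsupport h]
  simp

/-- Integration by parts against the constant function 1. -/
lemma integral_partialDeriv_eq_zero {W : E n → ℝ} (hW : ContDiff ℝ ∞ W) (hc : HasCompactSupport W)
    (i : Fin n) : ∫ y, partialDeriv i W y = 0 := by
  have hd : Differentiable ℝ W := hW.differentiable (by simp)
  have h1 : Integrable (fun y => fderiv ℝ W y (stdVec i)) :=
    ((hW.continuous_fderiv (by simp)).clm_apply continuous_const).integrable_of_hasCompactSupport
      (hc.fderiv_apply ℝ _)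
  have h := integral_mul_fderiv_eq_neg_fderiv_mul_of_integrable (μ := volume) (f := fun _ => (1 : ℝ))
    (g := W) (v := stdVec i) (by simp) (by simpa using h1)
    (by simpa using hW.continuous.integrable_of_hasCompactSupport hc)
    (fun x _ => differentiableAt_const _) (fun x _ => hd x)
  simpa [partialDeriv] using h

lemma sum_partialDeriv_chart (hn : n ≠ 1) {ψ : E n → X} {y : E n} (h : RegAt ψ y)
    (hφ : ContMDiff 𝓘(ℝ, E n) 𝓘(ℝ, ℝ) ∞ φ) (hf : ContMDiff 𝓘(ℝ, E n) 𝓘(ℝ, ℝ) ∞ f) :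
    ∑ i, partialDeriv i (fun y => dens (pform g ψ y) * φ (ψ y) * grad (pform g ψ) (f ∘ ψ) y i) y
      = dens (pform g ψ y) * divGrad g φ f (ψ y) := by
  have h1 := sum_partialDeriv_grad (φ := φ ∘ ψ) (h.contDiffAt_pform g) (h.eventually_isInnerForm g)
    (contDiffAt_comp_param hf h) ((contDiffAt_comp_param hφ h).differentiableAt (by simp))
  rw [divGrad, h.gradInner_eq g (hφ.contMDiffAt.mdifferentiableAt (by simp))
    (hf.contMDiffAt.mdifferentiableAt (by simp)), h.lapX_eq hn g hf.contMDiffAt]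
  exact h1

lemma contDiffAt_flux {ψ : E n → X} {y : E n} (h : RegAt ψ y)
    (hφ : ContMDiff 𝓘(ℝ, E n) 𝓘(ℝ, ℝ) ∞ φ) (hf : ContMDiff 𝓘(ℝ, E n) 𝓘(ℝ, ℝ) ∞ f) (i : Fin n) :
    ContDiffAt ℝ ∞ (fun y => dens (pform g ψ y) * φ (ψ y) * grad (pform g ψ) (f ∘ ψ) y i) y := by
  have h1 : ContDiffAt ℝ ∞ (fun y => dens (pform g ψ y)) y := by
    unfold dens
    refine ContDiffAt.sqrt ?_ (matOf_det_pos (h.isInnerForm g)).ne'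
    simp only [Matrix.det_apply]
    refine ContDiffAt.sum fun σ _ => ContDiffAt.const_smul _ (contDiffAt_prod fun j _ => ?_)
    exact ((h.contDiffAt_pform g).clm_apply contDiffAt_const).clm_apply contDiffAt_const
  refine (h1.mul (contDiffAt_comp_param hφ h)).mul ?_
  exact (coord i).contDiff.contDiffAt.comp y
    (contDiffAt_grad (h.contDiffAt_pform g) (h.isInnerForm g) (contDiffAt_comp_param hf h))

variable [MeasurableSpace X] [BorelSpace X] [SigmaCompactSpace X] [T2Space X]

/-- In the chart the integrand is the Euclidean divergence of the flux `√g φ grad f`. Since the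
support of `φ` is compact in the chart domain, the flux extended by zero is smooth and compactly
supported on `ℝⁿ`. -/
lemma integral_divGrad_of_subset_source [Nonempty X] (hn : n ≠ 1) {x : X}
    (hφ : ContMDiff 𝓘(ℝ, E n) 𝓘(ℝ, ℝ) ∞ φ) (hf : ContMDiff 𝓘(ℝ, E n) 𝓘(ℝ, ℝ) ∞ f)
    (hc : HasCompactSupport φ) (hs : tsupport φ ⊆ (chartAt (E n) x).source) :
    ∫ z, divGrad g φ f z ∂(vol g) = 0 := by
  classical
  set e := chartAt (E n) x with he
  set K := e '' tsupport φ with hK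
  have hKc : IsCompact K := hc.isCompact.image_of_continuousOn (e.continuousOn.mono hs)
  have hK1 : ∀ y ∈ e.target, y ∉ K → e.symm y ∉ tsupport φ := fun y hy hyK h =>
    hyK ⟨_, h, e.right_inv hy⟩
  have hKt : K ⊆ e.target := by
    rintro _ ⟨z, hz, rfl⟩
    exact e.map_source (hs hz)
  set V : Fin n → E n → ℝ := fun i y =>
    dens (pform g e.symm y) * φ (e.symm y) * grad (pform g e.symm) (f ∘ e.symm) y i with hV
  set W : Fin n → E n → ℝ := fun i => e.target.indicator (V i) with hW
  have hW0 : ∀ i, ∀ y ∉ K, W i y = 0 := by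
    intro i y hy
    by_cases h : y ∈ e.target
    · rw [hW]
      simp only [Set.indicator_of_mem h, hV, image_eq_zero_of_notMem_tsupport (hK1 y h hy)]
      simp
    · simp [hW, h]
  have hW1 : ∀ i, ∀ y ∈ e.target, W i =ᶠ[𝓝 y] V i := fun i y hy => by
    filter_upwards [e.open_target.mem_nhds hy] with z hz
    simp [hW, hz]
  have hWd : ∀ i, ContDiff ℝ ∞ (W i) := by
    intro i
    rw [contDiff_iff_contDiffAt]
    intro y
    by_cases h : y ∈ e.target
    · exact (contDiffAt_flux g (regAt_chart_symm h) hφ hf i).congr_of_eventuallyEq (hW1 i y h)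
    · have hyK : y ∉ K := fun h' => h (hKt h')
      refine (contDiffAt_const (c := (0 : ℝ))).congr_of_eventuallyEq ?_
      filter_upwards [hKc.isClosed.isOpen_compl.mem_nhds hyK] with z hz
      exact hW0 i z hz
  have hWc : ∀ i, HasCompactSupport (W i) := fun i => HasCompactSupport.intro hKc (hW0 i)
  have h1 : ∫ z, divGrad g φ f z ∂(vol g)
      = ∫ y in e.target, dens (pform g e.symm y) * divGrad g φ f (e.symm y) := by
    rw [← integral_chartVolume g x (continuous_divGrad g hn hφ hf), ← vol_restrict_source,
      setIntegral_eq_integral_of_forall_compl_eq_zero]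
    exact fun z hz => divGrad_eq_zero g fun h => hz (hs h)
  have h2 : ∫ y in e.target, dens (pform g e.symm y) * divGrad g φ f (e.symm y)
      = ∫ y in e.target, ∑ i, partialDeriv i (W i) y := by
    refine setIntegral_congr_fun e.open_target.measurableSet fun y hy => ?_
    rw [← sum_partialDeriv_chart g hn (regAt_chart_symm hy) hφ hf]
    refine Finset.sum_congr rfl fun i _ => ?_
    rw [partialDeriv, partialDeriv, (hW1 i y hy).fderiv_eq]
  rw [h1, h2, setIntegral_eq_integral_of_forall_compl_eq_zero, integral_finsetSum]
  · exact Finset.sum_eq_zero fun i _ => integral_partialDeriv_eq_zero (hWd i) (hWc i) i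
  · intro i _
    exact (((hWd i).continuous_fderiv (by simp)).clm_apply
      continuous_const).integrable_of_hasCompactSupport ((hWc i).fderiv_apply ℝ _)
  · intro y hy
    refine Finset.sum_eq_zero fun i _ => ?_
    have : W i =ᶠ[𝓝 y] fun _ => 0 := by
      filter_upwards [hKc.isClosed.isOpen_compl.mem_nhds fun h' => hy (hKt h')] with z hz
      exact hW0 i z hz
    rw [partialDeriv, this.fderiv_eq]
    simp

lemma hasCompactSupport_divGrad (hc : HasCompactSupport φ) : HasCompactSupport (divGrad g φ f) :=
  HasCompactSupport.intro hc.isCompact fun _ h => divGrad_eq_zero g h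

/-- The divergence theorem. -/
lemma integral_divGrad [Nonempty X] (hn : n ≠ 1)
    (hφ : ContMDiff 𝓘(ℝ, E n) 𝓘(ℝ, ℝ) ∞ φ) (hf : ContMDiff 𝓘(ℝ, E n) 𝓘(ℝ, ℝ) ∞ f)
    (hc : HasCompactSupport φ) : ∫ z, divGrad g φ f z ∂(vol g) = 0 := by
  classical
  -- A partition of unity subordinate to the chart domains reduces to the local case; only finitely
  -- many of its members meet the compact support of `φ`.
  obtain ⟨ρ, hρ⟩ := SmoothPartitionOfUnity.exists_isSubordinate_chartAt_source 𝓘(ℝ, E n) X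
  have hfin := ρ.locallyFinite.finite_nonempty_inter_compact hc.isCompact
  set S := hfin.toFinset with hS
  have hsum : φ = ∑ i ∈ S, fun x => ρ i x * φ x := by
    ext x
    rw [Finset.sum_apply, ← Finset.sum_mul]
    by_cases hx : x ∈ tsupport φ
    · have h1 := ρ.sum_eq_one (Set.mem_univ x)
      rw [finsum_eq_sum_of_support_subset (s := S)] at h1
      · rw [h1, one_mul]
      · intro i hi
        simp only [hS, Set.Finite.coe_toFinset, Set.mem_ofPred_eq]
        exact ⟨x, hi, hx⟩
    · rw [image_eq_zero_of_notMem_tsupport hx, mul_zero]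
  have key : (fun φ : X → ℝ => ContMDiff 𝓘(ℝ, E n) 𝓘(ℝ, ℝ) ∞ φ ∧ HasCompactSupport φ ∧
      ∫ z, divGrad g φ f z ∂(vol g) = 0) (∑ i ∈ S, fun x => ρ i x * φ x) := by
    refine Finset.sum_induction (fun i x => ρ i x * φ x)
      (fun φ : X → ℝ => ContMDiff 𝓘(ℝ, E n) 𝓘(ℝ, ℝ) ∞ φ ∧ HasCompactSupport φ ∧
        ∫ z, divGrad g φ f z ∂(vol g) = 0) ?_ ?_ ?_
    · rintro a b ⟨ha, hac, ha0⟩ ⟨hb, hbc, hb0⟩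
      refine ⟨ha.add hb, hac.add hbc, ?_⟩
      have e : divGrad g (a + b) f = fun x => divGrad g a f x + divGrad g b f x :=
        funext fun x => divGrad_add g ha hb x
      rw [e, integral_add, ha0, hb0, add_zero]
      · exact (continuous_divGrad g hn ha hf).integrable_of_hasCompactSupport
          (hasCompactSupport_divGrad g hac)
      · exact (continuous_divGrad g hn hb hf).integrable_of_hasCompactSupport
          (hasCompactSupport_divGrad g hbc)
    · refine ⟨contMDiff_const (c := (0 : ℝ)), HasCompactSupport.zero, ?_⟩
      have e : divGrad g (0 : X → ℝ) f = fun x => 0 := funext fun x => divGrad_eq_zero g (by simp)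
      rw [e, integral_zero]
    · intro i _
      have h1 : ContMDiff 𝓘(ℝ, E n) 𝓘(ℝ, ℝ) ∞ (fun x => ρ i x * φ x) :=
        (ρ i).contMDiff.mul hφ
      have h2 : HasCompactSupport (fun x => ρ i x * φ x) := hc.mul_left
      exact ⟨h1, h2, integral_divGrad_of_subset_source g hn (x := i) h1 hf h2
        ((tsupport_mul_subset_left).trans (hρ i))⟩
  rw [← hsum] at key
  exact key.2.2

end Divergence

/-! ### Conformal invariance of the Yamabe functional. -/

section ConformalInvariance

variable {n : ℕ} {X : Type*} [TopologicalSpace X] [ChartedSpace (E n) X]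
  [IsManifold 𝓘(ℝ, E n) ∞ X] [MeasurableSpace X] [BorelSpace X]

lemma yamabeQ_eq (g : Metric n X) {u : X → ℝ} (hu : ContMDiff 𝓘(ℝ, E n) 𝓘(ℝ, ℝ) ∞ u) :
    yamabeQ g u = (∫ x, energyDensity g u x ∂(vol g))
      / (∫ x, |u x| ^ (2 * (n : ℝ) / ((n : ℝ) - 2)) ∂(vol g)) ^ (((n : ℝ) - 2) / n) := by
  have h : ∀ x, 4 * ((n : ℝ) - 1) / ((n : ℝ) - 2) * gradSq g u x + scalarCurvature g x * u x ^ 2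
      = energyDensity g u x := fun x => by
    rw [energyDensity, gradSq_eq g (hu.contMDiffAt.mdifferentiableAt (by simp))]
  rw [yamabeQ]
  simp only [h]

lemma energyDensity_one (g : Metric n X) (x : X) :
    energyDensity g (fun _ => 1) x = scalarCurvature g x := by
  simp [energyDensity, gradInner, dX_const]

lemma einsteinHilbert_eq (g : Metric n X) : einsteinHilbert g = yamabeQ g (fun _ => 1) := by
  rw [yamabeQ_eq g contMDiff_const, einsteinHilbert]
  simp [energyDensity_one]

lemma hasCompactSupport_energyDensity [R1Space X] (g : Metric n X) {u : X → ℝ} (hc : HasCompactSupport u) :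
    HasCompactSupport (energyDensity g u) :=
  HasCompactSupport.intro hc.isCompact fun x h => by
    simp [energyDensity, gradInner, dX_eq_zero_of_notMem h, image_eq_zero_of_notMem_tsupport h]

variable [SigmaCompactSpace X] [Nonempty X]

/-- The critical exponent times `(n-2)/2` equals `n`, so the critical power of the weight is exactly
the conformal volume factor. -/
lemma weight_rpow (hn : 3 ≤ n) (f u : X → ℝ) (x : X) :
    |weight n f x * u x| ^ (2 * (n : ℝ) / ((n : ℝ) - 2))
      = Real.exp (n * f x) * |u x| ^ (2 * (n : ℝ) / ((n : ℝ) - 2)) := by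
  have hn2 : (n : ℝ) - 2 ≠ 0 := by
    have : (3 : ℝ) ≤ n := by exact_mod_cast hn
    linarith
  rw [abs_mul, abs_of_pos (weight_pos f x), Real.mul_rpow (weight_pos f x).le (abs_nonneg _),
    weight, ← Real.exp_mul]
  congr 2
  field_simp

lemma integral_rpow_confMetric (hn : 3 ≤ n) (g : Metric n X) {f : X → ℝ}
    (hf : ContMDiff 𝓘(ℝ, E n) 𝓘(ℝ, ℝ) ∞ f) (u : X → ℝ) :
    ∫ x, |u x| ^ (2 * (n : ℝ) / ((n : ℝ) - 2)) ∂(vol (confMetric f hf g))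
      = ∫ x, |weight n f x * u x| ^ (2 * (n : ℝ) / ((n : ℝ) - 2)) ∂(vol g) := by
  rw [integral_vol g]
  refine integral_congr_ae (Eventually.of_forall fun x => ?_)
  simp only [volRatio_confMetric, weight_rpow hn]

variable [T2Space X]

/-- The divergence theorem for a potential `f` that is constant outside a compact set. -/
lemma integral_divGrad_of_hasCompactSupport_sub (g : Metric n X) (hn : n ≠ 1) {φ f : X → ℝ}
    (hφ : ContMDiff 𝓘(ℝ, E n) 𝓘(ℝ, ℝ) ∞ φ) (hf : ContMDiff 𝓘(ℝ, E n) 𝓘(ℝ, ℝ) ∞ f) {c : ℝ}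
    (hc : HasCompactSupport fun x => f x - c) :
    ∫ z, divGrad g φ f z ∂(vol g) = 0 ∧ HasCompactSupport (divGrad g φ f) := by
  have : LocallyCompactSpace X := ChartedSpace.locallyCompactSpace (E n) X
  obtain ⟨K, hK, hKs⟩ := exists_compact_superset hc.isCompact
  -- Where `f` is locally constant the divergence vanishes for every `φ`. So `φ` may be replaced by
  -- `χ φ`, with `χ` equal to 1 near the support of `f - c`, and this has compact support.
  obtain ⟨χ, h1, h0, -⟩ := exists_contMDiffMap_one_nhds_of_subset_interior 𝓘(ℝ, E n) (n := (⊤ : ℕ∞))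
    (isClosed_tsupport (fun x => f x - c)) hKs
  have hχ : HasCompactSupport χ := HasCompactSupport.intro hK h0
  have hχφ : ContMDiff 𝓘(ℝ, E n) 𝓘(ℝ, ℝ) ∞ fun x => χ x * φ x := χ.contMDiff.mul hφ
  have hz : ∀ ξ : X → ℝ, ∀ x ∉ tsupport (fun x => f x - c), divGrad g ξ f x = 0 := by
    intro ξ x hx
    have h2 : f =ᶠ[𝓝 x] fun _ => c := by
      filter_upwards [notMem_tsupport_iff_eventuallyEq.mp hx] with y hy
      simpa [sub_eq_zero] using hy
    have hr := regAt_center (n := n) x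
    have h3 : f ∘ (chartAt (E n) x).symm =ᶠ[𝓝 (chartAt (E n) x x)] fun _ => c := by
      refine hr.contMDiffAt.continuousAt.eventually (p := fun z => f z = c) ?_
      rw [eq_chart_symm]
      exact h2
    have h4 : grad (pform g (chartAt (E n) x).symm) (f ∘ (chartAt (E n) x).symm)
        =ᶠ[𝓝 (chartAt (E n) x x)] fun _ => 0 := by
      filter_upwards [h3.eventuallyEq_nhds] with y hy
      rw [grad, hy.fderiv_eq]
      simp
    rw [divGrad, gradInner, dX_congr h2, dX_const, lapX, lap, lapOp, h4.fderiv_eq, h4.self_of_nhds]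
    simp [tr]
  refine ⟨?_, HasCompactSupport.intro hc.isCompact (hz φ)⟩
  rw [← integral_divGrad g hn hχφ hf hχ.mul_right]
  refine integral_congr_ae (Eventually.of_forall fun x => ?_)
  by_cases hx : x ∈ tsupport fun x => f x - c
  · have h2 : φ =ᶠ[𝓝 x] fun x => χ x * φ x := by
      filter_upwards [(eventually_nhdsSet_iff_forall.mp h1) x hx] with y hy
      rw [hy, one_mul]
    have h3 : φ x = χ x * φ x := h2.self_of_nhds
    rw [divGrad, divGrad, gradInner, gradInner, dX_congr h2, ← h3]
  · rw [hz _ x hx, hz _ x hx]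

/-- The densities differ by a divergence with compact support. The two alternatives are the two
uses: compactly supported test functions with any `f`, and the constant test function 1 with `f`
constant near the singular point. -/
lemma integral_energyDensity_confMetric (hn : 3 ≤ n) (g : Metric n X) {f u : X → ℝ}
    (hf : ContMDiff 𝓘(ℝ, E n) 𝓘(ℝ, ℝ) ∞ f) (hu : ContMDiff 𝓘(ℝ, E n) 𝓘(ℝ, ℝ) ∞ u)
    (h : HasCompactSupport u ∨ ∃ c : ℝ, HasCompactSupport fun x => f x - c) :
    ∫ x, energyDensity (confMetric f hf g) u x ∂(vol (confMetric f hf g))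
      = ∫ x, energyDensity g (fun x => weight n f x * u x) x ∂(vol g) := by
  have hwu : ContMDiff 𝓘(ℝ, E n) 𝓘(ℝ, ℝ) ∞ fun x => weight n f x * u x :=
    (contMDiff_weight hf).mul hu
  have hφ : ContMDiff 𝓘(ℝ, E n) 𝓘(ℝ, ℝ) ∞ fun x => (weight n f x * u x) ^ 2 := by
    simp only [sq]
    exact hwu.mul hwu
  have hn1 : n ≠ 1 := by omega
  set D := divGrad g (fun x => (weight n f x * u x) ^ 2) f with hD
  obtain ⟨hD0, hDc⟩ : ∫ z, D z ∂(vol g) = 0 ∧ HasCompactSupport D := by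
    rcases h with h | ⟨c, h⟩
    · have hc : HasCompactSupport fun x => (weight n f x * u x) ^ 2 := by
        refine HasCompactSupport.intro h.isCompact fun x hx => ?_
        simp [image_eq_zero_of_notMem_tsupport hx]
      exact ⟨integral_divGrad g hn1 hφ hf hc, hasCompactSupport_divGrad g hc⟩
    · exact integral_divGrad_of_hasCompactSupport_sub g hn1 hφ hf h
  have hDi : Integrable D (vol g) :=
    (continuous_divGrad g hn1 hφ hf).integrable_of_hasCompactSupport hDc
  rw [integral_vol g]
  simp only [volRatio_confMetric]
  have h1 : ∀ x, Real.exp (n * f x) * energyDensity (confMetric f hf g) u x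
      = energyDensity g (fun x => weight n f x * u x) x - 2 * (n - 1) * D x :=
    fun x => energyDensity_confMetric hn hu x
  simp only [h1]
  by_cases hA : Integrable (energyDensity g fun x => weight n f x * u x) (vol g)
  · rw [integral_sub hA (hDi.const_mul _), integral_const_mul, hD0]
    simp
  -- Adding an integrable function does not affect integrability, so if one side is not integrable
  -- neither is the other, and both integrals are 0 by convention.
  · rw [integral_undef hA, integral_undef]
    intro hi
    refine hA ((hi.add (hDi.const_mul (2 * ((n : ℝ) - 1)))).congr ?_)
    exact Eventually.of_forall fun x => by simp

/-- The conformal invariance of the Yamabe functional. -/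
lemma yamabeQ_confMetric (hn : 3 ≤ n) (g : Metric n X) {f u : X → ℝ}
    (hf : ContMDiff 𝓘(ℝ, E n) 𝓘(ℝ, ℝ) ∞ f) (hu : ContMDiff 𝓘(ℝ, E n) 𝓘(ℝ, ℝ) ∞ u)
    (h : HasCompactSupport u ∨ ∃ c : ℝ, HasCompactSupport fun x => f x - c) :
    yamabeQ (confMetric f hf g) u = yamabeQ g fun x => weight n f x * u x := by
  have hwu : ContMDiff 𝓘(ℝ, E n) 𝓘(ℝ, ℝ) ∞ fun x => weight n f x * u x :=
    (contMDiff_weight hf).mul hu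
  rw [yamabeQ_eq _ hu, yamabeQ_eq g hwu,
    integral_energyDensity_confMetric hn g hf hu h, integral_rpow_confMetric hn]

/-- The infimum of the Yamabe functional over `C_c^∞` is a conformal invariant. -/
lemma cylYamabeConst_le_yamabeQ_confMetric (hn : 3 ≤ n) (g : Metric n X) {f u : X → ℝ}
    (hf : ContMDiff 𝓘(ℝ, E n) 𝓘(ℝ, ℝ) ∞ f) (hu : ContMDiff 𝓘(ℝ, E n) 𝓘(ℝ, ℝ) ∞ u)
    (hc : HasCompactSupport u) (h0 : u ≠ 0) :
    cylYamabeConst g ≤ (yamabeQ (confMetric f hf g) u : EReal) := by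
  rw [yamabeQ_confMetric hn g hf hu (Or.inl hc)]
  refine iInf₂_le _ ⟨(contMDiff_weight hf).mul hu, hc.mul_left, ?_⟩
  intro h
  refine h0 (funext fun x => ?_)
  have := congrFun h x
  simpa [(weight_pos (n := n) f x).ne'] using this

end ConformalInvariance

/-! ### Smoothness tested through a local diffeomorphism. -/

section LocalDescent

variable {n : ℕ} {X : Type*} [TopologicalSpace X] [ChartedSpace (E n) X]
  [IsManifold 𝓘(ℝ, E n) ∞ X]

lemma contMDiffAt_of_localDiffeomorph {ψ : E n → X} {y : E n}
    (h : IsLocalDiffeomorphAt 𝓘(ℝ, E n) 𝓘(ℝ, E n) ∞ ψ y) {f : X → ℝ}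
    (hf : ContDiffAt ℝ ∞ (f ∘ ψ) y) : ContMDiffAt 𝓘(ℝ, E n) 𝓘(ℝ, ℝ) ∞ f (ψ y) := by
  have h1 : h.localInverse (ψ y) = y := h.localInverse_left_inv h.localInverse_mem_target
  have h2 : ContMDiffAt 𝓘(ℝ, E n) 𝓘(ℝ, ℝ) ∞ ((f ∘ ψ) ∘ h.localInverse) (ψ y) := by
    refine ContMDiffAt.comp _ ?_ h.localInverse_contMDiffAt
    rw [h1]
    exact contMDiffAt_iff_contDiffAt.mpr hf
  refine h2.congr_of_eventuallyEq ?_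
  filter_upwards [h.localInverse_eventuallyEq_right] with x hx
  simp only [Function.comp_apply] at hx ⊢
  rw [hx]
  rfl

/-- Near `ψ y` the inverse chart factors as `ψ ∘ θ` with `θ` a smooth map built from the local
inverse, so the coordinate expression of `s` is the pull-back by `θ` of the given one. -/
lemma contMDiffAt_section_of_localDiffeomorph {ψ : E n → X} {y : E n}
    (h : IsLocalDiffeomorphAt 𝓘(ℝ, E n) 𝓘(ℝ, E n) ∞ ψ y)
    (s : ∀ x : X, TangentSpace 𝓘(ℝ, E n) x →L[ℝ] TangentSpace 𝓘(ℝ, E n) x →L[ℝ] ℝ)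
    (hs : ContDiffAt ℝ ∞ (fun z => pullForm (s (ψ z) : Form n) (dmap ψ z)) y) :
    ContMDiffAt 𝓘(ℝ, E n) (𝓘(ℝ, E n).prod 𝓘(ℝ, E n →L[ℝ] E n →L[ℝ] ℝ)) ∞
      (fun x => Bundle.TotalSpace.mk' (E n →L[ℝ] E n →L[ℝ] ℝ)
        (E := fun x : X => TangentSpace 𝓘(ℝ, E n) x →L[ℝ] TangentSpace 𝓘(ℝ, E n) x →L[ℝ] ℝ)
        x (s x)) (ψ y) := by
  refine contMDiffAt_section_of_chart s (ψ y) ?_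
  set e := chartAt (E n) (ψ y) with he
  set θ : E n → E n := h.localInverse ∘ e.symm with hθ
  have hinv : h.localInverse (ψ y) = y := h.localInverse_left_inv h.localInverse_mem_target
  have hr : RegAt e.symm (e (ψ y)) := regAt_center (n := n) (ψ y)
  have hey : e.symm (e (ψ y)) = ψ y := eq_chart_symm (n := n) (ψ y)
  have hθy : θ (e (ψ y)) = y := by rw [hθ, Function.comp_apply, hey, hinv]
  have hθd : ContDiffAt ℝ ∞ θ (e (ψ y)) := by
    rw [← contMDiffAt_iff_contDiffAt]
    refine ContMDiffAt.comp _ ?_ hr.contMDiffAt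
    rw [hey]
    exact h.localInverse_contMDiffAt
  have hθe : ∀ᶠ z in 𝓝 (e (ψ y)), DifferentiableAt ℝ θ z := by
    have h1 : ContDiffAt ℝ 1 θ (e (ψ y)) := hθd.of_le (by exact_mod_cast le_top)
    filter_upwards [h1.eventually (by simp)] with z hz using hz.differentiableAt (by simp)
  have h1 : e.symm =ᶠ[𝓝 (e (ψ y))] ψ ∘ θ := by
    have : Tendsto e.symm (𝓝 (e (ψ y))) (𝓝 (ψ y)) := by
      have := hr.contMDiffAt.continuousAt.tendsto
      rwa [hey] at this
    filter_upwards [this.eventually h.localInverse_eventuallyEq_right] with z hz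
    exact hz.symm
  have hψ : ∀ᶠ z in 𝓝 y, RegAt ψ z := (RegAt.of_isLocalDiffeomorphAt h).eventually
  have hψ' : ∀ᶠ z in 𝓝 (e (ψ y)), RegAt ψ (θ z) := by
    have := hθd.continuousAt.tendsto
    rw [hθy] at this
    exact this.eventually hψ
  have h2 : ContDiffAt ℝ ∞ (fun z => pullForm (pullForm (s (ψ (θ z)) : Form n) (dmap ψ (θ z)))
      (fderiv ℝ θ z)) (e (ψ y)) := by
    refine contDiffAt_pullForm (H := fun z => pullForm (s (ψ z) : Form n) (dmap ψ z)) ?_ hθd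
    rw [hθy]
    exact hs
  refine h2.congr_of_eventuallyEq ?_
  filter_upwards [h1.eventuallyEq_nhds, hθe, hψ'] with z hz1 hz2 hz3
  rw [dmap_comp hz1 (hz3.contMDiffAt.mdifferentiableAt (by simp))
    hz2]
  have key : ∀ x x' : X, x = x' → ∀ A : E n →L[ℝ] E n,
      pullForm (s x : Form n) A = pullForm (s x' : Form n) A := by
    rintro x _ rfl A
    rfl
  rw [key _ _ hz1.self_of_nhds]
  rfl

end LocalDescent

/-! ### Geometry of a uniformization: orbits, neighbourhoods of the singular point, descent. -/

section Orbifold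

variable {n : ℕ} {M : Type*} [TopologicalSpace M] {p : M} [ChartedSpace (E n) (Punctured M p)]
  {Γ : Subgroup (E n ≃ₗᵢ[ℝ] E n)}

lemma mem_puncturedBall {r : ℝ} {x : E n} : x ∈ puncturedBall n r ↔ ‖x‖ < r ∧ x ≠ 0 := by
  simp [puncturedBall]

lemma puncturedBall_mono {r s : ℝ} (h : r ≤ s) : puncturedBall n r ⊆ puncturedBall n s :=
  fun _ hx => mem_puncturedBall.mpr
    ⟨(mem_puncturedBall.mp hx).1.trans_le h, (mem_puncturedBall.mp hx).2⟩

lemma isOpen_puncturedBall (r : ℝ) : IsOpen (puncturedBall n r) :=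
  Metric.isOpen_ball.sdiff isClosed_singleton

lemma smul_mem_puncturedBall {r : ℝ} {x : E n} (γ : E n ≃ₗᵢ[ℝ] E n) :
    γ x ∈ puncturedBall n r ↔ x ∈ puncturedBall n r := by
  simp [mem_puncturedBall]

lemma proj_eq_iff {x y : E n} : proj Γ x = proj Γ y ↔ ∃ γ ∈ Γ, γ x = y :=
  Quotient.eq (r := orbitSetoid Γ)

lemma proj_smul {γ : E n ≃ₗᵢ[ℝ] E n} (hγ : γ ∈ Γ) (x : E n) : proj Γ (γ x) = proj Γ x :=
  (proj_eq_iff.mpr ⟨γ, hγ, rfl⟩).symm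

lemma norm_eq_of_proj_eq {x y : E n} (h : proj Γ x = proj Γ y) : ‖x‖ = ‖y‖ := by
  obtain ⟨γ, -, rfl⟩ := proj_eq_iff.mp h
  exact (γ.norm_map x).symm

lemma continuous_proj : Continuous (proj Γ) := continuous_quotient_mk'

lemma isOpenMap_proj : IsOpenMap (proj Γ) := by
  intro O hO
  have h : (proj Γ) ⁻¹' (proj Γ '' O) = ⋃ γ ∈ Γ, γ '' O := by
    ext x
    simp only [Set.mem_preimage, Set.mem_image, Set.mem_iUnion, proj_eq_iff]
    constructor
    · rintro ⟨y, hy, γ, hγ, h⟩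
      exact ⟨γ, hγ, y, hy, h⟩
    · rintro ⟨γ, hγ, y, hy, h⟩
      exact ⟨y, hy, γ, hγ, h⟩
  have h2 : IsOpen ((proj Γ) ⁻¹' (proj Γ '' O)) := by
    rw [h]
    exact isOpen_biUnion fun γ _ => γ.toHomeomorph.isOpenMap O hO
  exact isOpen_coinduced.mpr h2

lemma mem_image_proj_ball {r : ℝ} {x : E n} :
    proj Γ x ∈ proj Γ '' Metric.ball 0 r ↔ ‖x‖ < r := by
  constructor
  · rintro ⟨y, hy, h⟩
    rw [← norm_eq_of_proj_eq h]
    simpa using hy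
  · intro h
    exact ⟨x, by simpa using h, rfl⟩

variable (u : LocalUniformization Γ p)

namespace LocalUniformization

lemma proj_mem_target {x : E n} : proj Γ x ∈ u.φ.target ↔ ‖x‖ < u.τ := by
  rw [u.target_eq, mem_image_proj_ball]

variable {u}

lemma φ_lift {x : E n} (hx : x ∈ puncturedBall n u.τ) : u.φ (u.lift x) = proj Γ x := by
  rw [u.lift_eq x hx, u.φ.right_inv (u.proj_mem_target.mpr (mem_puncturedBall.mp hx).1)]

lemma lift_mem_source {x : E n} (hx : x ∈ puncturedBall n u.τ) : (u.lift x : M) ∈ u.φ.source := by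
  rw [u.lift_eq x hx]
  exact u.φ.map_target (u.proj_mem_target.mpr (mem_puncturedBall.mp hx).1)

/-- Since `φ` is injective, the fibres of the uniformizing map are exactly the `Γ`-orbits. Descent
of invariant objects rests on this. -/
lemma lift_eq_lift_iff {x y : E n} (hx : x ∈ puncturedBall n u.τ) (hy : y ∈ puncturedBall n u.τ) :
    u.lift x = u.lift y ↔ ∃ γ ∈ Γ, γ x = y := by
  rw [← proj_eq_iff]
  constructor
  · intro h
    rw [← φ_lift hx, ← φ_lift hy, h]
  · intro h
    apply Subtype.ext
    rw [u.lift_eq x hx, u.lift_eq y hy, h]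

lemma lift_smul {γ : E n ≃ₗᵢ[ℝ] E n} (hγ : γ ∈ Γ) {x : E n} (hx : x ∈ puncturedBall n u.τ) :
    u.lift (γ x) = u.lift x :=
  ((lift_eq_lift_iff hx ((smul_mem_puncturedBall γ).mpr hx)).mpr ⟨γ, hγ, rfl⟩).symm

lemma exists_lift_eq {m : Punctured M p} (hm : (m : M) ∈ u.φ.source) :
    ∃ x ∈ puncturedBall n u.τ, u.lift x = m := by
  have h1 := u.φ.map_source hm
  rw [u.target_eq] at h1
  obtain ⟨x, hx, h⟩ := h1
  have hx0 : x ≠ 0 := by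
    rintro rfl
    refine m.2 ?_
    rw [← u.φ.left_inv hm, ← h, ← u.map_singular, u.φ.left_inv u.mem_source]
  have hxp : x ∈ puncturedBall n u.τ := ⟨hx, hx0⟩
  refine ⟨x, hxp, Subtype.ext ?_⟩
  rw [u.lift_eq x hxp, h, u.φ.left_inv hm]

lemma regAt_lift [IsManifold 𝓘(ℝ, E n) ∞ (Punctured M p)] {x : E n}
    (hx : x ∈ puncturedBall n u.τ) : RegAt u.lift x :=
  RegAt.of_isLocalDiffeomorphAt (u.isLocalDiffeo ⟨x, hx⟩)

variable (u)

/-- The neighbourhood of the singular point that corresponds to the ball of radius `r`. -/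
def nhd (r : ℝ) : Set M := u.φ.source ∩ u.φ ⁻¹' (proj Γ '' Metric.ball 0 r)

lemma isOpen_nhd (r : ℝ) : IsOpen (u.nhd r) :=
  u.φ.isOpen_inter_preimage (isOpenMap_proj _ Metric.isOpen_ball)

lemma singular_mem_nhd {r : ℝ} (hr : 0 < r) : p ∈ u.nhd r :=
  ⟨u.mem_source, by
    rw [Set.mem_preimage, u.map_singular, mem_image_proj_ball]
    simpa using hr⟩

variable {u}

lemma lift_mem_nhd {r : ℝ} {x : E n} (hx : x ∈ puncturedBall n u.τ) :
    (u.lift x : M) ∈ u.nhd r ↔ ‖x‖ < r := by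
  rw [nhd, Set.mem_inter_iff, Set.mem_preimage, φ_lift hx, mem_image_proj_ball]
  exact ⟨fun h => h.2, fun h => ⟨lift_mem_source hx, h⟩⟩

lemma mem_nhd_iff {r : ℝ} {m : Punctured M p} :
    (m : M) ∈ u.nhd r ↔ ∃ x ∈ puncturedBall n u.τ, ‖x‖ < r ∧ u.lift x = m := by
  constructor
  · intro h
    obtain ⟨x, hx, rfl⟩ := exists_lift_eq h.1
    exact ⟨x, hx, (lift_mem_nhd hx).mp h, rfl⟩
  · rintro ⟨x, hx, h, rfl⟩
    exact (lift_mem_nhd hx).mpr h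

variable (u)

/-- The complement of a neighbourhood of the singular point is compact. -/
lemma isCompact_compl_nhd [CompactSpace M] {r : ℝ} (hr : 0 < r) :
    IsCompact {m : Punctured M p | (m : M) ∉ u.nhd r} := by
  have h1 : IsCompact (u.nhd r)ᶜ := (u.isOpen_nhd r).isClosed_compl.isCompact
  refine Topology.IsInducing.subtypeVal.isCompact_preimage' h1 fun m hm => ?_
  refine ⟨⟨m, ?_⟩, rfl⟩
  rintro rfl
  exact hm (u.singular_mem_nhd hr)

lemma isOpen_preimage_nhd (r : ℝ) : IsOpen {m : Punctured M p | (m : M) ∈ u.nhd r} :=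
  (u.isOpen_nhd r).preimage continuous_subtype_val

include u in
-- Complements of the neighbourhoods of radius `τ/(k+1)` are compact and exhaust the punctured
-- space.
lemma sigmaCompactSpace [CompactSpace M] : SigmaCompactSpace (Punctured M p) := by
  have hpos : ∀ k : ℕ, 0 < u.τ / (k + 1) := fun k => div_pos u.τ_pos (by positivity)
  refine ⟨⟨fun k => {m : Punctured M p | (m : M) ∉ u.nhd (u.τ / (k + 1))},
    fun k => u.isCompact_compl_nhd (hpos k), ?_⟩⟩
  rw [Set.eq_univ_iff_forall]
  intro m
  by_contra h
  simp only [Set.mem_iUnion, Set.mem_ofPred_eq, not_exists, not_not] at h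
  obtain ⟨x, hx, -, rfl⟩ := mem_nhd_iff.mp (h 0)
  have h1 : ∀ k : ℕ, ‖x‖ < u.τ / (k + 1) := fun k => (lift_mem_nhd hx).mp (h k)
  have hx0 : 0 < ‖x‖ := norm_pos_iff.mpr (mem_puncturedBall.mp hx).2
  obtain ⟨k, hk⟩ := exists_nat_gt (u.τ / ‖x‖)
  have h2 := h1 k
  rw [lt_div_iff₀ (by positivity)] at h2
  rw [div_lt_iff₀ hx0] at hk
  nlinarith

include u in
lemma nonempty : Nonempty (Punctured M p) := ⟨u.lift 0⟩

/-- The image of a closed ball in `M \ {p}` is closed. -/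
lemma isClosed_image_closedBall [T2Space M] {r : ℝ} (hr : r < u.τ) :
    IsClosed {m : Punctured M p | ∃ x ∈ puncturedBall n u.τ, ‖x‖ ≤ r ∧ u.lift x = m} := by
  have h1 : IsCompact ((fun x => u.φ.symm (proj Γ x)) '' Metric.closedBall (0 : E n) r) := by
    refine (isCompact_closedBall _ _).image_of_continuousOn ?_
    refine u.φ.continuousOn_symm.comp continuous_proj.continuousOn fun x hx => ?_
    rw [u.proj_mem_target]
    exact (mem_closedBall_zero_iff.mp hx).trans_lt hr
  have h2 := h1.isClosed.preimage (continuous_subtype_val (p := fun m : M => m ≠ p))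
  convert! h2 using 1
  ext m
  simp only [Set.mem_ofPred_eq, Set.mem_preimage, Set.mem_image, mem_closedBall_zero_iff]
  constructor
  · rintro ⟨x, hx, hxr, rfl⟩
    exact ⟨x, hxr, (u.lift_eq x hx).symm⟩
  · rintro ⟨x, hxr, h⟩
    have hx : x ∈ puncturedBall n u.τ := by
      refine mem_puncturedBall.mpr ⟨hxr.trans_lt hr, ?_⟩
      rintro rfl
      refine m.2 ?_
      rw [← h, ← u.map_singular, u.φ.left_inv u.mem_source]
    exact ⟨x, hx, hxr, Subtype.ext ((u.lift_eq x hx).trans h)⟩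

lemma symm_proj_zero : u.φ.symm (proj Γ 0) = p := by
  rw [← u.map_singular, u.φ.left_inv u.mem_source]

variable [T2Space M] [IsManifold 𝓘(ℝ, E n) ∞ (Punctured M p)]

/-- An invariant function on the punctured ball that is constant near the boundary descends. -/
lemma exists_descent {F : E n → ℝ} {r c : ℝ} (hr : r < u.τ)
    (hF : ∀ x ∈ puncturedBall n u.τ, ContDiffAt ℝ ∞ F x)
    (hi : ∀ γ ∈ Γ, ∀ x ∈ puncturedBall n u.τ, F (γ x) = F x)
    (hc : ∀ x ∈ puncturedBall n u.τ, r < ‖x‖ → F x = c) :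
    ∃ f : Punctured M p → ℝ, ContMDiff 𝓘(ℝ, E n) 𝓘(ℝ, ℝ) ∞ f ∧
      (∀ x ∈ puncturedBall n u.τ, f (u.lift x) = F x) ∧
      ∀ m : Punctured M p, (m : M) ∉ u.nhd u.τ → f m = c := by
  classical
  set f : Punctured M p → ℝ := fun m =>
    if h : ∃ x ∈ puncturedBall n u.τ, u.lift x = m then F h.choose else c with hf
  have h1 : ∀ x ∈ puncturedBall n u.τ, f (u.lift x) = F x := by
    intro x hx
    have h : ∃ y ∈ puncturedBall n u.τ, u.lift y = u.lift x := ⟨x, hx, rfl⟩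
    obtain ⟨γ, hγ, e⟩ := (lift_eq_lift_iff h.choose_spec.1 hx).mp h.choose_spec.2
    simp only [hf, dif_pos h]
    rw [← hi γ hγ _ h.choose_spec.1, e]
  have h2 : ∀ m : Punctured M p, (¬ ∃ x ∈ puncturedBall n u.τ, ‖x‖ ≤ r ∧ u.lift x = m) →
      f m = c := by
    intro m hm
    by_cases h : ∃ x ∈ puncturedBall n u.τ, u.lift x = m
    · obtain ⟨x, hx, rfl⟩ := h
      rw [h1 x hx, hc x hx]
      by_contra hxr
      exact hm ⟨x, hx, not_lt.mp hxr, rfl⟩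
    · simp only [hf, dif_neg h]
  refine ⟨f, fun m => ?_, h1, fun m hm => h2 m ?_⟩
  · by_cases h : ∃ x ∈ puncturedBall n u.τ, u.lift x = m
    · obtain ⟨x, hx, rfl⟩ := h
      refine contMDiffAt_of_localDiffeomorph (u.isLocalDiffeo ⟨x, hx⟩) ?_
      refine (hF x hx).congr_of_eventuallyEq ?_
      filter_upwards [(isOpen_puncturedBall u.τ).mem_nhds hx] with y hy using h1 y hy
    · refine contMDiffAt_const (c := c) |>.congr_of_eventuallyEq ?_
      have : m ∈ {m : Punctured M p | ∃ x ∈ puncturedBall n u.τ, ‖x‖ ≤ r ∧ u.lift x = m}ᶜ :=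
        fun ⟨x, hx, _, e⟩ => h ⟨x, hx, e⟩
      filter_upwards [(u.isClosed_image_closedBall hr).isOpen_compl.mem_nhds this] with m' hm'
      exact h2 m' hm'
  · rintro ⟨x, hx, -, rfl⟩
    exact hm ((lift_mem_nhd hx).mpr (mem_puncturedBall.mp hx).1)

/-- An invariant metric on the punctured ball that agrees with a given metric near the boundary
descends. -/
lemma exists_metric_descent (g : Metric n (Punctured M p)) {H : E n → Form n} {r : ℝ}
    (hr : r < u.τ) (hH : ∀ x ∈ puncturedBall n u.τ, ContDiffAt ℝ ∞ H x)
    (hp : ∀ x ∈ puncturedBall n u.τ, IsInnerForm (H x))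
    (hi : ∀ γ ∈ Γ, ∀ x ∈ puncturedBall n u.τ, ∀ v w, H (γ x) (γ v) (γ w) = H x v w)
    (hc : ∀ x ∈ puncturedBall n u.τ, r < ‖x‖ → H x = pform g u.lift x) :
    ∃ g' : Metric n (Punctured M p),
      (∀ x ∈ puncturedBall n u.τ, pform g' u.lift x = H x) ∧
      ∀ m : Punctured M p, (¬ ∃ x ∈ puncturedBall n u.τ, ‖x‖ ≤ r ∧ u.lift x = m) →
        ginner g' m = ginner g m := by
  classical
  set s : Punctured M p → Form n := fun m =>
    if h : ∃ x ∈ puncturedBall n u.τ, u.lift x = m then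
      pullForm (H h.choose) (dmap u.lift h.choose).inverse else ginner g m with hs
  have hinv : ∀ x ∈ puncturedBall n u.τ, ∀ v, (dmap u.lift x).inverse (dmap u.lift x v) = v ∧
      dmap u.lift x ((dmap u.lift x).inverse v) = v := by
    intro x hx v
    have hb := (regAt_lift hx).bijective
    have e : dmap u.lift x = (ContinuousLinearEquiv.ofBijective (dmap u.lift x)
      (LinearMap.ker_eq_bot.mpr hb.injective) (LinearMap.range_eq_top.mpr hb.surjective) :
      E n →L[ℝ] E n) := by ext; rfl
    rw [e, ContinuousLinearMap.inverse_equiv]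
    simp
  have h1 : ∀ x ∈ puncturedBall n u.τ, pullForm (s (u.lift x)) (dmap u.lift x) = H x := by
    intro x hx
    have h : ∃ y ∈ puncturedBall n u.τ, u.lift y = u.lift x := ⟨x, hx, rfl⟩
    simp only [hs, dif_pos h]
    generalize hy' : h.choose = y
    have hy : y ∈ puncturedBall n u.τ := hy' ▸ h.choose_spec.1
    have hyx : u.lift y = u.lift x := hy' ▸ h.choose_spec.2
    obtain ⟨γ, hγ, rfl⟩ := (lift_eq_lift_iff hy hx).mp hyx
    have h3 : u.lift =ᶠ[𝓝 y] u.lift ∘ γ := by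
      filter_upwards [(isOpen_puncturedBall u.τ).mem_nhds hy] with z hz
      exact (lift_smul hγ hz).symm
    have h4 : dmap u.lift y = (dmap u.lift (γ y)).comp (fderiv ℝ γ y) :=
      dmap_comp h3 ((regAt_lift hx).contMDiffAt.mdifferentiableAt (by simp))
        γ.differentiable.differentiableAt
    have h5 : fderiv ℝ γ y = (γ : E n →L[ℝ] E n) :=
      (γ : E n →L[ℝ] E n).fderiv
    ext v w
    -- Differentiating `lift ∘ γ = lift` shows that two preimages of a point have differentials
    -- related by `γ`. Invariance of `H` then makes the form on the quotient independent of the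
    -- chosen preimage.
    have h6 : ∀ v, dmap u.lift (γ y) v = dmap u.lift y (γ.symm v) := by
      intro v
      rw [h4, h5]
      simp
    rw [pullForm_apply, pullForm_apply, h6, h6, (hinv y hy _).1, (hinv y hy _).1, ← hi γ hγ y hy]
    simp
  have h2 : ∀ m : Punctured M p, (¬ ∃ x ∈ puncturedBall n u.τ, ‖x‖ ≤ r ∧ u.lift x = m) →
      s m = ginner g m := by
    intro m hm
    by_cases h : ∃ x ∈ puncturedBall n u.τ, u.lift x = m
    · obtain ⟨x, hx, rfl⟩ := h
      have h3 := (h1 x hx).trans (hc x hx (by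
        by_contra hxr
        exact hm ⟨x, hx, not_lt.mp hxr, rfl⟩))
      ext v w
      have h4 := DFunLike.congr_fun (DFunLike.congr_fun h3 ((dmap u.lift x).inverse v))
        ((dmap u.lift x).inverse w)
      rw [pform, pullForm_apply, pullForm_apply, (hinv x hx _).2, (hinv x hx _).2] at h4
      exact h4
    · simp only [hs, dif_neg h]
  have hsp : ∀ m, IsInnerForm (s m) := by
    intro m
    by_cases h : ∃ x ∈ puncturedBall n u.τ, u.lift x = m
    · simp only [hs, dif_pos h]
      refine (hp _ h.choose_spec.1).pullForm fun v w hvw => ?_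
      rw [← (hinv _ h.choose_spec.1 v).2, ← (hinv _ h.choose_spec.1 w).2, hvw]
    · simp only [hs, dif_neg h]
      exact isInnerForm_ginner g m
  refine ⟨mkMetric s hsp fun m => ?_, h1, h2⟩
  by_cases h : ∃ x ∈ puncturedBall n u.τ, u.lift x = m
  · obtain ⟨x, hx, rfl⟩ := h
    refine contMDiffAt_section_of_localDiffeomorph (u.isLocalDiffeo ⟨x, hx⟩) s ?_
    refine (hH x hx).congr_of_eventuallyEq ?_
    filter_upwards [(isOpen_puncturedBall u.τ).mem_nhds hx] with y hy using h1 y hy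
  · refine (g.contMDiff m).congr_of_eventuallyEq ?_
    have : m ∈ {m : Punctured M p | ∃ x ∈ puncturedBall n u.τ, ‖x‖ ≤ r ∧ u.lift x = m}ᶜ :=
      fun ⟨x, hx, _, e⟩ => h ⟨x, hx, e⟩
    filter_upwards [(u.isClosed_image_closedBall hr).isOpen_compl.mem_nhds this] with m' hm'
    rw [h2 m' hm']
    rfl

end LocalUniformization

end Orbifold

/-! ### Radial cutoff functions. -/

section RadialCut

variable {n : ℕ}

/-- A radial cutoff function, equal to `1` for `‖x‖ ≤ a` and to `0` for `‖x‖ ≥ b`. -/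
def radialCut (a b : ℝ) (x : E n) : ℝ := Real.smoothTransition ((b ^ 2 - ‖x‖ ^ 2) / (b ^ 2 - a ^ 2))

lemma contDiff_radialCut (a b : ℝ) : ContDiff ℝ ∞ (radialCut (n := n) a b) :=
  Real.smoothTransition.contDiff.comp ((contDiff_const.sub (contDiff_norm_sq ℝ)).div_const _)

lemma radialCut_eq_one {a b : ℝ} (ha : 0 ≤ a) (hab : a < b) {x : E n} (hx : ‖x‖ ≤ a) :
    radialCut a b x = 1 := by
  refine Real.smoothTransition.one_of_one_le ?_
  rw [le_div_iff₀ (by nlinarith), one_mul]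
  nlinarith [norm_nonneg x]

lemma radialCut_eq_zero {a b : ℝ} (ha : 0 ≤ a) (hab : a < b) {x : E n} (hx : b ≤ ‖x‖) :
    radialCut a b x = 0 := by
  refine Real.smoothTransition.zero_of_nonpos (div_nonpos_of_nonpos_of_nonneg ?_ ?_)
  · nlinarith [norm_nonneg x]
  · nlinarith

lemma radialCut_nonneg (a b : ℝ) (x : E n) : 0 ≤ radialCut a b x :=
  Real.smoothTransition.nonneg _

lemma radialCut_le_one (a b : ℝ) (x : E n) : radialCut a b x ≤ 1 :=
  Real.smoothTransition.le_one _

lemma radialCut_smul (a b : ℝ) (γ : E n ≃ₗᵢ[ℝ] E n) (x : E n) :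
    radialCut a b (γ x) = radialCut a b x := by
  rw [radialCut, radialCut, γ.norm_map]

lemma scal_congr {B B' : E n → Form n} {y : E n} (h : B =ᶠ[𝓝 y] B') : scal B y = scal B' y := by
  have h1 : chr B =ᶠ[𝓝 y] chr B' := by
    filter_upwards [h.eventuallyEq_nhds] with z hz
    rw [chr, chr, hz.self_of_nhds, hz.fderiv_eq]
  rw [scal, scal, h1.self_of_nhds, h1.fderiv_eq, h.self_of_nhds]

lemma exists_fderiv_radialCut_bound (a b : ℝ) (ha : 0 ≤ a) (hab : a < b) :
    ∃ L : ℝ, 0 ≤ L ∧ ∀ x : E n, ‖fderiv ℝ (radialCut a b) x‖ ≤ L := by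
  have hc : HasCompactSupport (radialCut (n := n) a b) :=
    HasCompactSupport.intro (isCompact_closedBall (0 : E n) b) fun x hx =>
      radialCut_eq_zero ha hab (by simpa using (not_le.mp fun h => hx (by simpa using h)).le)
  obtain ⟨L, hL⟩ := (hc.fderiv ℝ).exists_bound_of_continuous
    ((contDiff_radialCut a b).continuous_fderiv (by simp))
  exact ⟨L, (norm_nonneg _).trans (hL 0), hL⟩

end RadialCut

/-! ### Bounds for orbifold metrics and cutoffs near the singular point. -/

section OrbifoldMetric

variable {n : ℕ} {M : Type*} [TopologicalSpace M] {p : M} [ChartedSpace (E n) (Punctured M p)]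
  [IsManifold 𝓘(ℝ, E n) ∞ (Punctured M p)] {Γ : Subgroup (E n ≃ₗᵢ[ℝ] E n)}

/-- `G` is the invariant smooth metric on the ball that uniformizes the orbifold metric `g`. -/
structure OrbForm (u : LocalUniformization Γ p) (g : Metric n (Punctured M p)) (G : E n → Form n) :
    Prop where
  contDiffAt : ∀ {x : E n}, ‖x‖ < u.τ → ContDiffAt ℝ ∞ G x
  isInnerForm : ∀ {x : E n}, ‖x‖ < u.τ → IsInnerForm (G x)
  inv : ∀ γ ∈ Γ, ∀ {x : E n}, ‖x‖ < u.τ → ∀ v w, G (γ x) (γ v) (γ w) = G x v w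
  pform_eq : ∀ {x : E n}, x ∈ puncturedBall n u.τ → pform g u.lift x = G x

lemma isOrbifoldMetric_iff {u : LocalUniformization Γ p} {g : Metric n (Punctured M p)} :
    IsOrbifoldMetric u g ↔ ∃ G, OrbForm u g G := by
  constructor
  · rintro ⟨G, h1, h2, h3, h4, h5⟩
    refine ⟨G, fun {x} hx => ?_, fun {x} hx => ⟨h2 x (by simpa using hx), h3 x (by simpa using hx)⟩,
      fun γ hγ x hx => h4 γ hγ x (by simpa using hx), fun {x} hx => ?_⟩
    · exact h1.contDiffAt (Metric.isOpen_ball.mem_nhds (by simpa using hx))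
    · ext v w
      exact h5 x hx v w
  · rintro ⟨G, h⟩
    refine ⟨G, fun x hx => (h.contDiffAt (by simpa using hx)).contDiffWithinAt,
      fun x hx => (h.isInnerForm (by simpa using hx)).symm,
      fun x hx => (h.isInnerForm (by simpa using hx)).pos,
      fun γ hγ x hx => h.inv γ hγ (by simpa using hx), fun x hx v w => ?_⟩
    rw [← pform_apply, h.pform_eq hx]

namespace OrbForm

variable {u : LocalUniformization Γ p} {g : Metric n (Punctured M p)} {G : E n → Form n}

lemma eventuallyEq (h : OrbForm u g G) {x : E n} (hx : x ∈ puncturedBall n u.τ) :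
    pform g u.lift =ᶠ[𝓝 x] G := by
  filter_upwards [(isOpen_puncturedBall u.τ).mem_nhds hx] with y hy using h.pform_eq hy

lemma scalarCurvature_eq (h : OrbForm u g G) {x : E n} (hx : x ∈ puncturedBall n u.τ) :
    scalarCurvature g (u.lift x) = scal G x := by
  rw [(LocalUniformization.regAt_lift hx).scalarCurvature_eq g, scal_congr (h.eventuallyEq hx)]

lemma gradInner_eq (h : OrbForm u g G) {x : E n} (hx : x ∈ puncturedBall n u.τ)
    {v w : Punctured M p → ℝ} (hv : ContMDiff 𝓘(ℝ, E n) 𝓘(ℝ, ℝ) ∞ v)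
    (hw : ContMDiff 𝓘(ℝ, E n) 𝓘(ℝ, ℝ) ∞ w) :
    gradInner g v w (u.lift x)
      = fderiv ℝ (v ∘ u.lift) x (sharp (G x) (fderiv ℝ (w ∘ u.lift) x)) := by
  rw [(LocalUniformization.regAt_lift hx).gradInner_eq g
    (hv.contMDiffAt.mdifferentiableAt (by simp)) (hw.contMDiffAt.mdifferentiableAt (by simp)),
    ← h.pform_eq hx]
  rfl

lemma half_lt : u.τ / 2 < u.τ := half_lt_self u.τ_pos

/-- Continuity is available only on the open ball of radius `τ`, so uniform bounds are taken on the
closed ball of half the radius. This is the origin of the conditions `r ≤ τ/2` and `3ε ≤ τ/2` below.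
-/
lemma exists_bound_of_continuous (u : LocalUniformization Γ p) {F : E n → ℝ}
    (hF : ∀ {x : E n}, ‖x‖ < u.τ → ContinuousAt F x) :
    ∃ C : ℝ, 0 ≤ C ∧ ∀ x : E n, ‖x‖ ≤ u.τ / 2 → |F x| ≤ C := by
  have hc : ContinuousOn F (Metric.closedBall 0 (u.τ / 2)) := fun x hx =>
    (hF ((mem_closedBall_zero_iff.mp hx).trans_lt half_lt)).continuousWithinAt
  obtain ⟨C, hC⟩ := (isCompact_closedBall (0 : E n) (u.τ / 2)).exists_bound_of_continuousOn hc
  exact ⟨C, (norm_nonneg _).trans (hC 0 (by simpa using (half_pos u.τ_pos).le)), fun x hx => hC x (by simpa using hx)⟩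

lemma exists_bound_sharp (h : OrbForm u g G) :
    ∃ C : ℝ, 0 ≤ C ∧ ∀ x : E n, ‖x‖ ≤ u.τ / 2 → ‖sharp (G x)‖ ≤ C := by
  obtain ⟨C, hC, hb⟩ := exists_bound_of_continuous u (F := fun x => ‖sharp (G x)‖) fun hx =>
    ((contDiffAt_sharp (h.isInnerForm hx)).comp _ (h.contDiffAt hx)).continuousAt.norm
  exact ⟨C, hC, fun x hx => by simpa using hb x hx⟩

variable [CompactSpace M]

lemma exists_bound_scalarCurvature (h : OrbForm u g G) :
    ∃ C : ℝ, 0 ≤ C ∧ ∀ m, |scalarCurvature g m| ≤ C := by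
  obtain ⟨C₁, hC₁, hb₁⟩ := exists_bound_of_continuous u (F := scal G) fun hx =>
    (contDiffAt_scal' (h.contDiffAt hx) (h.isInnerForm hx)).continuousAt
  obtain ⟨C₂, hb₂⟩ := (u.isCompact_compl_nhd (half_pos u.τ_pos)).exists_bound_of_continuousOn
    (continuous_scalarCurvature g).continuousOn
  refine ⟨max C₁ C₂, le_max_of_le_left hC₁, fun m => ?_⟩
  by_cases hm : (m : M) ∈ u.nhd (u.τ / 2)
  · obtain ⟨x, hx, hxr, rfl⟩ := LocalUniformization.mem_nhd_iff.mp hm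
    rw [h.scalarCurvature_eq hx]
    exact (hb₁ x hxr.le).trans (le_max_left _ _)
  · exact (hb₂ m hm).trans (le_max_right _ _)

variable [MeasurableSpace M] [BorelSpace M]

/-- The neighbourhood is the image of a punctured Euclidean ball, on which the density of the
extended metric is bounded. -/
lemma exists_vol_nhd_le (h : OrbForm u g G) :
    ∃ C : ℝ, 0 ≤ C ∧ ∀ r, 0 < r → r ≤ u.τ / 2 →
      vol g {m | (m : M) ∈ u.nhd r} ≤ ENNReal.ofReal (C * r ^ n) := by
  have := u.sigmaCompactSpace
  have := u.nonempty
  obtain ⟨D, hD, hb⟩ := exists_bound_of_continuous u (F := fun x => dens (G x)) fun hx =>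
    continuous_dens.continuousAt.comp (h.contDiffAt hx).continuousAt
  refine ⟨D * (volume (Metric.ball (0 : E n) 1)).toReal, by positivity, fun r hr0 hr => ?_⟩
  have hsub : puncturedBall n r ⊆ puncturedBall n u.τ := puncturedBall_mono (hr.trans half_lt.le)
  have h1 : {m : Punctured M p | (m : M) ∈ u.nhd r} = u.lift '' puncturedBall n r := by
    ext m
    rw [Set.mem_ofPred_eq, LocalUniformization.mem_nhd_iff]
    constructor
    · rintro ⟨x, hx, hxr, rfl⟩
      exact ⟨x, mem_puncturedBall.mpr ⟨hxr, (mem_puncturedBall.mp hx).2⟩, rfl⟩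
    · rintro ⟨x, hx, rfl⟩
      exact ⟨x, hsub hx, (mem_puncturedBall.mp hx).1, rfl⟩
  have hm : MeasurableSet (puncturedBall n r) := (isOpen_puncturedBall r).measurableSet
  calc vol g {m : Punctured M p | (m : M) ∈ u.nhd r}
      ≤ ∫⁻ y in puncturedBall n r, ENNReal.ofReal (dens (pform g u.lift y)) := by
        rw [h1]
        exact vol_image_le g hm fun y hy => u.isLocalDiffeo ⟨y, hsub hy⟩
    _ ≤ ∫⁻ _ in puncturedBall n r, ENNReal.ofReal D := by
        refine setLIntegral_mono measurable_const fun y hy => ENNReal.ofReal_le_ofReal ?_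
        rw [h.pform_eq (hsub hy)]
        exact (le_abs_self _).trans (hb y ((mem_puncturedBall.mp hy).1.le.trans hr))
    _ ≤ ENNReal.ofReal D * volume (Metric.ball (0 : E n) r) := by
        rw [setLIntegral_const]
        gcongr
        exact Set.sdiff_subset
    _ = _ := by
        rw [Measure.addHaar_ball_of_pos _ _ hr0, finrank_euclideanSpace_fin,
          ← ENNReal.ofReal_toReal (measure_ball_lt_top (μ := volume) (x := (0 : E n)) (r := 1)).ne,
          ← ENNReal.ofReal_mul (by positivity), ← ENNReal.ofReal_mul hD,
          ENNReal.toReal_ofReal ENNReal.toReal_nonneg]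
        congr 1
        ring

lemma isFiniteMeasure_vol (h : OrbForm u g G) : IsFiniteMeasure (vol g) := by
  have := u.sigmaCompactSpace
  have := u.nonempty
  obtain ⟨C, hC, hb⟩ := h.exists_vol_nhd_le
  refine ⟨?_⟩
  have h1 : (Set.univ : Set (Punctured M p)) = {m : Punctured M p | (m : M) ∈ u.nhd (u.τ / 2)}
      ∪ {m : Punctured M p | (m : M) ∉ u.nhd (u.τ / 2)} := by
    ext m
    simp [em]
  rw [h1]
  refine (measure_union_le _ _).trans_lt (ENNReal.add_lt_top.mpr ⟨?_, ?_⟩)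
  · exact (hb _ (half_pos u.τ_pos) le_rfl).trans_lt ENNReal.ofReal_lt_top
  · exact (u.isCompact_compl_nhd (half_pos u.τ_pos)).measure_lt_top

variable [T2Space M]

/-- The function descends from a rescaled radial profile that vanishes for `|x| < ε` and equals 1
for `|x| > 2ε`; rescaling costs `1/ε` in the gradient. The radius `3ε` leaves a margin, so that the
cutoff is locally constant at every point outside that neighbourhood. -/
lemma exists_cutoff (h : OrbForm u g G) :
    ∃ C : ℝ, 0 ≤ C ∧ ∀ ε, 0 < ε → 3 * ε ≤ u.τ / 2 → ∃ χ : Punctured M p → ℝ,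
      ContMDiff 𝓘(ℝ, E n) 𝓘(ℝ, ℝ) ∞ χ ∧ HasCompactSupport χ ∧ (∀ m, 0 ≤ χ m ∧ χ m ≤ 1) ∧
      (∀ m : Punctured M p, (m : M) ∉ u.nhd (3 * ε) → χ m = 1 ∧ gradInner g χ χ m = 0) ∧
      ∀ m : Punctured M p, (m : M) ∈ u.nhd (3 * ε) → gradInner g χ χ m ≤ C / ε ^ 2 := by
  obtain ⟨S, hS, hSb⟩ := h.exists_bound_sharp
  obtain ⟨L, hL, hLb⟩ := exists_fderiv_radialCut_bound (n := n) 1 2 zero_le_one one_lt_two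
  refine ⟨L * (S * L), by positivity, fun ε hε hετ => ?_⟩
  have h2ε : 2 * ε < u.τ := by linarith [half_lt (u := u)]
  set F : E n → ℝ := fun x => 1 - radialCut 1 2 (ε⁻¹ • x) with hF
  have hFd : ContDiff ℝ ∞ F :=
    contDiff_const.sub ((contDiff_radialCut 1 2).comp (contDiff_const_smul ε⁻¹))
  have hnorm : ∀ x : E n, ‖ε⁻¹ • x‖ = ‖x‖ / ε := fun x => by
    rw [norm_smul, norm_inv, Real.norm_of_nonneg hε.le, div_eq_inv_mul]
  have hF1 : ∀ x : E n, 2 * ε < ‖x‖ → F x = 1 := fun x hx => by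
    rw [hF]
    dsimp only
    rw [radialCut_eq_zero zero_le_one one_lt_two, sub_zero]
    rw [hnorm, le_div_iff₀ hε]
    exact hx.le
  have hF0 : ∀ x : E n, ‖x‖ < ε → F x = 0 := fun x hx => by
    rw [hF]
    dsimp only
    rw [radialCut_eq_one zero_le_one one_lt_two, sub_self]
    rw [hnorm, div_le_iff₀ hε]
    linarith
  have hFg : ∀ x, ‖fderiv ℝ F x‖ ≤ L / ε := by
    intro x
    have h1 : HasFDerivAt F (0 - (fderiv ℝ (radialCut 1 2) (ε⁻¹ • x)).comp
        (ε⁻¹ • ContinuousLinearMap.id ℝ (E n))) x :=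
      (hasFDerivAt_const 1 x).sub ((((contDiff_radialCut 1 2).differentiable
        (by simp)).differentiableAt.hasFDerivAt).comp x ((hasFDerivAt_id x).const_smul ε⁻¹))
    rw [h1.fderiv, zero_sub, norm_neg, ContinuousLinearMap.comp_smul, ContinuousLinearMap.comp_id,
      norm_smul, norm_inv, Real.norm_of_nonneg hε.le, div_eq_inv_mul]
    exact mul_le_mul_of_nonneg_left (hLb _) (by positivity)
  obtain ⟨χ, hχ, hχl, hχc⟩ := u.exists_descent (F := F) h2ε (fun x _ => hFd.contDiffAt)
    (fun γ _ x _ => by rw [hF]; simp only [← map_smul, radialCut_smul])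
    (fun x _ hx => hF1 x hx)
  have hlocal : ∀ x ∈ puncturedBall n u.τ, χ ∘ u.lift =ᶠ[𝓝 x] F := fun x hx => by
    filter_upwards [(isOpen_puncturedBall u.τ).mem_nhds hx] with y hy using hχl y hy
  have hbound : ∀ m, 0 ≤ χ m ∧ χ m ≤ 1 := by
    intro m
    by_cases hm : (m : M) ∈ u.nhd u.τ
    · obtain ⟨x, hx, -, rfl⟩ := LocalUniformization.mem_nhd_iff.mp hm
      rw [hχl x hx]
      exact ⟨sub_nonneg.mpr (radialCut_le_one _ _ _), sub_le_self _ (radialCut_nonneg _ _ _)⟩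
    · rw [hχc m hm]
      exact ⟨zero_le_one, le_rfl⟩
  have hone : ∀ m : Punctured M p,
      (¬ ∃ x ∈ puncturedBall n u.τ, ‖x‖ ≤ 2 * ε ∧ u.lift x = m) → χ m = 1 := by
    intro m hm
    by_cases hmτ : (m : M) ∈ u.nhd u.τ
    · obtain ⟨x, hx, -, rfl⟩ := LocalUniformization.mem_nhd_iff.mp hmτ
      rw [hχl x hx, hF1 x]
      by_contra hx2
      exact hm ⟨x, hx, not_lt.mp hx2, rfl⟩
    · exact hχc m hmτ
  refine ⟨χ, hχ, ?_, hbound, ?_, ?_⟩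
  · refine HasCompactSupport.intro (u.isCompact_compl_nhd hε) fun m hm => ?_
    simp only [Set.mem_ofPred_eq, not_not] at hm
    obtain ⟨x, hx, hxε, rfl⟩ := LocalUniformization.mem_nhd_iff.mp hm
    rw [hχl x hx, hF0 x hxε]
  · intro m hm
    have hm' : m ∈ {m : Punctured M p | ∃ x ∈ puncturedBall n u.τ, ‖x‖ ≤ 2 * ε ∧ u.lift x = m}ᶜ := by
      rintro ⟨x, hx, hxε, rfl⟩
      exact hm ((LocalUniformization.lift_mem_nhd hx).mpr (by linarith))
    refine ⟨hone m hm', ?_⟩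
    have h1 : χ =ᶠ[𝓝 m] fun _ => 1 := by
      filter_upwards [(u.isClosed_image_closedBall h2ε).isOpen_compl.mem_nhds hm'] with m' hm''
      exact hone m' hm''
    rw [gradInner, dX_congr h1, dX_const]
    simp
  · intro m hm
    obtain ⟨x, hx, hxε, rfl⟩ := LocalUniformization.mem_nhd_iff.mp hm
    rw [h.gradInner_eq hx hχ hχ, (hlocal x hx).fderiv_eq]
    calc _ ≤ ‖fderiv ℝ F x (sharp (G x) (fderiv ℝ F x))‖ := le_abs_self _
      _ ≤ ‖fderiv ℝ F x‖ * (‖sharp (G x)‖ * ‖fderiv ℝ F x‖) :=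
        (ContinuousLinearMap.le_opNorm _ _).trans
          (mul_le_mul_of_nonneg_left (ContinuousLinearMap.le_opNorm _ _) (norm_nonneg _))
      _ ≤ L / ε * (S * (L / ε)) := by
        gcongr
        · exact hFg x
        · exact hSb x (hxε.le.trans hετ)
        · exact hFg x
      _ = L * (S * L) / ε ^ 2 := by field_simp

end OrbForm

end OrbifoldMetric

/-! ### The singular point is negligible for the Yamabe functional. -/

section OrbifoldMetric

variable {n : ℕ} {M : Type*} [TopologicalSpace M] {p : M} [ChartedSpace (E n) (Punctured M p)]
  [IsManifold 𝓘(ℝ, E n) ∞ (Punctured M p)] {Γ : Subgroup (E n ≃ₗᵢ[ℝ] E n)}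
  [T2Space M] [CompactSpace M] [MeasurableSpace M] [BorelSpace M]

lemma continuous_integrable_gradInner {X : Type*} [TopologicalSpace X] [ChartedSpace (E n) X]
    [IsManifold 𝓘(ℝ, E n) ∞ X] [MeasurableSpace X] [BorelSpace X] [SigmaCompactSpace X]
    [Nonempty X] [R1Space X] (g : Metric n X)
    {v : X → ℝ} (hv : ContMDiff 𝓘(ℝ, E n) 𝓘(ℝ, ℝ) ∞ v) (hc : HasCompactSupport v) :
    Integrable (gradInner g v v) (vol g) := by
  refine (continuous_gradInner g hv hv).integrable_of_hasCompactSupport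
    (HasCompactSupport.intro hc.isCompact fun x h => ?_)
  simp [gradInner, dX_eq_zero_of_notMem h]

namespace OrbForm

variable {u : LocalUniformization Γ p} {g : Metric n (Punctured M p)} {G : E n → Form n}

lemma integrable_scalarCurvature_mul (h : OrbForm u g G) {w : Punctured M p → ℝ}
    (hw : Continuous w) {C : ℝ} (hC : ∀ m, |w m| ≤ C) :
    Integrable (fun m => scalarCurvature g m * w m) (vol g) := by
  have := h.isFiniteMeasure_vol
  obtain ⟨C', hC', hb⟩ := h.exists_bound_scalarCurvature
  refine Integrable.of_bound ((continuous_scalarCurvature g).mul hw).aestronglyMeasurable (C' * C)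
    (Eventually.of_forall fun m => ?_)
  rw [norm_mul]
  exact mul_le_mul (hb m) (hC m) (norm_nonneg _) hC'

lemma vol_univ_pos (h : OrbForm u g G) : 0 < (vol g).real Set.univ := by
  have := u.sigmaCompactSpace
  have := u.nonempty
  have := h.isFiniteMeasure_vol
  rw [measureReal_def, ENNReal.toReal_pos_iff]
  exact ⟨isOpen_univ.measure_pos _ Set.univ_nonempty, measure_lt_top _ _⟩

/-- An orbifold metric cannot have a smaller normalized Einstein-Hilbert functional than allowed by
compactly supported test functions on the complement of the singular point. -/
lemma cylYamabeConst_le_einsteinHilbert (hn : 3 ≤ n) (h : OrbForm u g G) :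
    cylYamabeConst g ≤ (einsteinHilbert g : EReal) := by
  have := u.sigmaCompactSpace
  have := u.nonempty
  have := h.isFiniteMeasure_vol
  have hn3 : (3 : ℝ) ≤ n := by exact_mod_cast hn
  obtain ⟨C, hC, hcut⟩ := h.exists_cutoff
  obtain ⟨D, hD, hvol⟩ := h.exists_vol_nhd_le
  obtain ⟨K, hK, hR⟩ := h.exists_bound_scalarCurvature
  -- The factor `τ/6` ensures `3ε ≤ τ/2` for every index.
  set ε : ℕ → ℝ := fun k => u.τ / 6 * (1 / ((k : ℝ) + 1)) with hε
  have hτ := u.τ_pos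
  have hε0 : ∀ k, 0 < ε k := fun k => by positivity
  have hετ : ∀ k, 3 * ε k ≤ u.τ / 2 := fun k => by
    have : 1 / ((k : ℝ) + 1) ≤ 1 := by
      rw [div_le_one (by positivity)]
      linarith [Nat.cast_nonneg (α := ℝ) k]
    simp only [hε]
    nlinarith
  have hεlim : Tendsto ε atTop (𝓝 0) := by
    have h1 := (tendsto_one_div_add_atTop_nhds_zero_nat (𝕜 := ℝ)).const_mul (u.τ / 6)
    rwa [mul_zero] at h1
  choose χ hχ hχc hχb hχ1 hχg using fun k => hcut (ε k) (hε0 k) (hετ k)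
  have hev : ∀ m : Punctured M p, ∀ᶠ k in atTop, (m : M) ∉ u.nhd (3 * ε k) := by
    intro m
    by_cases hm : (m : M) ∈ u.nhd u.τ
    · obtain ⟨x, hx, -, rfl⟩ := LocalUniformization.mem_nhd_iff.mp hm
      have hx0 : 0 < ‖x‖ := norm_pos_iff.mpr (mem_puncturedBall.mp hx).2
      have h3 : Tendsto (fun k => 3 * ε k) atTop (𝓝 0) := by simpa using hεlim.const_mul 3
      filter_upwards [h3.eventually (gt_mem_nhds hx0)] with k hk
      rw [LocalUniformization.lift_mem_nhd hx]
      exact not_lt.mpr hk.le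
    · refine Eventually.of_forall fun k hk => hm ?_
      obtain ⟨x, hx, -, rfl⟩ := LocalUniformization.mem_nhd_iff.mp hk
      exact (LocalUniformization.lift_mem_nhd hx).mpr (mem_puncturedBall.mp hx).1
  have hlim1 : ∀ m, Tendsto (fun k => χ k m) atTop (𝓝 1) := fun m =>
    tendsto_const_nhds.congr' ((hev m).mono fun k hk => (hχ1 k m hk).1.symm)
  -- A gradient square of size `C/ε²` on a set of volume at most `D (3ε)^n` gives `O(ε^{n-2})`. This
  -- is where `n ≥ 3` is essential.
  have hgrad : Tendsto (fun k => ∫ m, gradInner g (χ k) (χ k) m ∂(vol g)) atTop (𝓝 0) := by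
    have hb : ∀ k, ‖∫ m, gradInner g (χ k) (χ k) m ∂(vol g)‖ ≤ C * D * 3 ^ n * ε k ^ (n - 2) := by
      intro k
      have hfin := hvol (3 * ε k) (by linarith [hε0 k]) (hετ k)
      rw [← setIntegral_eq_integral_of_forall_compl_eq_zero
        (s := {m : Punctured M p | (m : M) ∈ u.nhd (3 * ε k)}) fun m hm => (hχ1 k m hm).2]
      refine (norm_setIntegral_le_of_norm_le_const (C := C / ε k ^ 2) (measure_lt_top _ _)
        fun m hm => ?_).trans ?_
      · rw [Real.norm_of_nonneg (gradInner_self_nonneg g _ m)]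
        exact hχg k m hm
      · have h3 : (vol g).real {m : Punctured M p | (m : M) ∈ u.nhd (3 * ε k)}
            ≤ D * (3 * ε k) ^ n :=
          ENNReal.toReal_le_of_le_ofReal (mul_nonneg hD (by have := hε0 k; positivity)) hfin
        calc _ ≤ C / ε k ^ 2 * (D * (3 * ε k) ^ n) := by
              gcongr
          _ = C * D * 3 ^ n * ε k ^ (n - 2) := by
            have key : ∀ e : ℝ, e ≠ 0 → C / e ^ 2 * (D * (3 * e) ^ n)
                = C * D * 3 ^ n * e ^ (n - 2) := by
              intro e he
              have h4 : e ^ n = e ^ (n - 2) * e ^ 2 := by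
                rw [← pow_add]
                congr 1
                omega
              rw [mul_pow, h4]
              field_simp
            exact key _ (hε0 k).ne'
    refine squeeze_zero_norm hb ?_
    have h4 : Tendsto (fun k => ε k ^ (n - 2)) atTop (𝓝 0) := by
      simpa [show n - 2 ≠ 0 by omega] using hεlim.pow (n - 2)
    simpa using h4.const_mul (C * D * 3 ^ n)
  have hscal : Tendsto (fun k => ∫ m, scalarCurvature g m * χ k m ^ 2 ∂(vol g)) atTop
      (𝓝 (∫ m, scalarCurvature g m ∂(vol g))) := by
    refine tendsto_integral_of_dominated_convergence (fun _ => K) (fun k =>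
      ((continuous_scalarCurvature g).mul ((hχ k).continuous.pow 2)).aestronglyMeasurable)
      (integrable_const K) (fun k => Eventually.of_forall fun m => ?_)
      (Eventually.of_forall fun m => ?_)
    · rw [norm_mul, Real.norm_of_nonneg (sq_nonneg (χ k m))]
      have : χ k m ^ 2 ≤ 1 := pow_le_one₀ (hχb k m).1 (hχb k m).2
      calc _ ≤ K * 1 := mul_le_mul (hR m) this (sq_nonneg _) hK
        _ = K := mul_one K
    · simpa using ((hlim1 m).pow 2).const_mul (scalarCurvature g m)
  have hq : 0 ≤ 2 * (n : ℝ) / ((n : ℝ) - 2) := div_nonneg (by linarith) (by linarith)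
  have hden : Tendsto (fun k => ∫ m, |χ k m| ^ (2 * (n : ℝ) / ((n : ℝ) - 2)) ∂(vol g)) atTop
      (𝓝 ((vol g).real Set.univ)) := by
    have h1 : (vol g).real Set.univ = ∫ _, (1 : ℝ) ∂(vol g) := by simp
    rw [h1]
    refine tendsto_integral_of_dominated_convergence (fun _ => 1) (fun k =>
      ((hχ k).continuous.abs.rpow_const fun _ => Or.inr hq).aestronglyMeasurable)
      (integrable_const 1) (fun k => Eventually.of_forall fun m => ?_)
      (Eventually.of_forall fun m => ?_)
    · rw [Real.norm_of_nonneg (Real.rpow_nonneg (abs_nonneg _) _), abs_of_nonneg (hχb k m).1]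
      exact Real.rpow_le_one (hχb k m).1 (hχb k m).2 hq
    · simpa using ((hlim1 m).abs.rpow_const (Or.inr hq))
  have hE : ∀ k, ∫ m, energyDensity g (χ k) m ∂(vol g)
      = 4 * ((n : ℝ) - 1) / ((n : ℝ) - 2) * ∫ m, gradInner g (χ k) (χ k) m ∂(vol g)
        + ∫ m, scalarCurvature g m * χ k m ^ 2 ∂(vol g) := by
    intro k
    rw [← integral_const_mul, ← integral_add]
    · rfl
    · exact (continuous_integrable_gradInner g (hχ k) (hχc k)).const_mul _
    · refine h.integrable_scalarCurvature_mul ((hχ k).continuous.pow 2) (C := 1) fun m => ?_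
      rw [abs_of_nonneg (sq_nonneg _)]
      exact pow_le_one₀ (hχb k m).1 (hχb k m).2
  have hQ : Tendsto (fun k => yamabeQ g (χ k)) atTop (𝓝 (einsteinHilbert g)) := by
    have h1 : Tendsto (fun k => ∫ m, energyDensity g (χ k) m ∂(vol g)) atTop
        (𝓝 (∫ m, scalarCurvature g m ∂(vol g))) := by
      simp only [hE]
      simpa using (hgrad.const_mul (4 * ((n : ℝ) - 1) / ((n : ℝ) - 2))).add hscal
    have h2 := h1.div (hden.rpow_const (p := ((n : ℝ) - 2) / n) (Or.inl h.vol_univ_pos.ne'))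
      (Real.rpow_pos_of_pos h.vol_univ_pos _).ne'
    refine h2.congr fun k => ?_
    rw [yamabeQ_eq g (hχ k), Pi.div_apply]
  have hne : ∀ᶠ k in atTop, χ k ≠ 0 := by
    filter_upwards [hev (u.lift 0)] with k hk h0
    have h1 := (hχ1 k _ hk).1
    rw [h0] at h1
    simp at h1
  refine ge_of_tendsto ((continuous_coe_real_ereal.tendsto _).comp hQ) ?_
  filter_upwards [hne] with k hk
  exact iInf₂_le _ ⟨hχ k, hχc k, hk⟩

end OrbForm

end OrbifoldMetric

/-! ### Polar coordinates and the cylindrical form of the flat metric. -/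

section Polar

variable {n : ℕ}

/-- The Euclidean inner product. -/
def eucl (n : ℕ) : Form n := innerSL ℝ

lemma eucl_apply (v w : E n) : eucl n v w = inner ℝ v w := rfl

lemma isInnerForm_eucl : IsInnerForm (eucl n) where
  symm v w := by rw [eucl_apply, eucl_apply, real_inner_comm]
  pos v hv := by
    rw [eucl_apply, real_inner_self_eq_norm_sq]
    have := norm_pos_iff.mpr hv
    positivity

variable {X : Type*} [TopologicalSpace X] [ChartedSpace (E n) X] [IsManifold 𝓘(ℝ, E n) ∞ X]

lemma pullback_polar (g : Metric n X) {ψ : E n → X} {z : E n} {t : ℝ}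
    (hψ : MDifferentiableAt 𝓘(ℝ, E n) 𝓘(ℝ, E n) ψ (Real.exp (-t) • z)) (v w : E n) (a b : ℝ) :
    pullback g (fun q : E n × ℝ => ψ (Real.exp (-q.2) • q.1)) (z, t) (v, a) (w, b)
      = pform g ψ (Real.exp (-t) • z) (Real.exp (-t) • (v - a • z)) (Real.exp (-t) • (w - b • z)) := by
  set P : E n × ℝ → E n := fun q => Real.exp (-q.2) • q.1 with hP
  have h1 : HasFDerivAt P (Real.exp (-t) • ContinuousLinearMap.fst ℝ (E n) ℝ
      + (Real.exp (-t) • -ContinuousLinearMap.snd ℝ (E n) ℝ).smulRight z) (z, t) := by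
    have h2 : HasFDerivAt (fun q : E n × ℝ => Real.exp (-q.2))
        (Real.exp (-t) • -ContinuousLinearMap.snd ℝ (E n) ℝ) (z, t) :=
      (hasFDerivAt_snd (p := (z, t))).neg.exp
    exact h2.smul hasFDerivAt_fst
  have h3 : ∀ v a, fderiv ℝ P (z, t) (v, a) = Real.exp (-t) • (v - a • z) := by
    intro v a
    rw [h1.fderiv]
    simp [smul_smul, sub_eq_add_neg]
  have h4 : mfderiv 𝓘(ℝ, E n × ℝ) 𝓘(ℝ, E n) (ψ ∘ P) (z, t)
      = (mfderiv 𝓘(ℝ, E n) 𝓘(ℝ, E n) ψ (P (z, t))).comp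
        (mfderiv 𝓘(ℝ, E n × ℝ) 𝓘(ℝ, E n) P (z, t)) :=
    mfderiv_comp (z, t) hψ h1.differentiableAt.mdifferentiableAt
  rw [mfderiv_eq_fderiv] at h4
  have h5 : ∀ v a, mfderiv 𝓘(ℝ, E n × ℝ) 𝓘(ℝ, E n) (ψ ∘ P) (z, t) (v, a)
      = dmap ψ (Real.exp (-t) • z) (Real.exp (-t) • (v - a • z)) := by
    intro v a
    rw [h4, ← h3]
    rfl
  have h6 : pullback g (ψ ∘ P) (z, t) (v, a) (w, b)
      = g.inner (ψ (P (z, t))) (mfderiv 𝓘(ℝ, E n × ℝ) 𝓘(ℝ, E n) (ψ ∘ P) (z, t) (v, a))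
        (mfderiv 𝓘(ℝ, E n × ℝ) 𝓘(ℝ, E n) (ψ ∘ P) (z, t) (w, b)) := rfl
  refine h6.trans ?_
  rw [h5, h5]
  rfl

/-- With `x = e^{-t} z` the Euclidean metric is `e^{-2t}(h + dt²)`, so the cylinder is `|x|^{-2}`
times it, and `t ≥ 1` corresponds to `|x| ≤ e^{-1}`. Later arguments use only the right-hand form.
-/
lemma cylinder_iff (g : Metric n X) {ψ : E n → X} (hψ : ∀ x ∈ puncturedBall n 1,
      MDifferentiableAt 𝓘(ℝ, E n) 𝓘(ℝ, E n) ψ x) :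
    (∀ (z : E n) (t : ℝ), ‖z‖ = 1 → 1 ≤ t →
      ∀ (v w : E n) (a b : ℝ), inner ℝ z v = 0 → inner ℝ z w = 0 →
        pullback g (fun q : E n × ℝ => ψ (Real.exp (-q.2) • q.1)) (z, t) (v, a) (w, b)
          = inner ℝ v w + a * b) ↔
    ∀ x : E n, x ≠ 0 → ‖x‖ ≤ Real.exp (-1) → pform g ψ x = (‖x‖ ^ 2)⁻¹ • eucl n := by
  have he1 : Real.exp (-1) < 1 := by rw [Real.exp_lt_one_iff]; norm_num
  constructor
  · intro h x hx hxe
    have hx0 : 0 < ‖x‖ := norm_pos_iff.mpr hx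
    have hz : ‖‖x‖⁻¹ • x‖ = 1 := by
      rw [norm_smul, norm_inv, norm_norm, inv_mul_cancel₀ hx0.ne']
    have ht : 1 ≤ -Real.log ‖x‖ := by
      have := Real.log_le_log hx0 hxe
      rw [Real.log_exp] at this
      linarith
    have het : Real.exp (-(-Real.log ‖x‖)) = ‖x‖ := by rw [neg_neg, Real.exp_log hx0]
    set z := ‖x‖⁻¹ • x with hzdef
    have hxz : ‖x‖ • z = x := by rw [hzdef, smul_smul, mul_inv_cancel₀ hx0.ne', one_smul]
    have hzz : inner ℝ z z = 1 := by rw [real_inner_self_eq_norm_sq, hz, one_pow]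
    ext ξ ζ
    have h1 := h z (-Real.log ‖x‖) hz ht (‖x‖⁻¹ • (ξ - (inner ℝ z ξ : ℝ) • z))
      (‖x‖⁻¹ • (ζ - (inner ℝ z ζ : ℝ) • z)) (-(‖x‖⁻¹ * inner ℝ z ξ)) (-(‖x‖⁻¹ * inner ℝ z ζ))
      (by rw [inner_smul_right, inner_sub_right, inner_smul_right, hzz]; ring)
      (by rw [inner_smul_right, inner_sub_right, inner_smul_right, hzz]; ring)
    have hm : MDifferentiableAt 𝓘(ℝ, E n) 𝓘(ℝ, E n) ψ (Real.exp (-(-Real.log ‖x‖)) • z) := by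
      rw [het, hxz]
      exact hψ x (mem_puncturedBall.mpr ⟨hxe.trans_lt he1, hx⟩)
    rw [pullback_polar g hm, het, hxz] at h1
    -- Decomposition of `ξ` into tangential and radial parts. The radial coefficient carries a minus
    -- sign because the radius decreases as `t` grows.
    have h2 : ∀ ξ : E n, ‖x‖ • (‖x‖⁻¹ • (ξ - (inner ℝ z ξ : ℝ) • z)
        - (-(‖x‖⁻¹ * inner ℝ z ξ)) • z) = ξ := by
      intro ξ
      rw [neg_smul, sub_neg_eq_add, mul_smul, ← smul_add, sub_add_cancel, smul_smul,
        mul_inv_cancel₀ hx0.ne', one_smul]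
    rw [h2, h2] at h1
    rw [h1]
    simp only [smul_apply, eucl_apply, smul_eq_mul, inner_smul_left, inner_smul_right,
      inner_sub_left, inner_sub_right, hzz, RCLike.conj_to_real]
    rw [real_inner_comm ξ z]
    field_simp
    ring
  · intro h z t hz ht v w a b hv hw
    have hnorm : ‖Real.exp (-t) • z‖ = Real.exp (-t) := by
      rw [norm_smul, hz, mul_one, Real.norm_of_nonneg (Real.exp_pos _).le]
    have hne : Real.exp (-t) • z ≠ 0 := norm_ne_zero_iff.mp (by
      rw [hnorm]
      exact (Real.exp_pos _).ne')
    have hle : Real.exp (-t) ≤ Real.exp (-1) := Real.exp_le_exp.mpr (by linarith)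
    have hzz : inner ℝ z z = 1 := by rw [real_inner_self_eq_norm_sq, hz, one_pow]
    have hpos := Real.exp_pos (-t)
    rw [pullback_polar g (hψ _ (mem_puncturedBall.mpr ⟨by
        rw [hnorm]
        exact hle.trans_lt he1, hne⟩)),
      h _ hne (by rwa [hnorm]), hnorm]
    simp only [smul_apply, eucl_apply, smul_eq_mul, inner_smul_left, inner_smul_right,
      inner_sub_left, inner_sub_right, hzz, RCLike.conj_to_real, hw]
    rw [real_inner_comm z v, hv]
    field_simp
    ring

end Polar

/-! ### From cylindrical metrics to orbifold metrics. -/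

section Orbifold

variable {n : ℕ} {M : Type*} [TopologicalSpace M] {p : M} [ChartedSpace (E n) (Punctured M p)]
  {Γ : Subgroup (E n ≃ₗᵢ[ℝ] E n)}

/-- A nontrivial element of a freely acting group moves every nonzero vector. Hence an equivariant
change of coordinates must fix the origin. -/
lemma IsStructureGroup.eq_zero_of_fixed (hΓ : IsStructureGroup Γ) {x : E n}
    (h : ∀ γ ∈ Γ, γ x = x) : x = 0 := by
  by_contra hx
  have := hΓ.nontrivial
  obtain ⟨γ, hγ⟩ := exists_ne (1 : Γ)
  exact hγ (Subtype.ext (hΓ.free γ γ.2 x hx (h γ γ.2)))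

lemma fderiv_isometry (γ : E n ≃ₗᵢ[ℝ] E n) (x v : E n) : fderiv ℝ γ x v = γ v := by
  have h : fderiv ℝ γ x = (γ : E n →L[ℝ] E n) := (γ : E n →L[ℝ] E n).fderiv
  rw [h]
  rfl

variable [IsManifold 𝓘(ℝ, E n) ∞ (Punctured M p)]

lemma LocalUniformization.pform_lift_smul (u : LocalUniformization Γ p)
    (g : Metric n (Punctured M p)) {γ : E n ≃ₗᵢ[ℝ] E n} (hγ : γ ∈ Γ) {x : E n}
    (hx : x ∈ puncturedBall n u.τ) (v w : E n) :
    pform g u.lift (γ x) (γ v) (γ w) = pform g u.lift x v w := by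
  have h1 : u.lift =ᶠ[𝓝 x] u.lift ∘ γ := by
    filter_upwards [(isOpen_puncturedBall u.τ).mem_nhds hx] with y hy
    exact (LocalUniformization.lift_smul hγ hy).symm
  rw [pform_comp g h1 ((LocalUniformization.regAt_lift
    ((smul_mem_puncturedBall γ).mpr hx)).contMDiffAt.mdifferentiableAt (by simp))
    γ.differentiable.differentiableAt, pullForm_apply, fderiv_isometry, fderiv_isometry]

/-- A metric that is Euclidean near the singular point in a compatible uniformization is an
orbifold metric. -/
lemma exists_orbForm_of_flat (hΓ : IsStructureGroup Γ) {u u' : LocalUniformization Γ p}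
    (hc : Compatible u u') (g : Metric n (Punctured M p)) {ρ : ℝ} (hρ : 0 < ρ)
    (hflat : ∀ y : E n, y ≠ 0 → ‖y‖ < ρ → pform g u'.lift y = eucl n) : ∃ G, OrbForm u g G := by
  obtain ⟨r, Φ, hr0, hrτ, hΦ, hinj, hmaps, hbij, hequi, hlift⟩ := hc
  have hmem : ∀ {x : E n}, ‖x‖ < r → x ∈ Metric.ball (0 : E n) r := fun h => by simpa using h
  have hΦ0 : Φ 0 = 0 := hΓ.eq_zero_of_fixed fun γ hγ => by
    rw [← hequi γ hγ 0 (hmem (by simpa using hr0)), map_zero]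
  have hΦd : ∀ {x : E n}, ‖x‖ < r → ContDiffAt ℝ ∞ Φ x := fun h =>
    hΦ.contDiffAt (Metric.isOpen_ball.mem_nhds (hmem h))
  have hΦne : ∀ x ∈ puncturedBall n r, Φ x ∈ puncturedBall n u'.τ := by
    intro x hx
    refine ⟨hmaps hx.1, fun h0 => hx.2 ?_⟩
    exact hinj hx.1 (hmem (by simpa using hr0)) (h0.trans hΦ0.symm)
  have hll : ∀ x ∈ puncturedBall n r, u.lift x = u'.lift (Φ x) := by
    intro x hx
    apply Subtype.ext
    rw [u.lift_eq x (puncturedBall_mono hrτ hx), u'.lift_eq _ (hΦne x hx), hlift x hx]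
  have hpf : ∀ x ∈ puncturedBall n r, ‖Φ x‖ < ρ →
      pform g u.lift x = pullForm (eucl n) (fderiv ℝ Φ x) := by
    intro x hx hxρ
    have h1 : u.lift =ᶠ[𝓝 x] u'.lift ∘ Φ := by
      filter_upwards [(isOpen_puncturedBall r).mem_nhds hx] with y hy using hll y hy
    rw [pform_comp g h1 ((LocalUniformization.regAt_lift (hΦne x hx)).contMDiffAt.mdifferentiableAt
      (by simp)) ((hΦd (mem_puncturedBall.mp hx).1).differentiableAt (by simp)),
      hflat _ (mem_puncturedBall.mp (hΦne x hx)).2 hxρ]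
  classical
  -- The metric in the coordinates of `u` is `Φ^*` of the Euclidean metric near the origin. Since
  -- `Φ` is smooth at 0, this formula supplies the missing value and smoothness there.
  set G : E n → Form n := fun x =>
    if x = 0 then pullForm (eucl n) (fderiv ℝ Φ 0) else pform g u.lift x with hG
  have hG0 : G 0 = pullForm (eucl n) (fderiv ℝ Φ 0) := if_pos rfl
  have hG1 : ∀ {x : E n}, x ≠ 0 → G x = pform g u.lift x := fun h => if_neg h
  refine ⟨G, ⟨fun {x} hx => ?_, fun {x} hx => ?_, fun γ hγ x hx v w => ?_,
    fun {x} hx => (hG1 (mem_puncturedBall.mp hx).2).symm⟩⟩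
  · by_cases hx0 : x = 0
    · subst hx0
      have h0r : ‖(0 : E n)‖ < r := by simpa using hr0
      refine (contDiffAt_pullForm (H := fun _ => eucl n) contDiffAt_const
        (hΦd h0r)).congr_of_eventuallyEq ?_
      have h1 : ∀ᶠ y in 𝓝 (0 : E n), ‖Φ y‖ < ρ := by
        have h2 := (hΦd h0r).continuousAt.norm.tendsto
        simp only [hΦ0, norm_zero] at h2
        exact h2.eventually (gt_mem_nhds hρ)
      filter_upwards [h1, Metric.ball_mem_nhds (0 : E n) hr0] with y hy1 hy2
      by_cases hy0 : y = 0
      · rw [hy0, hG0]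
      · rw [hG1 hy0, hpf y ⟨hy2, hy0⟩ hy1]
    · refine ((LocalUniformization.regAt_lift
        (mem_puncturedBall.mpr ⟨hx, hx0⟩)).contDiffAt_pform g).congr_of_eventuallyEq ?_
      filter_upwards [isOpen_ne.mem_nhds hx0] with y hy using hG1 hy
  · by_cases hx0 : x = 0
    · subst hx0
      rw [hG0]
      exact isInnerForm_eucl.pullForm (hbij 0 (hmem (by simpa using hr0))).injective
    · rw [hG1 hx0]
      exact (LocalUniformization.regAt_lift (mem_puncturedBall.mpr ⟨hx, hx0⟩)).isInnerForm g
  · by_cases hx0 : x = 0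
    · subst hx0
      rw [map_zero, hG0]
      have h0r : ‖(0 : E n)‖ < r := by simpa using hr0
      have hd := (hΦd h0r).differentiableAt (by simp)
      -- Differentiating the equivariance at the fixed point 0 shows that `dΦ` at 0 commutes with
      -- `γ`, which gives the invariance of `G 0`.
      have h1 : (Φ ∘ γ) =ᶠ[𝓝 0] (γ ∘ Φ) := by
        filter_upwards [Metric.ball_mem_nhds (0 : E n) hr0] with y hy using hequi γ hγ y hy
      have h2 := h1.fderiv_eq (𝕜 := ℝ)
      rw [fderiv_comp (0 : E n) (by rwa [map_zero]) γ.differentiable.differentiableAt,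
        fderiv_comp (0 : E n) γ.differentiable.differentiableAt hd, map_zero] at h2
      have h3 : ∀ v, fderiv ℝ Φ 0 (γ v) = γ (fderiv ℝ Φ 0 v) := by
        intro v
        have := DFunLike.congr_fun h2 v
        simpa [fderiv_isometry] using this
      rw [pullForm_apply, pullForm_apply, h3, h3, eucl_apply, eucl_apply, γ.inner_map_map]
    · rw [hG1 hx0, hG1 (by simpa using hx0)]
      exact u.pform_lift_smul g hγ (mem_puncturedBall.mpr ⟨hx, hx0⟩) v w

variable [MeasurableSpace M] [BorelSpace M] [T2Space M] [CompactSpace M]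

lemma cylYamabeConst_le_confMetric {X : Type*} [TopologicalSpace X] [ChartedSpace (E n) X]
    [IsManifold 𝓘(ℝ, E n) ∞ X] [MeasurableSpace X] [BorelSpace X] [SigmaCompactSpace X]
    [Nonempty X] [T2Space X] (hn : 3 ≤ n) (g : Metric n X) {f : X → ℝ}
    (hf : ContMDiff 𝓘(ℝ, E n) 𝓘(ℝ, ℝ) ∞ f) :
    cylYamabeConst g ≤ cylYamabeConst (confMetric f hf g) :=
  le_iInf₂ fun _ hu => cylYamabeConst_le_yamabeQ_confMetric hn g hf hu.1 hu.2.1 hu.2.2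

/-- A cylindrical metric is conformal to an orbifold metric. -/
lemma exists_orbifoldMetric_of_cylindrical (hΓ : IsStructureGroup Γ) {u : LocalUniformization Γ p}
    {g : Metric n (Punctured M p)} (hg : IsCylindricalMetric u g) :
    ∃ (f : Punctured M p → ℝ) (hf : ContMDiff 𝓘(ℝ, E n) 𝓘(ℝ, ℝ) ∞ f),
      IsOrbifoldMetric u (confMetric f hf g) := by
  obtain ⟨u', hτ, -, hc, hcyl⟩ := hg
  have hd : ∀ x ∈ puncturedBall n 1, MDifferentiableAt 𝓘(ℝ, E n) 𝓘(ℝ, E n) u'.lift x := fun x hx =>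
    (LocalUniformization.regAt_lift (u := u') (hτ.symm ▸ hx)).contMDiffAt.mdifferentiableAt (by simp)
  rw [cylinder_iff g hd] at hcyl
  have he : Real.exp (-1) < 1 / 2 := by
    rw [Real.exp_neg, one_div]
    have := Real.add_one_lt_exp (one_ne_zero)
    exact inv_strictAnti₀ two_pos (by linarith)
  have he0 := (Real.exp_pos (-1)).le
  -- Near the origin the factor is `e^{2 log|x|} = |x|²`, which cancels the `|x|^{-2}` of the
  -- cylinder; the cutoff makes it descend to the whole space.
  set F : E n → ℝ := fun x => radialCut (Real.exp (-1)) (1 / 2) x * Real.log ‖x‖ with hF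
  obtain ⟨f, hf, hfl, -⟩ := u'.exists_descent (F := F) (r := 1 / 2) (c := 0) (by rw [hτ]; norm_num)
    (fun x hx => (contDiff_radialCut _ _).contDiffAt.mul
      ((contDiffAt_norm ℝ (mem_puncturedBall.mp hx).2).log
        (norm_ne_zero_iff.mpr (mem_puncturedBall.mp hx).2)))
    (fun γ _ x _ => by simp only [hF, radialCut_smul, γ.norm_map])
    (fun x _ hx => by simp only [hF, radialCut_eq_zero he0 he hx.le, zero_mul])
  refine ⟨f, hf, isOrbifoldMetric_iff.mpr (exists_orbForm_of_flat hΓ hc _ (Real.exp_pos (-1))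
    fun y hy0 hy => ?_)⟩
  have hy1 : 0 < ‖y‖ := norm_pos_iff.mpr hy0
  have hyp : y ∈ puncturedBall n u'.τ := mem_puncturedBall.mpr ⟨by rw [hτ]; linarith, hy0⟩
  rw [pform_confMetric, confForm, hcyl y hy0 hy.le, Function.comp_apply, hfl y hyp, hF]
  simp only [radialCut_eq_one he0 he hy.le, one_mul]
  rw [smul_smul, two_mul, Real.exp_add, Real.exp_log hy1, ← sq,
    mul_inv_cancel₀ (pow_ne_zero 2 hy1.ne'), one_smul]

lemma eq_confMetric_of_mem_orbConformalClass {u : LocalUniformization Γ p}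
    {g g' : Metric n (Punctured M p)} (h : g' ∈ orbConformalClass u g) :
    ∃ (f : Punctured M p → ℝ) (hf : ContMDiff 𝓘(ℝ, E n) 𝓘(ℝ, ℝ) ∞ f), g' = confMetric f hf g := by
  obtain ⟨-, f, -, hf, -, he⟩ := h
  exact ⟨fun x => f x, hf, metric_ext he⟩

/-- Every member of the orbifold class is reached from the cylindrical metric by two conformal
changes, neither of which lowers the infimum over compactly supported functions. That infimum is at
most the Einstein-Hilbert value by the cutoff argument. -/
theorem cylYamabeInvariant_le_orbYamabeInvariant (hn : 3 ≤ n) (hΓ : IsStructureGroup Γ)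
    (u : LocalUniformization Γ p) : cylYamabeInvariant u ≤ orbYamabeInvariant u := by
  have := u.sigmaCompactSpace
  have := u.nonempty
  refine iSup₂_le fun g hg => ?_
  obtain ⟨f, hf, ho⟩ := exists_orbifoldMetric_of_cylindrical hΓ hg
  refine le_trans ?_ (le_iSup₂ (f := fun C (_ : C ∈ orbConformalClasses u) => orbYamabeConst C)
    (orbConformalClass u (confMetric f hf g)) ⟨_, ho, rfl⟩)
  refine le_iInf₂ fun g' hg' => ?_
  obtain ⟨G, hG⟩ := isOrbifoldMetric_iff.mp hg'.1
  obtain ⟨f', hf', rfl⟩ := eq_confMetric_of_mem_orbConformalClass hg'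
  exact (cylYamabeConst_le_confMetric hn g hf).trans ((cylYamabeConst_le_confMetric hn _ hf').trans
    (hG.cylYamabeConst_le_einsteinHilbert hn))

end Orbifold

/-! ### Conformal factors constant near the singular point. -/

section ConformalClass

variable {n : ℕ} {M : Type*} [TopologicalSpace M] {p : M} [ChartedSpace (E n) (Punctured M p)]
  [IsManifold 𝓘(ℝ, E n) ∞ (Punctured M p)] {Γ : Subgroup (E n ≃ₗᵢ[ℝ] E n)} [T2Space M]
  {u : LocalUniformization Γ p} {g : Metric n (Punctured M p)} {G : E n → Form n}

/-- A conformal factor that is constant near the singular point stays in the orbifold conformal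
class. -/
lemma OrbForm.confMetric_mem (h : OrbForm u g G) {f : Punctured M p → ℝ}
    (hf : ContMDiff 𝓘(ℝ, E n) 𝓘(ℝ, ℝ) ∞ f) {c : ℝ} (hc : HasCompactSupport fun m => f m - c) :
    confMetric f hf g ∈ orbConformalClass u g := by
  classical
  -- The potential is extended to the singular point by its constant value there. It is then
  -- constant on a neighbourhood, so both continuity on `M` and smoothness of the lift at the origin
  -- hold.
  set F : M → ℝ := fun m => if h : m ≠ p then f ⟨m, h⟩ else c with hF
  have hFv : ∀ m : Punctured M p, F m = f m := fun m => dif_pos m.2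
  have hFp : F p = c := dif_neg (by simp)
  have hK : IsClosed (Subtype.val '' tsupport fun m => f m - c) :=
    (hc.isCompact.image continuous_subtype_val).isClosed
  have hFc : ∀ᶠ m in 𝓝 p, F m = c := by
    have hpK : p ∉ Subtype.val '' tsupport fun m => f m - c := by
      rintro ⟨m, -, hm⟩
      exact m.2 hm
    filter_upwards [hK.isOpen_compl.mem_nhds hpK] with m hm
    by_cases hmp : m = p
    · rw [hmp, hFp]
    · have h1 : (⟨m, hmp⟩ : Punctured M p) ∉ tsupport fun m => f m - c := fun h => hm ⟨_, h, rfl⟩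
      have h2 := image_eq_zero_of_notMem_tsupport h1
      rw [show F m = f ⟨m, hmp⟩ from dif_pos hmp]
      linarith
  have hFcont : Continuous F := by
    rw [continuous_iff_continuousAt]
    intro m
    by_cases hmp : m = p
    · rw [hmp]
      exact (continuousAt_const (y := c)).congr (hFc.mono fun _ h => h.symm)
    · have ho : Topology.IsOpenEmbedding (Subtype.val : Punctured M p → M) :=
        isOpen_ne.isOpenEmbedding_subtypeVal
      have h1 := ho.continuousAt_iff (f := (Subtype.val : Punctured M p → M)) (g := F)
        (x := ⟨m, hmp⟩)
      refine h1.mp ?_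
      have h2 : F ∘ Subtype.val = f := funext hFv
      rw [h2]
      exact hf.continuous.continuousAt
  set Fh : E n → ℝ := fun x => F (u.φ.symm (proj Γ x)) with hFh
  have hlift : ∀ x ∈ puncturedBall n u.τ, Fh x = f (u.lift x) := fun x hx => by
    rw [hFh]
    dsimp only
    rw [← u.lift_eq x hx, hFv]
  have hFd : ∀ x : E n, ‖x‖ < u.τ → ContDiffAt ℝ ∞ Fh x := by
    intro x hx
    by_cases hx0 : x = 0
    · rw [hx0]
      have h1 : ContinuousAt (fun x => u.φ.symm (proj Γ x)) (0 : E n) := by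
        refine ContinuousAt.comp (g := u.φ.symm) (f := proj Γ) (x := (0 : E n)) ?_
          continuous_proj.continuousAt
        exact u.φ.continuousAt_symm (u.proj_mem_target.mpr (by simpa using u.τ_pos))
      have h2 : ∀ᶠ y in 𝓝 (0 : E n), Fh y = c := by
        refine h1.eventually (p := fun m => F m = c) ?_
        have h0 : (fun x => u.φ.symm (proj Γ x)) (0 : E n) = p := u.symm_proj_zero
        rw [h0]
        exact hFc
      exact (contDiffAt_const (c := c)).congr_of_eventuallyEq h2
    · have hxp : x ∈ puncturedBall n u.τ := mem_puncturedBall.mpr ⟨hx, hx0⟩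
      refine (contDiffAt_comp_param hf (LocalUniformization.regAt_lift hxp)).congr_of_eventuallyEq ?_
      filter_upwards [(isOpen_puncturedBall u.τ).mem_nhds hxp] with y hy using hlift y hy
  refine ⟨isOrbifoldMetric_iff.mpr ⟨confForm Fh G, ?_⟩, F, hFcont, ?_, ?_, ?_⟩
  · refine ⟨fun {x} hx => contDiffAt_confForm (h.contDiffAt hx) (hFd x hx),
      fun {x} hx => isInnerForm_smul (h.isInnerForm hx) (Real.exp_pos _), fun γ hγ x hx v w => ?_,
      fun {x} hx => ?_⟩
    · have h1 : Fh (γ x) = Fh x := by simp only [hFh, proj_smul hγ]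
      simp only [confForm, smul_apply, h1, h.inv γ hγ hx]
    · rw [pform_confMetric, confForm, confForm, h.pform_eq hx, hlift x hx, Function.comp_apply]
  · simpa only [hFv] using hf
  · exact fun x hx => (hFd x (by simpa using hx)).contDiffWithinAt
  · intro x v w
    rw [hFv]
    rfl

end ConformalClass

/-! ### Positive regularizations of compactly supported test functions. -/

section TestFunction

variable {n : ℕ} {X : Type*} [TopologicalSpace X] [ChartedSpace (E n) X]
  [IsManifold 𝓘(ℝ, E n) ∞ X]

/-- The square `(∫ |v|^{2n/(n-2)})^{(n-2)/n}` of the critical norm. -/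
def critNorm [MeasurableSpace X] [BorelSpace X] (g : Metric n X) (v : X → ℝ) : ℝ :=
  (∫ x, |v x| ^ (2 * (n : ℝ) / ((n : ℝ) - 2)) ∂(vol g)) ^ (((n : ℝ) - 2) / n)

/-- The potential of the conformal factor `(v² + δ²)^{2/(n-2)}`. -/
def logPotential (n : ℕ) (v : X → ℝ) (δ : ℝ) (x : X) : ℝ :=
  1 / ((n : ℝ) - 2) * Real.log (v x ^ 2 + δ ^ 2)

variable {v : X → ℝ} {δ : ℝ}

lemma contMDiff_logPotential (hv : ContMDiff 𝓘(ℝ, E n) 𝓘(ℝ, ℝ) ∞ v) (hδ : 0 < δ) :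
    ContMDiff 𝓘(ℝ, E n) 𝓘(ℝ, ℝ) ∞ (logPotential n v δ) := by
  have h1 : ContDiff ℝ ∞ fun t : ℝ => 1 / ((n : ℝ) - 2) * Real.log (t ^ 2 + δ ^ 2) :=
    contDiff_const.mul (((contDiff_id.pow 2).add contDiff_const).log fun t => by positivity)
  exact h1.contMDiff.comp hv

lemma hasCompactSupport_logPotential_sub (hv : HasCompactSupport v) [R1Space X] :
    HasCompactSupport fun x => logPotential n v δ x - 1 / ((n : ℝ) - 2) * Real.log (δ ^ 2) := by
  refine HasCompactSupport.intro hv.isCompact fun x hx => ?_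
  rw [logPotential, image_eq_zero_of_notMem_tsupport hx]
  simp

/-- The exponents are chosen so that the conformal metric has Yamabe weight `√(v² + δ²)`, a smooth
positive substitute for `|v|`. -/
lemma weight_logPotential (hn : 3 ≤ n) (hδ : 0 < δ) (x : X) :
    weight n (logPotential n v δ) x = √(v x ^ 2 + δ ^ 2) := by
  have hn2 : (n : ℝ) - 2 ≠ 0 := by
    have : (3 : ℝ) ≤ n := by exact_mod_cast hn
    linarith
  have hpos : 0 < v x ^ 2 + δ ^ 2 := by positivity
  rw [weight, logPotential, Real.sqrt_eq_rpow, Real.rpow_def_of_pos hpos]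
  congr 1
  field_simp

lemma contMDiff_sqrt (hv : ContMDiff 𝓘(ℝ, E n) 𝓘(ℝ, ℝ) ∞ v) (hδ : 0 < δ) :
    ContMDiff 𝓘(ℝ, E n) 𝓘(ℝ, ℝ) ∞ fun x => √(v x ^ 2 + δ ^ 2) := by
  have h1 : ContDiff ℝ ∞ fun t : ℝ => √(t ^ 2 + δ ^ 2) :=
    ((contDiff_id.pow 2).add contDiff_const).sqrt fun t => by positivity
  exact h1.contMDiff.comp hv

lemma dX_sqrt (hv : ContMDiff 𝓘(ℝ, E n) 𝓘(ℝ, ℝ) ∞ v) (hδ : 0 < δ) (x : X) :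
    dX (n := n) (fun x => √(v x ^ 2 + δ ^ 2)) x = (v x / √(v x ^ 2 + δ ^ 2)) • dX v x := by
  refine dX_comp (F := fun t => √(t ^ 2 + δ ^ 2)) hv ?_
  have h1 : HasDerivAt (fun t : ℝ => √(t ^ 2 + δ ^ 2)) (2 * v x / (2 * √(v x ^ 2 + δ ^ 2))) (v x) := by
    refine HasDerivAt.sqrt ?_ (by positivity)
    simpa using (hasDerivAt_pow 2 (v x)).add_const (δ ^ 2)
  rwa [mul_div_mul_left _ _ two_ne_zero] at h1

lemma gradInner_sqrt (g : Metric n X) (hv : ContMDiff 𝓘(ℝ, E n) 𝓘(ℝ, ℝ) ∞ v) (hδ : 0 < δ) (x : X) :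
    gradInner g (fun x => √(v x ^ 2 + δ ^ 2)) (fun x => √(v x ^ 2 + δ ^ 2)) x
      = v x ^ 2 / (v x ^ 2 + δ ^ 2) * gradInner g v v x := by
  have hpos : 0 < v x ^ 2 + δ ^ 2 := by positivity
  have h2 := Real.sq_sqrt hpos.le
  rw [gradInner, dX_sqrt hv hδ]
  simp only [map_smul, smul_apply, smul_eq_mul, gradInner]
  rw [← mul_assoc, ← sq, div_pow, h2]

/-- Regularizing multiplies the squared gradient by `v²/(v² + δ²) ≤ 1`, while the curvature term
changes by exactly `δ² R`. -/
lemma energyDensity_sqrt_le (hn : 3 ≤ n) (g : Metric n X) (hv : ContMDiff 𝓘(ℝ, E n) 𝓘(ℝ, ℝ) ∞ v)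
    (hδ : 0 < δ) (x : X) :
    energyDensity g (fun x => √(v x ^ 2 + δ ^ 2)) x
      ≤ energyDensity g v x + δ ^ 2 * scalarCurvature g x := by
  have hn3 : (3 : ℝ) ≤ n := by exact_mod_cast hn
  have hpos : 0 < v x ^ 2 + δ ^ 2 := by positivity
  have h1 : v x ^ 2 / (v x ^ 2 + δ ^ 2) * gradInner g v v x ≤ gradInner g v v x := by
    refine mul_le_of_le_one_left (gradInner_self_nonneg g v x) ?_
    rw [div_le_one hpos]
    nlinarith [sq_nonneg δ]
  have h2 : 0 ≤ 4 * ((n : ℝ) - 1) / ((n : ℝ) - 2) := div_nonneg (by linarith) (by linarith)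
  have h3 := mul_le_mul_of_nonneg_left h1 h2
  rw [energyDensity, energyDensity, gradInner_sqrt g hv hδ, Real.sq_sqrt hpos.le]
  linarith

end TestFunction

/-! ### The orbifold Yamabe constant bounds the energy of compactly supported functions. -/

section LowerBound

variable {n : ℕ} {M : Type*} [TopologicalSpace M] {p : M} [ChartedSpace (E n) (Punctured M p)]
  [IsManifold 𝓘(ℝ, E n) ∞ (Punctured M p)] {Γ : Subgroup (E n ≃ₗᵢ[ℝ] E n)} [T2Space M]
  [CompactSpace M] [MeasurableSpace M] [BorelSpace M]
  {u : LocalUniformization Γ p} {g : Metric n (Punctured M p)} {G : E n → Form n}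
  {v : Punctured M p → ℝ}

/-- Outside the support of `v` the weight is the constant `δ`, so the conformal metric is in the
orbifold class and its Einstein-Hilbert value is at least `c`. By conformal invariance that value is
the quotient of the regularized function for `g`. -/
lemma OrbForm.mul_critNorm_sqrt_le (hn : 3 ≤ n) (h : OrbForm u g G) {c : ℝ}
    (hc : (c : EReal) ≤ orbYamabeConst (orbConformalClass u g))
    (hv : ContMDiff 𝓘(ℝ, E n) 𝓘(ℝ, ℝ) ∞ v) (hvc : HasCompactSupport v) {δ : ℝ} (hδ : 0 < δ) :
    c * critNorm g (fun x => √(v x ^ 2 + δ ^ 2))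
      ≤ ∫ x, energyDensity g v x ∂(vol g) + δ ^ 2 * ∫ x, scalarCurvature g x ∂(vol g) := by
  have := u.sigmaCompactSpace
  have := u.nonempty
  have := h.isFiniteMeasure_vol
  have hf := contMDiff_logPotential (n := n) hv hδ
  have hfc := hasCompactSupport_logPotential_sub (n := n) (δ := δ) hvc
  have h1 : c ≤ einsteinHilbert (confMetric _ hf g) := by
    rw [← EReal.coe_le_coe_iff]
    exact hc.trans (iInf₂_le _ (h.confMetric_mem hf hfc))
  have hw := contMDiff_sqrt (n := n) hv hδ
  rw [einsteinHilbert_eq, yamabeQ_confMetric hn g hf contMDiff_const (Or.inr ⟨_, hfc⟩)] at h1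
  simp only [mul_one, weight_logPotential hn hδ] at h1
  rw [yamabeQ_eq g hw] at h1
  obtain ⟨B, hB⟩ := hvc.exists_bound_of_continuous hv.continuous
  have hB0 : 0 ≤ B := (norm_nonneg _).trans (hB (u.lift 0))
  have hq : 0 ≤ 2 * (n : ℝ) / ((n : ℝ) - 2) := by
    have hn3 : (3 : ℝ) ≤ n := by exact_mod_cast hn
    exact div_nonneg (by linarith) (by linarith)
  have hv2 : ∀ x, v x ^ 2 ≤ B ^ 2 := fun x => by
    rw [← sq_abs]
    exact pow_le_pow_left₀ (abs_nonneg _) (hB x) 2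
  have hNpos : 0 < ∫ x, |√(v x ^ 2 + δ ^ 2)| ^ (2 * (n : ℝ) / ((n : ℝ) - 2)) ∂(vol g) := by
    have hcont : Continuous fun x => |√(v x ^ 2 + δ ^ 2)| ^ (2 * (n : ℝ) / ((n : ℝ) - 2)) :=
      hw.continuous.abs.rpow_const fun _ => Or.inr hq
    refine integral_pos_of_integrable_nonneg_nonzero (x := u.lift 0) hcont ?_
      (fun x => Real.rpow_nonneg (abs_nonneg _) _)
      (Real.rpow_pos_of_pos (abs_pos.mpr (Real.sqrt_pos.mpr (by positivity)).ne') _).ne'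
    refine Integrable.of_bound hcont.aestronglyMeasurable
      ((√(B ^ 2 + δ ^ 2)) ^ (2 * (n : ℝ) / ((n : ℝ) - 2))) (Eventually.of_forall fun x => ?_)
    rw [Real.norm_of_nonneg (Real.rpow_nonneg (abs_nonneg _) _), abs_of_nonneg (Real.sqrt_nonneg _)]
    exact Real.rpow_le_rpow (Real.sqrt_nonneg _) (Real.sqrt_le_sqrt (by linarith [hv2 x])) hq
  rw [le_div_iff₀ (Real.rpow_pos_of_pos hNpos _)] at h1
  refine h1.trans ?_
  have hEv : Integrable (energyDensity g v) (vol g) :=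
    (continuous_energyDensity g hv).integrable_of_hasCompactSupport
      (hasCompactSupport_energyDensity g hvc)
  have hRi : Integrable (scalarCurvature g) (vol g) := by
    simpa using h.integrable_scalarCurvature_mul (continuous_const (y := (1 : ℝ))) (C := 1) (by simp)
  rw [← integral_const_mul, ← integral_add]
  · refine integral_mono ?_ ?_ fun x => energyDensity_sqrt_le hn g hv hδ x
    · refine Integrable.add (Integrable.const_mul ?_ _) (h.integrable_scalarCurvature_mul
        (hw.continuous.pow 2) (C := B ^ 2 + δ ^ 2) fun x => ?_)
      · refine (continuous_gradInner g hw hw).integrable_of_hasCompactSupport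
          (HasCompactSupport.intro hvc.isCompact fun x hx => ?_)
        rw [gradInner_sqrt g hv hδ, image_eq_zero_of_notMem_tsupport hx]
        simp
      · rw [Real.sq_sqrt (by positivity), abs_of_nonneg (by positivity)]
        linarith [hv2 x]
    · exact hEv.add (hRi.const_mul _)
  · exact hEv
  · exact hRi.const_mul _

/-- The limit `δ → 0` of the regularized inequality, by dominated convergence on a space of finite
volume. The multiplied-out form avoids dividing by a norm that may vanish. -/
lemma OrbForm.mul_critNorm_le (hn : 3 ≤ n) (h : OrbForm u g G) {c : ℝ}
    (hc : (c : EReal) ≤ orbYamabeConst (orbConformalClass u g))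
    (hv : ContMDiff 𝓘(ℝ, E n) 𝓘(ℝ, ℝ) ∞ v) (hvc : HasCompactSupport v) :
    c * critNorm g v ≤ ∫ x, energyDensity g v x ∂(vol g) := by
  have := u.sigmaCompactSpace
  have := u.nonempty
  have := h.isFiniteMeasure_vol
  have hn3 : (3 : ℝ) ≤ n := by exact_mod_cast hn
  have hq : 0 ≤ 2 * (n : ℝ) / ((n : ℝ) - 2) := div_nonneg (by linarith) (by linarith)
  have hθ : 0 ≤ ((n : ℝ) - 2) / n := div_nonneg (by linarith) (by linarith)
  obtain ⟨B, hB⟩ := hvc.exists_bound_of_continuous hv.continuous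
  set δ : ℕ → ℝ := fun k => 1 / ((k : ℝ) + 1) with hδ
  have hδ0 : ∀ k, 0 < δ k := fun k => by positivity
  have hδ1 : ∀ k, δ k ≤ 1 := fun k => by
    rw [hδ]
    dsimp only
    rw [div_le_one (by positivity)]
    linarith [Nat.cast_nonneg (α := ℝ) k]
  have hδlim : Tendsto δ atTop (𝓝 0) := tendsto_one_div_add_atTop_nhds_zero_nat
  have hlim : Tendsto (fun k => critNorm g fun x => √(v x ^ 2 + δ k ^ 2)) atTop
      (𝓝 (critNorm g v)) := by
    refine Tendsto.rpow_const ?_ (Or.inr hθ)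
    refine tendsto_integral_of_dominated_convergence
      (fun _ => (√(B ^ 2 + 1)) ^ (2 * (n : ℝ) / ((n : ℝ) - 2))) (fun k =>
      ((contMDiff_sqrt (n := n) hv (hδ0 k)).continuous.abs.rpow_const
        fun _ => Or.inr hq).aestronglyMeasurable)
      (integrable_const _) (fun k => Eventually.of_forall fun x => ?_)
      (Eventually.of_forall fun x => ?_)
    · rw [Real.norm_of_nonneg (Real.rpow_nonneg (abs_nonneg _) _),
        abs_of_nonneg (Real.sqrt_nonneg _)]
      refine Real.rpow_le_rpow (Real.sqrt_nonneg _) (Real.sqrt_le_sqrt (add_le_add ?_ ?_)) hq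
      · rw [← sq_abs]
        exact pow_le_pow_left₀ (abs_nonneg _) (hB x) 2
      · exact pow_le_one₀ (hδ0 k).le (hδ1 k)
    · have h1 : Tendsto (fun k => √(v x ^ 2 + δ k ^ 2)) atTop (𝓝 |v x|) := by
        have h2 := ((hδlim.pow 2).const_add (v x ^ 2)).sqrt
        simpa [Real.sqrt_sq_eq_abs] using h2
      have h3 := h1.abs.rpow_const (p := 2 * (n : ℝ) / ((n : ℝ) - 2)) (Or.inr hq)
      simpa using h3
  have hR : Tendsto (fun k => ∫ x, energyDensity g v x ∂(vol g)
      + δ k ^ 2 * ∫ x, scalarCurvature g x ∂(vol g)) atTop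
      (𝓝 (∫ x, energyDensity g v x ∂(vol g))) := by
    have h1 := ((hδlim.pow 2).mul_const (∫ x, scalarCurvature g x ∂(vol g))).const_add
      (∫ x, energyDensity g v x ∂(vol g))
    simpa using h1
  exact le_of_tendsto_of_tendsto' (hlim.const_mul c) hR fun k =>
    h.mul_critNorm_sqrt_le hn hc hv hvc (hδ0 k)

end LowerBound

/-! ### Freezing a metric near the origin. -/

section Flattening

variable {n : ℕ}

lemma IsInnerForm.segment {B B' : Form n} (h : IsInnerForm B) (h' : IsInnerForm B') {t : ℝ}
    (ht0 : 0 ≤ t) (ht1 : t ≤ 1) : IsInnerForm (B + t • (B' - B)) where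
  symm v w := by
    simp only [add_apply, smul_apply, sub_apply, h.symm v w, h'.symm v w]
  pos v hv := by
    have h1 := h.pos v hv
    have h2 := h'.pos v hv
    simp only [add_apply, smul_apply, sub_apply, smul_eq_mul]
    have : B v v + t * (B' v v - B v v) = (1 - t) * B v v + t * B' v v := by ring
    rw [this]
    rcases ht0.eq_or_lt with rfl | ht
    · simpa using h1
    · have := mul_pos ht h2
      have := mul_nonneg (sub_nonneg.mpr ht1) h1.le
      linarith

lemma scal_const (B : Form n) (y : E n) : scal (fun _ => B) y = 0 := by
  have h1 : chr (fun _ : E n => B) = fun _ => 0 := by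
    ext y v w
    have h2 : kos (fderiv ℝ (fun _ : E n => B) y) v w = 0 := by
      ext z
      rw [kos_apply, (hasFDerivAt_const B y).fderiv]
      simp only [zero_apply]
      norm_num
    rw [chr_apply, h2, map_zero]
    rfl
  rw [scal, h1]
  simp [ric, ricOp, tr]

/-- The conformal law with the constant potential `(log c)/2`, whose derivatives vanish. -/
lemma scal_smul {B : E n → Form n} {y : E n} (hB : ContDiffAt ℝ ∞ B y)
    (h : ∀ᶠ y' in 𝓝 y, IsInnerForm (B y')) {c : ℝ} (hc : 0 < c) :
    scal (fun y => c • B y) y = c⁻¹ * scal B y := by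
  have h1 := scal_confForm hB h (contDiffAt_const (c := Real.log c / 2))
  have h2 : Real.exp (2 * (Real.log c / 2)) = c := by
    rw [mul_div_cancel₀ _ two_ne_zero, Real.exp_log hc]
  have h3 : confForm (fun _ => Real.log c / 2) B = fun y => c • B y := by
    ext1 y
    rw [confForm, h2]
  have h4 : grad B (fun _ => Real.log c / 2) = fun _ => 0 := by
    ext1 y
    simp [grad]
  have h5 : lap B (fun _ => Real.log c / 2) y = 0 := by
    rw [lap, lapOp, h4]
    simp [tr]
  rw [h3, h2, h5, h4] at h1
  rw [h1]
  simp

/-- The metric `G`, made constant on the ball of radius `ε`. -/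
def flat (G : E n → Form n) (ε : ℝ) (x : E n) : Form n :=
  G x + radialCut 1 2 (ε⁻¹ • x) • (G 0 - G x)

/-- The metric `flat G s` in the coordinates `y = x / s`, divided by `s ^ 2`. -/
def flatScaled (G : E n → Form n) (s : ℝ) (y : E n) : Form n :=
  G (s • y) + radialCut 1 2 y • (G 0 - G (s • y))

lemma flat_eq_flatScaled (G : E n → Form n) {ε : ℝ} (hε : ε ≠ 0) (x : E n) :
    flat G ε x = flatScaled G ε (ε⁻¹ • x) := by
  rw [flat, flatScaled, smul_inv_smul₀ hε]

lemma norm_inv_smul {ε : ℝ} (hε : 0 < ε) (x : E n) : ‖ε⁻¹ • x‖ = ‖x‖ / ε := by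
  rw [norm_smul, norm_inv, Real.norm_of_nonneg hε.le, div_eq_inv_mul]

lemma flat_eq_zero {G : E n → Form n} {ε : ℝ} (hε : 0 < ε) {x : E n} (hx : ‖x‖ ≤ ε) :
    flat G ε x = G 0 := by
  rw [flat, radialCut_eq_one zero_le_one one_lt_two, one_smul, add_sub_cancel]
  rw [norm_inv_smul hε, div_le_iff₀ hε, one_mul]
  exact hx

lemma flat_eq_self {G : E n → Form n} {ε : ℝ} (hε : 0 < ε) {x : E n} (hx : 2 * ε ≤ ‖x‖) :
    flat G ε x = G x := by
  rw [flat, radialCut_eq_zero zero_le_one one_lt_two, zero_smul, add_zero]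
  rw [norm_inv_smul hε, le_div_iff₀ hε]
  exact hx

lemma contDiffAt_flat {G : E n → Form n} {ε : ℝ} {x : E n} (hG : ContDiffAt ℝ ∞ G x) :
    ContDiffAt ℝ ∞ (flat G ε) x :=
  hG.add ((((contDiff_radialCut 1 2).comp (contDiff_const_smul ε⁻¹)).contDiffAt).smul
    (contDiffAt_const.sub hG))

/-- The scalar curvature of the flattened metric is `o(ε⁻²)`. -/
lemma eventually_scal_flat_le {G : E n → Form n} {τ : ℝ} (hτ : 0 < τ)
    (hG : ∀ {x : E n}, ‖x‖ < τ → ContDiffAt ℝ ∞ G x)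
    (hi : ∀ {x : E n}, ‖x‖ < τ → IsInnerForm (G x)) {δ : ℝ} (hδ : 0 < δ) :
    ∀ᶠ ε in 𝓝[>] (0 : ℝ), ∀ x : E n, ‖x‖ ≤ 3 * ε → |scal (flat G ε) x| ≤ δ / ε ^ 2 := by
  have h0 : ‖(0 : E n)‖ < τ := by simpa using hτ
  -- The rescaled metrics depend smoothly on `(s, y)` jointly, also at `s = 0`, where the metric is
  -- constant and its scalar curvature vanishes. Compactness of the ball of radius 3 makes the
  -- smallness uniform.
  have h1 : ∀ᶠ s in 𝓝 (0 : ℝ), ∀ y ∈ Metric.closedBall (0 : E n) 3,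
      |scal (flatScaled G s) y| < δ := by
    refine (isCompact_closedBall _ _).eventually_forall_of_forall_eventually fun y _ => ?_
    have h2 : ContDiffAt ℝ ∞ (fun q : ℝ × E n => G (q.1 • q.2)) (0, y) := by
      refine ContDiffAt.comp (g := G) (f := fun q : ℝ × E n => q.1 • q.2) (0, y) ?_
        (contDiffAt_fst.smul contDiffAt_snd)
      simpa using hG h0
    have h3 : ContDiffAt ℝ ∞ (fun q : ℝ × E n => flatScaled G q.1 q.2) (0, y) :=
      h2.add (((contDiff_radialCut 1 2).contDiffAt.comp (0, y) contDiffAt_snd).smul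
        (contDiffAt_const.sub h2))
    have h4 : flatScaled G 0 = fun _ => G 0 := by
      ext1 y
      simp [flatScaled]
    have h5 := (contDiffAt_scal (F := fun s => flatScaled G s) (q := ((0 : ℝ), y)) h3
      (by rw [h4]; exact hi h0)).continuousAt.abs
    have h6 : |scal (flatScaled G 0) y| < δ := by
      rw [h4, scal_const, abs_zero]
      exact hδ
    exact h5.eventually (gt_mem_nhds h6)
  have h7 : ∀ᶠ ε in 𝓝 (0 : ℝ), 3 * ε < τ := by
    have : Tendsto (fun ε : ℝ => 3 * ε) (𝓝 0) (𝓝 0) := by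
      simpa using (tendsto_id (α := ℝ) (x := 𝓝 0)).const_mul 3
    exact this.eventually (gt_mem_nhds hτ)
  filter_upwards [nhdsWithin_le_nhds h1, nhdsWithin_le_nhds h7, self_mem_nhdsWithin]
    with ε hε1 hε2 hε x hx
  have hε : 0 < ε := hε
  have hxτ : ‖x‖ < τ := hx.trans_lt hε2
  have hxs : ε • (ε⁻¹ • x) = x := smul_inv_smul₀ hε.ne' x
  set θ : E n → E n := fun x => ε⁻¹ • x with hθ
  have hθd : ∀ y, HasFDerivAt θ (ε⁻¹ • ContinuousLinearMap.id ℝ (E n)) y := fun y =>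
    (hasFDerivAt_id y).const_smul ε⁻¹
  have hcont : Tendsto (fun y : E n => ε • y) (𝓝 (θ x)) (𝓝 x) := by
    have := (continuous_const_smul ε).tendsto (θ x)
    rwa [hθ, hxs] at this
  have hS : ContDiffAt ℝ ∞ (flatScaled G ε) (θ x) := by
    have h2 : ContDiffAt ℝ ∞ (fun y => G (ε • y)) (θ x) := by
      refine ContDiffAt.comp (g := G) (f := fun y : E n => ε • y) (θ x) ?_
        (contDiff_const_smul ε).contDiffAt
      rw [hθ]
      dsimp only
      rw [hxs]
      exact hG hxτ
    exact h2.add ((contDiff_radialCut 1 2).contDiffAt.smul (contDiffAt_const.sub h2))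
  have hSi : ∀ᶠ y in 𝓝 (θ x), IsInnerForm (flatScaled G ε y) := by
    filter_upwards [hcont.norm.eventually (gt_mem_nhds hxτ)] with y hy
    exact (hi hy).segment (hi h0) (radialCut_nonneg _ _ _) (radialCut_le_one _ _ _)
  -- The flattened metric is the pull-back of `ε²` times the rescaled one under `x ↦ x/ε`. The
  -- factor `ε²` divides the scalar curvature, which turns `δ` into `δ/ε²`.
  have hpull : scal (flat G ε) x = scal (fun y => ε ^ 2 • flatScaled G ε y) (θ x) := by
    refine scal_pullForm (H := fun y => ε ^ 2 • flatScaled G ε y) (ψ := θ)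
      ((contDiffAt_const (c := ε ^ 2)).smul hS)
      (Eventually.of_forall fun y => (contDiff_const_smul ε⁻¹).contDiffAt)
      (Eventually.of_forall fun y => ?_)
      (hSi.mono fun y hy => isInnerForm_smul hy (by positivity))
      (Eventually.of_forall fun y => ?_)
    · dsimp only
      rw [flat_eq_flatScaled G hε.ne', (hθd y).fderiv]
      change flatScaled G ε (θ y) = _
      generalize flatScaled G ε (θ y) = B
      ext v w
      simp only [pullForm_apply, smul_apply, map_smul, smul_eq_mul, ContinuousLinearMap.id_apply]
      field_simp
    · rw [(hθd y).fderiv]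
      exact (ContinuousLinearEquiv.smulLeft (M₁ := E n) (R₁ := ℝ) (Units.mk0 ε⁻¹ (inv_ne_zero hε.ne'))).bijective
  rw [hpull, scal_smul hS hSi (by positivity), abs_mul, abs_of_pos (by positivity),
    inv_mul_eq_div]
  gcongr
  refine (hε1 (θ x) ?_).le
  rw [mem_closedBall_zero_iff, hθ, norm_inv_smul hε, div_le_iff₀ hε]
  exact hx

/-- Inner products close to a given one are comparable. -/
lemma IsInnerForm.exists_close {B₀ : Form n} (h : IsInnerForm B₀) {δ : ℝ} (hδ : 0 < δ) :
    ∃ η > 0, ∀ B B' : Form n, ‖B - B₀‖ < η → ‖B' - B₀‖ < η →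
      (∀ v, |B' v v - B v v| ≤ δ * B v v) ∧ |dens B' / dens B - 1| ≤ δ := by
  obtain ⟨c, hc, hcb⟩ := h.exists_lower_bound
  have h1 : ContinuousAt (fun q : Form n × Form n => |dens q.2 / dens q.1 - 1|) (B₀, B₀) :=
    ((ContinuousAt.div (f := fun q : Form n × Form n => dens q.2)
      (g := fun q : Form n × Form n => dens q.1) (continuous_dens.comp continuous_snd).continuousAt
      (continuous_dens.comp continuous_fst).continuousAt (dens_pos h).ne').sub
      continuousAt_const).abs
  have h2 : |dens B₀ / dens B₀ - 1| < δ := by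
    rw [div_self (dens_pos h).ne', sub_self, abs_zero]
    exact hδ
  obtain ⟨η, hη, hηb⟩ := Metric.eventually_nhds_iff.mp (h1.eventually (gt_mem_nhds h2))
  -- With `c` the lower bound of `B₀`: distance `c/2` gives `B ≥ (c/2)|v|²`, and distances `δc/4`
  -- for both forms give a difference of at most `(δc/2)|v|²`, which is at most `δ B(v, v)`.
  refine ⟨min η (min (c / 2) (δ * c / 4)), by positivity, fun B B' hB hB' => ⟨fun v => ?_, ?_⟩⟩
  · have hform : ∀ B : Form n, |B v v| ≤ ‖B‖ * ‖v‖ ^ 2 := fun B => by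
      rw [sq, ← mul_assoc]
      exact B.le_opNorm₂ v v
    have hB1 : ‖B - B₀‖ ≤ c / 2 := hB.le.trans ((min_le_right _ _).trans (min_le_left _ _))
    have hB2 : ‖B - B₀‖ ≤ δ * c / 4 := hB.le.trans ((min_le_right _ _).trans (min_le_right _ _))
    have hB3 : ‖B' - B₀‖ ≤ δ * c / 4 := hB'.le.trans ((min_le_right _ _).trans (min_le_right _ _))
    have hv := sq_nonneg ‖v‖
    have e1 := (hform (B - B₀)).trans (mul_le_mul_of_nonneg_right hB1 hv)
    have e2 := (hform (B - B₀)).trans (mul_le_mul_of_nonneg_right hB2 hv)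
    have e3 := (hform (B' - B₀)).trans (mul_le_mul_of_nonneg_right hB3 hv)
    simp only [sub_apply] at e1 e2 e3
    have h3 : c / 2 * ‖v‖ ^ 2 ≤ B v v := by
      have := hcb v
      have := (abs_le.mp e1).1
      linarith
    have h4 : |B' v v - B v v| ≤ δ * c / 2 * ‖v‖ ^ 2 := by
      have : B' v v - B v v = (B' v v - B₀ v v) - (B v v - B₀ v v) := by ring
      rw [this]
      refine (abs_sub _ _).trans ?_
      linarith
    refine h4.trans ?_
    calc δ * c / 2 * ‖v‖ ^ 2 = δ * (c / 2 * ‖v‖ ^ 2) := by ring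
      _ ≤ _ := mul_le_mul_of_nonneg_left h3 hδ.le
  · refine (hηb (y := (B, B')) ?_).le
    rw [Prod.dist_eq, dist_eq_norm, dist_eq_norm]
    exact max_lt (hB.trans_le (min_le_left _ _)) (hB'.trans_le (min_le_left _ _))

end Flattening

/-! ### Orbifold metrics made flat near the singular point. -/

section Orbifold

variable {n : ℕ} {M : Type*} [TopologicalSpace M] {p : M} [ChartedSpace (E n) (Punctured M p)]
  [IsManifold 𝓘(ℝ, E n) ∞ (Punctured M p)] {Γ : Subgroup (E n ≃ₗᵢ[ℝ] E n)} [T2Space M]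
  {u : LocalUniformization Γ p} {g : Metric n (Punctured M p)} {G : E n → Form n}

lemma scalarCurvature_congr {X : Type*} [TopologicalSpace X] [ChartedSpace (E n) X]
    [IsManifold 𝓘(ℝ, E n) ∞ X] {g g' : Metric n X} {m : X}
    (h : ∀ᶠ m' in 𝓝 m, ginner g' m' = ginner g m') :
    scalarCurvature g' m = scalarCurvature g m := by
  have hr := regAt_center (n := n) m
  have h1 := hr.scalarCurvature_eq g
  have h2 := hr.scalarCurvature_eq g'
  rw [eq_chart_symm] at h1 h2
  rw [h1, h2]
  refine scal_congr ?_
  have h3 := hr.contMDiffAt.continuousAt.tendsto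
  rw [eq_chart_symm] at h3
  filter_upwards [h3.eventually h] with y hy
  rw [pform, pform, hy]

/-- An orbifold metric can be made flat near the singular point with little effect on the Yamabe
functional. -/
lemma OrbForm.exists_flattening (h : OrbForm u g G) {δ : ℝ} (hδ : 0 < δ) :
    ∃ (ε : ℝ) (g' : Metric n (Punctured M p)), 0 < ε ∧ 3 * ε ≤ u.τ / 2 ∧ ε ≤ δ ∧
      (∀ x ∈ puncturedBall n ε, pform g' u.lift x = G 0) ∧
      (∀ m v, |ginner g' m v v - ginner g m v v| ≤ δ * ginner g m v v) ∧
      (∀ m, |volRatio g g' m - 1| ≤ δ) ∧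
      (∀ m : Punctured M p, (m : M) ∉ u.nhd (3 * ε) →
        volRatio g g' m = 1 ∧ scalarCurvature g' m = scalarCurvature g m) ∧
      ∀ m : Punctured M p, (m : M) ∈ u.nhd (3 * ε) → |scalarCurvature g' m| ≤ δ / ε ^ 2 := by
  have hτ := u.τ_pos
  have h0 : ‖(0 : E n)‖ < u.τ := by simpa using hτ
  obtain ⟨η, hη, hclose⟩ := (h.isInnerForm h0).exists_close hδ
  obtain ⟨ρ, hρ, hρb⟩ := Metric.eventually_nhds_iff.mp ((h.contDiffAt h0).continuousAt.eventually
    (Metric.ball_mem_nhds (G 0) hη))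
  -- The bound `τ/6` yields `3ε ≤ τ/2`. The bound `ρ/3` keeps the region `|x| ≤ 2ε`, where the
  -- metric is changed, inside the ball on which `G` is `η`-close to `G 0`.
  have hpos : 0 < min δ (min (u.τ / 6) (ρ / 3)) := by positivity
  obtain ⟨ε, hscal, hε, hεs⟩ := ((eventually_scal_flat_le hτ h.contDiffAt h.isInnerForm hδ).and
    (Ioo_mem_nhdsGT hpos)).exists
  have hεδ : ε ≤ δ := hεs.le.trans (min_le_left _ _)
  have hετ : 3 * ε ≤ u.τ / 2 := by
    have : ε ≤ u.τ / 6 := hεs.le.trans ((min_le_right _ _).trans (min_le_left _ _))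
    linarith
  have hερ : 3 * ε ≤ ρ := by
    have : ε ≤ ρ / 3 := hεs.le.trans ((min_le_right _ _).trans (min_le_right _ _))
    linarith
  have h2ε : 2 * ε < u.τ := by linarith
  have hflati : ∀ x ∈ puncturedBall n u.τ, IsInnerForm (flat G ε x) := fun x hx =>
    (h.isInnerForm (mem_puncturedBall.mp hx).1).segment (h.isInnerForm h0) (radialCut_nonneg _ _ _)
      (radialCut_le_one _ _ _)
  obtain ⟨g', hg', hgo⟩ := u.exists_metric_descent g (H := flat G ε) h2ε
    (fun x hx => contDiffAt_flat (h.contDiffAt (mem_puncturedBall.mp hx).1)) hflati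
    (fun γ hγ x hx v w => by
      have h1 := h.inv γ hγ (mem_puncturedBall.mp hx).1 v w
      have h2 := h.inv γ hγ h0 v w
      rw [map_zero] at h2
      simp only [flat, add_apply, smul_apply, sub_apply, h1, h2, ← map_smul, radialCut_smul])
    (fun x hx hx2 => by rw [flat_eq_self hε hx2.le, h.pform_eq hx])
  have hGclose : ∀ x : E n, ‖x‖ ≤ 2 * ε → ‖G x - G 0‖ < η := fun x hx => by
    rw [← dist_eq_norm]
    refine hρb ?_
    rw [dist_zero_right]
    linarith
  have hFclose : ∀ x : E n, ‖x‖ ≤ 2 * ε → ‖flat G ε x - G 0‖ < η := fun x hx => by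
    have e : flat G ε x - G 0 = (1 - radialCut 1 2 (ε⁻¹ • x)) • (G x - G 0) := by
      rw [flat]
      module
    rw [e, norm_smul, Real.norm_of_nonneg (sub_nonneg.mpr (radialCut_le_one _ _ _))]
    refine (mul_le_of_le_one_left (norm_nonneg _) ?_).trans_lt (hGclose x hx)
    linarith [radialCut_nonneg 1 2 (ε⁻¹ • x)]
  refine ⟨ε, g', hε, hετ, hεδ, fun x hx => ?_, fun m v => ?_, fun m => ?_, fun m hm => ?_,
    fun m hm => ?_⟩
  · rw [hg' x (puncturedBall_mono (by linarith) hx),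
      flat_eq_zero hε (mem_puncturedBall.mp hx).1.le]
  · by_cases hm : ∃ x ∈ puncturedBall n u.τ, ‖x‖ ≤ 2 * ε ∧ u.lift x = m
    · obtain ⟨x, hx, hxε, rfl⟩ := hm
      obtain ⟨w, rfl⟩ := (LocalUniformization.regAt_lift hx).bijective.surjective v
      have h1 := (hclose _ _ (hGclose x hxε) (hFclose x hxε)).1 w
      rw [← hg' x hx, ← h.pform_eq hx] at h1
      exact h1
    · rw [hgo m hm, sub_self, abs_zero]
      exact mul_nonneg hδ.le ((isInnerForm_ginner g m).nonneg v)
  · by_cases hm : ∃ x ∈ puncturedBall n u.τ, ‖x‖ ≤ 2 * ε ∧ u.lift x = m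
    · obtain ⟨x, hx, hxε, rfl⟩ := hm
      have h1 := (hclose _ _ (hGclose x hxε) (hFclose x hxε)).2
      rw [← hg' x hx, ← h.pform_eq hx, dens_pform_eq g g', mul_div_cancel_right₀ _
        ((LocalUniformization.regAt_lift hx).dens_pos g).ne'] at h1
      exact h1
    · rw [volRatio, hgo m hm, div_self (dens_pos (isInnerForm_ginner g m)).ne', sub_self, abs_zero]
      exact hδ.le
  -- Curvature depends on the metric near the point, so agreement is used on the open complement of
  -- the closed `2ε`-region, which contains everything outside radius `3ε`.
  · have hm' : m ∈ {m : Punctured M p | ∃ x ∈ puncturedBall n u.τ, ‖x‖ ≤ 2 * ε ∧ u.lift x = m}ᶜ := by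
      rintro ⟨x, hx, hxε, rfl⟩
      exact hm ((LocalUniformization.lift_mem_nhd hx).mpr (by linarith))
    refine ⟨?_, scalarCurvature_congr ?_⟩
    · rw [volRatio, hgo m hm', div_self (dens_pos (isInnerForm_ginner g m)).ne']
    · filter_upwards [(u.isClosed_image_closedBall h2ε).isOpen_compl.mem_nhds hm'] with m' hm''
      exact hgo m' hm''
  · obtain ⟨x, hx, hxε, rfl⟩ := LocalUniformization.mem_nhd_iff.mp hm
    rw [(LocalUniformization.regAt_lift hx).scalarCurvature_eq g']
    have h1 : pform g' u.lift =ᶠ[𝓝 x] flat G ε := by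
      filter_upwards [(isOpen_puncturedBall u.τ).mem_nhds hx] with y hy using hg' y hy
    rw [scal_congr h1]
    exact hscal x hxε.le

end Orbifold

/-- Passing to dual norms reverses inequalities of inner products. With `x`, `x'` the two
representatives of `a`, expand `0 ≤ B'(x - s x', x - s x')` and bound `B'(x, x)` by `s a(x)`. -/
lemma IsInnerForm.sharp_le {n : ℕ} {B B' : Form n} (h : IsInnerForm B) (h' : IsInnerForm B') {s : ℝ}
    (hs : 0 < s) (hle : ∀ v, B' v v ≤ s * B v v) (a : E n →L[ℝ] ℝ) :
    a (sharp B a) ≤ s * a (sharp B' a) := by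
  set x := sharp B a with hx
  set x' := sharp B' a with hx'
  have h1 : B x = a := apply_sharp h a
  have h2 : B' x' = a := apply_sharp h' a
  have h3 := h'.nonneg (x - s • x')
  simp only [map_sub, map_smul, sub_apply, smul_apply, smul_eq_mul, h'.symm x x', h2] at h3
  have h4 := hle x
  rw [h1] at h4
  have h5 : s * a x ≤ s * (s * a x') := by linarith
  exact le_of_mul_le_mul_left h5 hs

/-! ### Comparing the norms of two nearby metrics. -/

section Comparison

variable {n : ℕ} {X : Type*} [TopologicalSpace X] [ChartedSpace (E n) X]
  [IsManifold 𝓘(ℝ, E n) ∞ X] [MeasurableSpace X] [BorelSpace X] [SigmaCompactSpace X]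
  [Nonempty X] [T2Space X] {g g' : Metric n X} {v : X → ℝ}

lemma integrable_of_continuous_hasCompactSupport (g : Metric n X) {F : X → ℝ} (hF : Continuous F)
    (hv : HasCompactSupport v) (h : ∀ x, v x = 0 → F x = 0) : Integrable F (vol g) :=
  hF.integrable_of_hasCompactSupport (HasCompactSupport.intro hv.isCompact fun x hx =>
    h x (image_eq_zero_of_notMem_tsupport hx))

lemma critNorm_nonneg (g : Metric n X) (v : X → ℝ) : 0 ≤ critNorm g v :=
  Real.rpow_nonneg (integral_nonneg fun _ => Real.rpow_nonneg (abs_nonneg _) _) _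

lemma critNorm_exponent_pos (hn : 3 ≤ n) : 0 < 2 * (n : ℝ) / ((n : ℝ) - 2) := by
  have hn3 : (3 : ℝ) ≤ n := by exact_mod_cast hn
  exact div_pos (by linarith) (by linarith)

lemma integrable_critical (hn : 3 ≤ n) (g : Metric n X) (hv : Continuous v)
    (hvc : HasCompactSupport v) :
    Integrable (fun x => |v x| ^ (2 * (n : ℝ) / ((n : ℝ) - 2))) (vol g) :=
  integrable_of_continuous_hasCompactSupport g
    (hv.abs.rpow_const fun _ => Or.inr (critNorm_exponent_pos hn).le) hvc fun x hx => by
      rw [hx, abs_zero, Real.zero_rpow (critNorm_exponent_pos hn).ne']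

/-- Hölder's inequality with exponents `n/(n-2)` and `n/2`. -/
lemma setIntegral_sq_le (hn : 3 ≤ n) (g : Metric n X) (hv : Continuous v)
    (hvc : HasCompactSupport v) {S : Set X} (hS : MeasurableSet S) (hfin : vol g S ≠ ⊤) :
    ∫ x in S, v x ^ 2 ∂(vol g) ≤ critNorm g v * (vol g).real S ^ (2 / (n : ℝ)) := by
  have hn3 : (3 : ℝ) ≤ n := by exact_mod_cast hn
  have hpq : ((n : ℝ) / ((n : ℝ) - 2)).HolderConjugate ((n : ℝ) / 2) := by
    rw [Real.holderConjugate_iff]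
    refine ⟨?_, ?_⟩
    · rw [lt_div_iff₀ (by linarith)]
      linarith
    · rw [inv_div, inv_div]
      field_simp
      ring
  have hind : Measurable (S.indicator fun _ => (1 : ℝ)) := measurable_const.indicator hS
  have hp0 : ENNReal.ofReal ((n : ℝ) / ((n : ℝ) - 2)) ≠ 0 := by
    rw [ne_eq, ENNReal.ofReal_eq_zero, not_le]
    exact hpq.pos
  have hq0 : ENNReal.ofReal ((n : ℝ) / 2) ≠ 0 := by
    rw [ne_eq, ENNReal.ofReal_eq_zero, not_le]
    exact hpq.symm.pos
  have h1 : MemLp (fun x => v x ^ 2) (ENNReal.ofReal ((n : ℝ) / ((n : ℝ) - 2))) (vol g) :=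
    (hv.pow 2).memLp_of_hasCompactSupport (HasCompactSupport.intro hvc.isCompact fun x hx => by
      simp [image_eq_zero_of_notMem_tsupport hx])
  have h2 : MemLp (S.indicator fun _ => (1 : ℝ)) (ENNReal.ofReal ((n : ℝ) / 2)) (vol g) :=
    memLp_indicator_const _ hS 1 (Or.inr hfin)
  have h3 := integral_mul_le_Lp_mul_Lq_of_nonneg hpq
    (Eventually.of_forall fun x => sq_nonneg (v x))
    (Eventually.of_forall fun x => Set.indicator_nonneg (fun _ _ => zero_le_one) x) h1 h2
  have e1 : ∀ x, v x ^ 2 * S.indicator (fun _ => (1 : ℝ)) x = S.indicator (fun x => v x ^ 2) x := by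
    intro x
    by_cases hx : x ∈ S <;> simp [hx]
  have e2 : ∀ x, (v x ^ 2) ^ ((n : ℝ) / ((n : ℝ) - 2)) = |v x| ^ (2 * (n : ℝ) / ((n : ℝ) - 2)) := by
    intro x
    rw [← sq_abs, ← Real.rpow_natCast, ← Real.rpow_mul (abs_nonneg _)]
    congr 1
    push_cast
    ring
  have e3 : ∀ x, (S.indicator (fun _ => (1 : ℝ)) x) ^ ((n : ℝ) / 2) = S.indicator (fun _ => (1 : ℝ)) x := by
    intro x
    by_cases hx : x ∈ S
    · simp [hx]
    · simp [hx, Real.zero_rpow hpq.symm.pos.ne']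
  simp only [e1, e2, e3] at h3
  rw [integral_indicator hS, integral_indicator hS, setIntegral_const, smul_eq_mul, mul_one,
    one_div_div, one_div_div] at h3
  exact h3

lemma integral_sq_le (hn : 3 ≤ n) (g : Metric n X) (hv : Continuous v)
    (hvc : HasCompactSupport v) [IsFiniteMeasure (vol g)] :
    ∫ x, v x ^ 2 ∂(vol g) ≤ critNorm g v * (vol g).real Set.univ ^ (2 / (n : ℝ)) := by
  have := setIntegral_sq_le hn g hv hvc MeasurableSet.univ (measure_ne_top _ _)
  rwa [Measure.restrict_univ] at this

/-- The critical integral changes by a factor between `1 - δ` and `1 + δ`; the outer exponent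
`(n-2)/n` lies in `[0, 1]`, and such a power stays between the same bounds. The estimate is
two-sided because it will be multiplied by a constant of unknown sign. -/
lemma abs_critNorm_sub_le (hn : 3 ≤ n) (hv : Continuous v) (hvc : HasCompactSupport v) {δ : ℝ}
    (hδ1 : δ ≤ 1) (hρ : ∀ x, |volRatio g g' x - 1| ≤ δ) :
    |critNorm g' v - critNorm g v| ≤ δ * critNorm g v := by
  have hn3 : (3 : ℝ) ≤ n := by exact_mod_cast hn
  have hδ : 0 ≤ δ := (abs_nonneg _).trans (hρ (Classical.arbitrary X))
  have hi := integrable_critical hn g hv hvc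
  have hi' : Integrable (fun x => volRatio g g' x * |v x| ^ (2 * (n : ℝ) / ((n : ℝ) - 2))) (vol g) :=
    integrable_of_continuous_hasCompactSupport g ((continuous_volRatio g g').mul
      (hv.abs.rpow_const fun _ => Or.inr (critNorm_exponent_pos hn).le)) hvc fun x hx => by
        rw [hx, abs_zero, Real.zero_rpow (critNorm_exponent_pos hn).ne', mul_zero]
  set N := ∫ x, |v x| ^ (2 * (n : ℝ) / ((n : ℝ) - 2)) ∂(vol g) with hN
  set N' := ∫ x, |v x| ^ (2 * (n : ℝ) / ((n : ℝ) - 2)) ∂(vol g') with hN'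
  have hN0 : 0 ≤ N := integral_nonneg fun _ => Real.rpow_nonneg (abs_nonneg _) _
  have hN'0 : 0 ≤ N' := integral_nonneg fun _ => Real.rpow_nonneg (abs_nonneg _) _
  have hNe : N' = ∫ x, volRatio g g' x * |v x| ^ (2 * (n : ℝ) / ((n : ℝ) - 2)) ∂(vol g) :=
    integral_vol g g' _
  have hup : N' ≤ (1 + δ) * N := by
    rw [hNe, hN, ← integral_const_mul]
    refine integral_mono hi' (hi.const_mul _) fun x => ?_
    exact mul_le_mul_of_nonneg_right (by linarith [(abs_le.mp (hρ x)).2])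
      (Real.rpow_nonneg (abs_nonneg _) _)
  have hlo : (1 - δ) * N ≤ N' := by
    rw [hNe, hN, ← integral_const_mul]
    refine integral_mono (hi.const_mul _) hi' fun x => ?_
    exact mul_le_mul_of_nonneg_right (by linarith [(abs_le.mp (hρ x)).1])
      (Real.rpow_nonneg (abs_nonneg _) _)
  have hθ0 : 0 ≤ ((n : ℝ) - 2) / n := div_nonneg (by linarith) (by linarith)
  have hθ1 : ((n : ℝ) - 2) / n ≤ 1 := by
    rw [div_le_one (by linarith)]
    linarith
  have hNθ : 0 ≤ N ^ (((n : ℝ) - 2) / n) := Real.rpow_nonneg hN0 _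
  have h1 : critNorm g' v ≤ (1 + δ) * critNorm g v := by
    refine (Real.rpow_le_rpow hN'0 hup hθ0).trans ?_
    rw [Real.mul_rpow (by linarith) hN0]
    refine mul_le_mul_of_nonneg_right ?_ hNθ
    have := Real.rpow_le_rpow_of_exponent_le (x := 1 + δ) (by linarith) hθ1
    rwa [Real.rpow_one] at this
  have h2 : (1 - δ) * critNorm g v ≤ critNorm g' v := by
    refine le_trans ?_ (Real.rpow_le_rpow (mul_nonneg (by linarith) hN0) hlo hθ0)
    rw [Real.mul_rpow (by linarith) hN0]
    refine mul_le_mul_of_nonneg_right ?_ hNθ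
    exact Real.self_le_rpow_of_le_one (by linarith) (by linarith) hθ1
  rw [abs_le]
  constructor <;> linarith

lemma gradInner_le {s : ℝ} (hs : 0 < s) {x : X}
    (hle : ∀ w, ginner g' x w w ≤ s * ginner g x w w) (v : X → ℝ) :
    gradInner g v v x ≤ s * gradInner g' v v x :=
  (isInnerForm_ginner g x).sharp_le (isInnerForm_ginner g' x) hs hle _

end Comparison

/-! ### Stability of the lower bound under flattening. -/

section Orbifold

variable {n : ℕ} {M : Type*} [TopologicalSpace M] {p : M} [ChartedSpace (E n) (Punctured M p)]
  [IsManifold 𝓘(ℝ, E n) ∞ (Punctured M p)] {Γ : Subgroup (E n ≃ₗᵢ[ℝ] E n)} [T2Space M]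
  [CompactSpace M] [MeasurableSpace M] [BorelSpace M]
  {u : LocalUniformization Γ p} {g : Metric n (Punctured M p)} {G : E n → Form n}

/-- The energy of a metric that is `δ`-close to `g` and whose curvature differs from that of `g`
only on a set `S`. -/
lemma OrbForm.integral_energyDensity_ge (hn : 3 ≤ n) {g' : Metric n (Punctured M p)}
    {δ K L : ℝ} (hδ : 0 < δ) (hδ1 : δ ≤ 1 / 2) (hK : ∀ m, |scalarCurvature g m| ≤ K)
    {S : Set (Punctured M p)} (hS : MeasurableSet S)
    (hg : ∀ m v, |ginner g' m v v - ginner g m v v| ≤ δ * ginner g m v v)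
    (hρ : ∀ m, |volRatio g g' m - 1| ≤ δ)
    (hout : ∀ m ∉ S, volRatio g g' m = 1 ∧ scalarCurvature g' m = scalarCurvature g m)
    (hin : ∀ m ∈ S, |scalarCurvature g' m| ≤ L)
    [SigmaCompactSpace (Punctured M p)] [Nonempty (Punctured M p)] {v : Punctured M p → ℝ}
    (hv : ContMDiff 𝓘(ℝ, E n) 𝓘(ℝ, ℝ) ∞ v) (hvc : HasCompactSupport v) :
    (1 - 2 * δ) * ∫ x, energyDensity g v x ∂(vol g) - 2 * δ * K * ∫ x, v x ^ 2 ∂(vol g)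
      - (2 * L + K) * ∫ x in S, v x ^ 2 ∂(vol g) ≤ ∫ x, energyDensity g' v x ∂(vol g') := by
  have hn3 : (3 : ℝ) ≤ n := by exact_mod_cast hn
  have hα : 0 ≤ 4 * ((n : ℝ) - 1) / ((n : ℝ) - 2) := div_nonneg (by linarith) (by linarith)
  have hE : Integrable (energyDensity g v) (vol g) :=
    (continuous_energyDensity g hv).integrable_of_hasCompactSupport
      (hasCompactSupport_energyDensity g hvc)
  have hE' : Integrable (fun x => volRatio g g' x * energyDensity g' v x) (vol g) :=
    ((continuous_volRatio g g').mul (continuous_energyDensity g' hv)).integrable_of_hasCompactSupport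
      (hasCompactSupport_energyDensity g' hvc).mul_left
  have hv2 : Integrable (fun x => v x ^ 2) (vol g) :=
    integrable_of_continuous_hasCompactSupport g (hv.continuous.pow 2) hvc fun x hx => by simp [hx]
  have hEv : Integrable (fun x => (1 - 2 * δ) * energyDensity g v x - 2 * δ * K * v x ^ 2) (vol g) :=
    (hE.const_mul _).sub (hv2.const_mul _)
  rw [integral_vol g g', ← integral_indicator hS, ← integral_const_mul, ← integral_const_mul,
    ← integral_const_mul, ← integral_sub (hE.const_mul _) (hv2.const_mul _),
    ← integral_sub hEv ((hv2.indicator hS).const_mul _)]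
  refine integral_mono (hEv.sub ((hv2.indicator hS).const_mul _)) hE' fun m => ?_
  have hρm := abs_le.mp (hρ m)
  have hgr : gradInner g v v m ≤ (1 + δ) * gradInner g' v v m :=
    gradInner_le (by linarith) (fun w => by linarith [(abs_le.mp (hg m w)).2]) v
  have h0 := gradInner_self_nonneg g v m
  have h0' := gradInner_self_nonneg g' v m
  have hvm := sq_nonneg (v m)
  have hKm := abs_le.mp (hK m)
  -- The gradient term loses a factor `1 + δ` from the inverse metric and at most `1 - δ` from the
  -- volume; `(1 - 2δ)(1 + δ) ≤ 1 - δ` absorbs both.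
  have h1 : (1 - 2 * δ) * gradInner g v v m ≤ volRatio g g' m * gradInner g' v v m := by
    have e1 : (1 - 2 * δ) * gradInner g v v m ≤ (1 - 2 * δ) * ((1 + δ) * gradInner g' v v m) :=
      mul_le_mul_of_nonneg_left hgr (by linarith)
    have e2 : (1 - 2 * δ) * (1 + δ) ≤ volRatio g g' m := by nlinarith
    have e3 := mul_le_mul_of_nonneg_right e2 h0'
    linarith
  have h2 := mul_le_mul_of_nonneg_left h1 hα
  have h3 : 2 * δ * (scalarCurvature g m * v m ^ 2) ≥ - (2 * δ * K * v m ^ 2) := by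
    have := mul_le_mul_of_nonneg_right hKm.1 hvm
    have := mul_le_mul_of_nonneg_left this (by linarith : 0 ≤ 2 * δ)
    linarith
  simp only [energyDensity]
  by_cases hm : m ∈ S
  · have hL := abs_le.mp (hin m hm)
    have hL0 : 0 ≤ L := (abs_nonneg _).trans (hin m hm)
    -- The volume ratio is at most `1 + δ ≤ 2`.
    have h4 : -(2 * L) ≤ volRatio g g' m * scalarCurvature g' m := by
      have e1 : |volRatio g g' m * scalarCurvature g' m| ≤ 2 * L := by
        rw [abs_mul, abs_of_pos (volRatio_pos g g' m)]
        exact mul_le_mul (by linarith) (hin m hm) (abs_nonneg _) zero_le_two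
      exact (abs_le.mp e1).1
    have h5 := mul_le_mul_of_nonneg_right h4 hvm
    have h6 := mul_le_mul_of_nonneg_right hKm.2 hvm
    rw [Set.indicator_of_mem hm]
    linarith
  · obtain ⟨e1, e2⟩ := hout m hm
    rw [Set.indicator_of_notMem hm, e2]
    rw [e1] at h2 ⊢
    linarith

/-- Orbifold metrics that are flat near the singular point almost realize the Yamabe constants. -/
lemma OrbForm.exists_flat_lower_bound (hn : 3 ≤ n) (h : OrbForm u g G) {c c' : ℝ} (hcc : c < c')
    (hc : (c' : EReal) ≤ orbYamabeConst (orbConformalClass u g)) :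
    ∃ (ε : ℝ) (g' : Metric n (Punctured M p)), 0 < ε ∧ ε < u.τ ∧
      (∀ x ∈ puncturedBall n ε, pform g' u.lift x = G 0) ∧
      ∀ v : Punctured M p → ℝ, ContMDiff 𝓘(ℝ, E n) 𝓘(ℝ, ℝ) ∞ v → HasCompactSupport v →
        c * critNorm g' v ≤ ∫ x, energyDensity g' v x ∂(vol g') := by
  have := u.sigmaCompactSpace
  have := u.nonempty
  have := h.isFiniteMeasure_vol
  have hn3 : (3 : ℝ) ≤ n := by exact_mod_cast hn
  obtain ⟨K, hK0, hK⟩ := h.exists_bound_scalarCurvature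
  obtain ⟨D, hD0, hD⟩ := h.exists_vol_nhd_le
  set V := (vol g).real Set.univ ^ (2 / (n : ℝ)) with hV
  have hV0 : 0 ≤ V := Real.rpow_nonneg measureReal_nonneg _
  set D' := D ^ (2 / (n : ℝ)) with hD'
  have hD'0 : 0 ≤ D' := Real.rpow_nonneg hD0 _
  -- The constant collects the curvature errors: `2KV` from the total volume and `9 D'(2 + K)` from
  -- the flattened region. Then `δ` is chosen so that the total relative loss `δ(|c| + 2|c'| + C)`
  -- fits into the gap `c' - c`.
  set C := 2 * K * V + 9 * D' * (2 + K) with hC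
  have hC0 : 0 ≤ C := by positivity
  have hden : 0 < |c| + 2 * |c'| + C + 1 := by positivity
  set δ := min (1 / 2) ((c' - c) / (|c| + 2 * |c'| + C + 1)) with hδ
  have hδ0 : 0 < δ := lt_min (by norm_num) (div_pos (by linarith) hden)
  have hδ1 : δ ≤ 1 / 2 := min_le_left _ _
  have hδ2 : δ * (|c| + 2 * |c'| + C + 1) ≤ c' - c := by
    rw [← le_div_iff₀ hden]
    exact min_le_right _ _
  obtain ⟨ε, g', hε, hετ, hεδ, hflat, hg, hρ, hout, hin⟩ := h.exists_flattening hδ0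
  refine ⟨ε, g', hε, by linarith [u.τ_pos], hflat, fun v hv hvc => ?_⟩
  set S : Set (Punctured M p) := {m | (m : M) ∈ u.nhd (3 * ε)} with hS
  have hSm : MeasurableSet S := (u.isOpen_preimage_nhd (3 * ε)).measurableSet
  have hmain := integral_energyDensity_ge hn hδ0 hδ1 hK hSm hg hρ hout hin hv hvc
  have hE := h.mul_critNorm_le hn hc hv hvc
  have hN := critNorm_nonneg g v
  have hN' := abs_le.mp (abs_critNorm_sub_le hn hv.continuous hvc (by linarith) hρ)
  set N := critNorm g v with hNdef
  have hS2 := setIntegral_sq_le hn g hv.continuous hvc hSm (measure_ne_top _ _)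
  have hX2 := integral_sq_le hn g hv.continuous hvc
  have hvolS : (vol g).real S ^ (2 / (n : ℝ)) ≤ D' * (9 * ε ^ 2) := by
    -- The power `2/n` turns the volume `O(ε^n)` into `O(ε²)`, which compensates the curvature bound
    -- `δ/ε²`. The scale invariance of this Hölder estimate is what makes the flattening affordable.
    have h1 : (vol g).real S ≤ D * (3 * ε) ^ n :=
      ENNReal.toReal_le_of_le_ofReal (by positivity) (hD (3 * ε) (by positivity) hετ)
    refine (Real.rpow_le_rpow measureReal_nonneg h1 (by positivity)).trans_eq ?_
    rw [Real.mul_rpow hD0 (by positivity), ← Real.rpow_natCast, ← Real.rpow_mul (by positivity),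
      show (n : ℝ) * (2 / n) = 2 by field_simp, Real.rpow_two]
    ring
  have e1 : (2 * (δ / ε ^ 2) + K) * ∫ x in S, v x ^ 2 ∂(vol g) ≤ N * (9 * D' * (2 + K) * δ) := by
    have h1 : ∫ x in S, v x ^ 2 ∂(vol g) ≤ N * (D' * (9 * ε ^ 2)) :=
      hS2.trans (mul_le_mul_of_nonneg_left hvolS hN)
    refine (mul_le_mul_of_nonneg_left h1 (by positivity)).trans ?_
    have h2 : (2 * (δ / ε ^ 2) + K) * (N * (D' * (9 * ε ^ 2)))
        = N * (9 * D' * (2 * δ + K * ε ^ 2)) := by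
      field_simp
    rw [h2]
    refine mul_le_mul_of_nonneg_left ?_ hN
    rw [mul_assoc (9 * D')]
    refine mul_le_mul_of_nonneg_left ?_ (by positivity)
    have h3 : ε ^ 2 ≤ δ := by nlinarith
    nlinarith [mul_le_mul_of_nonneg_left h3 hK0]
  have e2 : 2 * δ * K * ∫ x, v x ^ 2 ∂(vol g) ≤ N * (2 * K * V * δ) := by
    refine (mul_le_mul_of_nonneg_left hX2 (by positivity)).trans_eq ?_
    ring
  have e3 : (1 - 2 * δ) * (c' * N) ≤ (1 - 2 * δ) * ∫ x, energyDensity g v x ∂(vol g) :=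
    mul_le_mul_of_nonneg_left hE (by linarith)
  have e4 : c * critNorm g' v ≤ c * N + |c| * (δ * N) := by
    have h1 : c * (critNorm g' v - N) ≤ |c| * (δ * N) := by
      refine (le_abs_self _).trans ?_
      rw [abs_mul]
      exact mul_le_mul_of_nonneg_left (abs_le.mpr hN') (abs_nonneg _)
    linarith
  have e5 : c + |c| * δ ≤ (1 - 2 * δ) * c' - C * δ := by
    have := mul_le_mul_of_nonneg_left (le_abs_self c') hδ0.le
    nlinarith
  have e6 := mul_le_mul_of_nonneg_left e5 hN
  rw [hC] at e6
  linarith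

end Orbifold

/-! ### The invariant square root of an inner product. -/

section SquareRoot

variable {n : ℕ}

/-- An inner product is the pull-back of the Euclidean one by a symmetric linear map that commutes
with all isometries preserving the inner product. -/
lemma IsInnerForm.exists_sqrt {B : Form n} (hB : IsInnerForm B) :
    ∃ T : E n ≃L[ℝ] E n, (∀ v w, inner ℝ (T v) (T w) = B v w) ∧
      ∀ γ : E n ≃ₗᵢ[ℝ] E n, (∀ v w, B (γ v) (γ w) = B v w) → ∀ v, T (γ v) = γ (T v) := by
  set S : E n →ₗ[ℝ] E n :=
    { toFun := fun v => (InnerProductSpace.toDual ℝ (E n)).symm (B v)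
      map_add' := fun v w => by rw [map_add, map_add]
      map_smul' := fun c v => by simp } with hS
  have hSB : ∀ v w, inner ℝ (S v) w = B v w := fun v w =>
    InnerProductSpace.toDual_symm_apply (𝕜 := ℝ) (x := w) (y := B v)
  have hsymm : S.IsSymmetric := fun v w => by
    rw [hSB, real_inner_comm, hSB, hB.symm]
  clear_value S
  obtain ⟨b, l, hSb⟩ : ∃ (b : OrthonormalBasis (Fin n) ℝ (E n)) (l : Fin n → ℝ),
      ∀ i, S (b i) = l i • b i :=
    ⟨_, _, fun i => hsymm.apply_eigenvectorBasis finrank_euclideanSpace_fin i⟩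
  have hl0 : ∀ i, 0 < l i := by
    intro i
    have h1 := hB.pos (b i) (b.orthonormal.ne_zero i)
    rwa [← hSB, hSb, inner_smul_left, real_inner_self_eq_norm_sq, b.orthonormal.1 i,
      one_pow, mul_one] at h1
  set T : E n →ₗ[ℝ] E n :=
    { toFun := fun v => ∑ i, (√(l i) * inner ℝ (b i) v) • b i
      map_add' := fun v w => by
        simp only [inner_add_right, mul_add, add_smul, Finset.sum_add_distrib]
      map_smul' := fun c v => by
        simp only [inner_smul_right, Finset.smul_sum, smul_smul, RingHom.id_apply]
        exact Finset.sum_congr rfl fun i _ => by rw [mul_left_comm] }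
    with hT
  have hTi : ∀ i v, inner ℝ (b i) (T v) = √(l i) * inner ℝ (b i) v := fun i v =>
    b.orthonormal.inner_right_fintype (fun i => √(l i) * inner ℝ (b i) v) i
  have hTT : ∀ v w, inner ℝ (T v) (T w) = B v w := by
    intro v w
    rw [← b.sum_inner_mul_inner (T v) (T w), ← hSB, ← b.sum_inner_mul_inner (S v) w]
    refine Finset.sum_congr rfl fun i _ => ?_
    have h1 : inner ℝ (S v) (b i) = l i * inner ℝ (b i) v := by
      rw [hsymm, hSb, inner_smul_right, real_inner_comm]
    rw [real_inner_comm, hTi, hTi, h1]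
    linear_combination (inner ℝ (b i) v * inner ℝ (b i) w) * Real.mul_self_sqrt (hl0 i).le
  have hinj : Function.Injective T := by
    rw [injective_iff_map_eq_zero]
    intro v hv
    by_contra h0
    have h1 := hB.pos v h0
    rw [← hTT, hv, inner_zero_left] at h1
    exact h1.false
  refine ⟨(LinearEquiv.ofInjectiveEndo T hinj).toContinuousLinearEquiv, hTT, fun γ hγ v => ?_⟩
  change T (γ v) = γ (T v)
  have hSγ : ∀ v, S (γ v) = γ (S v) := fun v => by
    refine ext_inner_right ℝ fun w => ?_
    obtain ⟨w, rfl⟩ := γ.surjective w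
    rw [γ.inner_map_map, hSB, hSB, hγ]
  -- The map `T` acts as `√μ` on the whole `μ`-eigenspace of `S`, not only on the chosen basis. As
  -- `S` commutes with `γ`, the vector `γ (b i)` is again an eigenvector, and `T` commutes with `γ`
  -- on the basis.
  have heig : ∀ (μ : ℝ) (v : E n), S v = μ • v → T v = √μ • v := by
    intro μ v hv
    refine b.repr.injective ?_
    ext i
    rw [b.repr_apply_apply, b.repr_apply_apply, hTi, inner_smul_right]
    have h1 : l i * inner ℝ (b i) v = μ * inner ℝ (b i) v := by
      rw [← inner_smul_right (b i) v μ, ← hv, ← hsymm, hSb, inner_smul_left]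
      rfl
    by_cases h0 : inner ℝ (b i) v = 0
    · rw [h0, mul_zero, mul_zero]
    · rw [mul_right_cancel₀ h0 h1]
  have h1 : T ∘ₗ (γ.toLinearEquiv : E n →ₗ[ℝ] E n) = (γ.toLinearEquiv : E n →ₗ[ℝ] E n) ∘ₗ T := by
    refine b.toBasis.ext fun i => ?_
    rw [OrthonormalBasis.coe_toBasis]
    change T (γ (b i)) = γ (T (b i))
    rw [heig _ _ (hSb i), map_smul, heig (l i)]
    rw [hSγ, hSb, map_smul]
  exact LinearMap.congr_fun h1 v

end SquareRoot

/-! ### Equivariant linear changes of a uniformization. -/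

section Reparametrization

variable {n : ℕ} {M : Type*} [TopologicalSpace M] {p : M} [ChartedSpace (E n) (Punctured M p)]
  {Γ : Subgroup (E n ≃ₗᵢ[ℝ] E n)}

/-- The homeomorphism of the orbit space induced by an equivariant linear automorphism. -/
def orbitHomeomorph (T : E n ≃L[ℝ] E n) (hT : ∀ γ ∈ Γ, ∀ v, T (γ v) = γ (T v)) :
    OrbitSpace Γ ≃ₜ OrbitSpace Γ :=
  Homeomorph.Quotient.congr T.toHomeomorph fun x y => by
    constructor
    · rintro ⟨γ, hγ, rfl⟩
      exact ⟨γ, hγ, (hT γ hγ x).symm⟩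
    · rintro ⟨γ, hγ, h⟩
      refine ⟨γ, hγ, T.injective ?_⟩
      rw [hT γ hγ]
      exact h

lemma orbitHomeomorph_proj (T : E n ≃L[ℝ] E n) (hT : ∀ γ ∈ Γ, ∀ v, T (γ v) = γ (T v)) (x : E n) :
    orbitHomeomorph T hT (proj Γ x) = proj Γ (T x) := rfl

lemma orbitHomeomorph_symm_proj (T : E n ≃L[ℝ] E n) (hT : ∀ γ ∈ Γ, ∀ v, T (γ v) = γ (T v))
    (x : E n) : (orbitHomeomorph T hT).symm (proj Γ x) = proj Γ (T.symm x) := rfl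

/-- The local uniformization obtained from `u` by an equivariant linear change of coordinates,
restricted to the unit ball. -/
def LocalUniformization.reparam (u : LocalUniformization Γ p) (T : E n ≃L[ℝ] E n)
    (hT : ∀ γ ∈ Γ, ∀ v, T (γ v) = γ (T v)) (h : ∀ x, ‖T x‖ < 1 → ‖x‖ < u.τ) :
    LocalUniformization Γ p where
  φ := ((u.φ.transHomeomorph (orbitHomeomorph T hT)).symm.restrOpen (proj Γ '' Metric.ball 0 1)
    (isOpenMap_proj _ Metric.isOpen_ball)).symm
  τ := 1
  τ_pos := one_pos
  target_eq := by
    change (orbitHomeomorph T hT).symm ⁻¹' u.φ.target ∩ proj Γ '' Metric.ball 0 1 = _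
    refine Set.inter_eq_right.mpr ?_
    rintro _ ⟨x, hx, rfl⟩
    rw [Set.mem_preimage, orbitHomeomorph_symm_proj, u.proj_mem_target]
    refine h _ ?_
    rw [T.apply_symm_apply]
    simpa using hx
  mem_source := by
    rw [OpenPartialHomeomorph.symm_source]
    have h0 : proj Γ 0 ∈ ((u.φ.transHomeomorph (orbitHomeomorph T hT)).symm.restrOpen
        (proj Γ '' Metric.ball 0 1) (isOpenMap_proj _ Metric.isOpen_ball)).source := by
      refine ⟨?_, mem_image_proj_ball.mpr (by simp)⟩
      change (orbitHomeomorph T hT).symm (proj Γ 0) ∈ u.φ.target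
      rw [orbitHomeomorph_symm_proj, u.proj_mem_target, map_zero, norm_zero]
      exact u.τ_pos
    have h1 := OpenPartialHomeomorph.map_source _ h0
    have h2 : u.φ.symm ((orbitHomeomorph T hT).symm (proj Γ 0)) = p := by
      rw [orbitHomeomorph_symm_proj, map_zero, u.symm_proj_zero]
    change u.φ.symm ((orbitHomeomorph T hT).symm (proj Γ 0)) ∈ _ at h1
    rwa [h2] at h1
  map_singular := by
    change orbitHomeomorph T hT (u.φ p) = _
    rw [u.map_singular, orbitHomeomorph_proj, map_zero]
  lift := u.lift ∘ T.symm
  lift_eq := fun x hx => by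
    have hx' := mem_puncturedBall.mp hx
    change _ = u.φ.symm ((orbitHomeomorph T hT).symm (proj Γ x))
    rw [orbitHomeomorph_symm_proj, Function.comp_apply, u.lift_eq _ (mem_puncturedBall.mpr
      ⟨h _ (by rw [T.apply_symm_apply]; exact hx'.1), by simpa using hx'.2⟩)]
  isLocalDiffeo := by
    rintro ⟨x, hx⟩
    have hx' := mem_puncturedBall.mp hx
    refine (T.symm.toDiffeomorph.isLocalDiffeomorph x).comp _ _ (u.isLocalDiffeo ⟨T.symm x,
      mem_puncturedBall.mpr ⟨h _ (by rw [T.apply_symm_apply]; exact hx'.1), by simpa using hx'.2⟩⟩)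

variable (u : LocalUniformization Γ p) (T : E n ≃L[ℝ] E n)
  (hT : ∀ γ ∈ Γ, ∀ v, T (γ v) = γ (T v)) (h : ∀ x, ‖T x‖ < 1 → ‖x‖ < u.τ)

lemma LocalUniformization.reparam_source_subset : (u.reparam T hT h).φ.source ⊆ u.φ.source := by
  intro m hm
  have h1 := (u.reparam T hT h).φ.map_source hm
  have h2 := (u.reparam T hT h).φ.left_inv hm
  rw [(u.reparam T hT h).target_eq] at h1
  obtain ⟨x, hx, hxm⟩ := h1
  rw [← hxm] at h2
  have h3 : u.φ.symm (proj Γ (T.symm x)) = m := h2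
  rw [← h3]
  refine u.φ.map_target (u.proj_mem_target.mpr (h _ ?_))
  rw [T.apply_symm_apply]
  simpa [reparam] using hx

lemma LocalUniformization.compatible_reparam : Compatible u (u.reparam T hT h) := by
  -- On a ball of radius `1/(‖T‖ + 1)` the linear map takes values in the unit ball; the summand 1
  -- avoids division by zero.
  have hr : 0 < min u.τ (1 / (‖(T : E n →L[ℝ] E n)‖ + 1)) :=
    lt_min u.τ_pos (by positivity)
  refine ⟨min u.τ (1 / (‖(T : E n →L[ℝ] E n)‖ + 1)), T, hr, min_le_left _ _,
    T.contDiff.contDiffOn, T.injective.injOn, fun x hx => ?_, fun x _ => ?_,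
    fun γ hγ x _ => hT γ hγ x, fun x _ => ?_⟩
  · have hx1 : ‖x‖ < 1 / (‖(T : E n →L[ℝ] E n)‖ + 1) :=
      (mem_ball_zero_iff.mp hx).trans_le (min_le_right _ _)
    rw [lt_div_iff₀ (by positivity)] at hx1
    have h1 := (T : E n →L[ℝ] E n).le_opNorm x
    rw [mem_ball_zero_iff]
    change ‖T x‖ < 1
    have h2 : ‖T x‖ ≤ ‖(T : E n →L[ℝ] E n)‖ * ‖x‖ := h1
    nlinarith [norm_nonneg x]
  · rw [T.fderiv]
    exact T.bijective
  · change _ = u.φ.symm ((orbitHomeomorph T hT).symm (proj Γ (T x)))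
    rw [orbitHomeomorph_symm_proj, T.symm_apply_apply]

end Reparametrization

/-! ### From flat orbifold metrics to cylindrical metrics. -/

section Orbifold

variable {n : ℕ} {M : Type*} [TopologicalSpace M] {p : M} [ChartedSpace (E n) (Punctured M p)]
  [IsManifold 𝓘(ℝ, E n) ∞ (Punctured M p)] {Γ : Subgroup (E n ≃ₗᵢ[ℝ] E n)} [T2Space M]
  {u : LocalUniformization Γ p}

/-- A metric with constant coefficients near the singular point is conformal to a cylindrical
metric. -/
lemma exists_cylindrical_of_flat {g : Metric n (Punctured M p)} {B : Form n} (hB : IsInnerForm B)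
    (hBi : ∀ γ ∈ Γ, ∀ v w, B (γ v) (γ w) = B v w) {ε : ℝ} (hε : 0 < ε) (hετ : ε ≤ u.τ)
    (hflat : ∀ x ∈ puncturedBall n ε, pform g u.lift x = B) :
    ∃ (f : Punctured M p → ℝ) (hf : ContMDiff 𝓘(ℝ, E n) 𝓘(ℝ, ℝ) ∞ f),
      IsCylindricalMetric u (confMetric f hf g) := by
  obtain ⟨T₀, hT₀, hT₀γ⟩ := hB.exists_sqrt
  -- The dilation is large enough that the preimage of the unit ball under `s T₀` lies in the ball
  -- of radius `ε`, where the metric is constant.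
  set s : ℝ := (‖(T₀.symm : E n →L[ℝ] E n)‖ + 1) / ε with hs
  have hs0 : 0 < s := by positivity
  set T : E n ≃L[ℝ] E n := T₀.trans (ContinuousLinearEquiv.smulLeft (Units.mk0 s hs0.ne')) with hTdef
  have hTx : ∀ x, T x = s • T₀ x := fun x => rfl
  have hT : ∀ γ ∈ Γ, ∀ v, T (γ v) = γ (T v) := fun γ hγ v => by
    rw [hTx, hTx, hT₀γ γ (hBi γ hγ), map_smul]
  have hTT : ∀ v w, inner ℝ (T v) (T w) = s ^ 2 * B v w := fun v w => by
    rw [hTx, hTx, inner_smul_left, inner_smul_right, hT₀, RCLike.conj_to_real]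
    ring
  have hTε : ∀ x, ‖T x‖ < 1 → ‖x‖ < ε := by
    intro x hx
    rw [hTx, norm_smul, Real.norm_of_nonneg hs0.le] at hx
    have h1 : ‖x‖ ≤ ‖(T₀.symm : E n →L[ℝ] E n)‖ * ‖T₀ x‖ := by
      have := (T₀.symm : E n →L[ℝ] E n).le_opNorm (T₀ x)
      simpa using this
    have h2 : ε * s = ‖(T₀.symm : E n →L[ℝ] E n)‖ + 1 := by
      rw [hs]
      field_simp
    have h3 : ε * (s * ‖T₀ x‖) < ε * 1 := mul_lt_mul_of_pos_left hx hε
    rw [← mul_assoc, h2] at h3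
    nlinarith [norm_nonneg (T₀ x)]
  set u' := u.reparam T hT fun x hx => (hTε x hx).trans_le hετ with hu'
  have hτ : u'.τ = 1 := rfl
  have he : Real.exp (-1) < 1 / 2 := by
    rw [Real.exp_neg, one_div]
    have := Real.add_one_lt_exp (one_ne_zero)
    exact inv_strictAnti₀ two_pos (by linarith)
  have he0 := (Real.exp_pos (-1)).le
  -- In the new coordinates the metric is `s^{-2}` times the Euclidean one, so the factor needed for
  -- the cylinder is `e^{2F} = s²/|x|²`.
  set F : E n → ℝ := fun x =>
    radialCut (Real.exp (-1)) (1 / 2) x * (Real.log s - Real.log ‖x‖) with hF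
  obtain ⟨f, hf, hfl, -⟩ := u'.exists_descent (F := F) (r := 1 / 2) (c := 0) (by rw [hτ]; norm_num)
    (fun x hx => (contDiff_radialCut _ _).contDiffAt.mul (contDiffAt_const.sub
      ((contDiffAt_norm ℝ (mem_puncturedBall.mp hx).2).log
        (norm_ne_zero_iff.mpr (mem_puncturedBall.mp hx).2))))
    (fun γ _ x _ => by simp only [hF, radialCut_smul, γ.norm_map])
    (fun x _ hx => by simp only [hF, radialCut_eq_zero he0 he hx.le, zero_mul])
  refine ⟨f, hf, u', hτ, u.reparam_source_subset T hT _, u.compatible_reparam T hT _, ?_⟩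
  rw [cylinder_iff _ fun x hx => (LocalUniformization.regAt_lift (u := u')
    hx).contMDiffAt.mdifferentiableAt (by simp)]
  intro x hx0 hx
  have hx1 : ‖x‖ < 1 := by linarith
  have hxp : x ∈ puncturedBall n u'.τ := mem_puncturedBall.mpr ⟨hx1, hx0⟩
  have hxε : T.symm x ∈ puncturedBall n ε :=
    mem_puncturedBall.mpr ⟨hTε _ (by rwa [T.apply_symm_apply]), by simpa using hx0⟩
  have hnorm : 0 < ‖x‖ := norm_pos_iff.mpr hx0
  rw [pform_confMetric, confForm, Function.comp_apply, hfl x hxp, hF]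
  simp only [radialCut_eq_one he0 he hx, one_mul]
  have h1 : pform g u'.lift x = pullForm B (T.symm : E n →L[ℝ] E n) := by
    rw [pform_comp g (ψ := u'.lift) (ξ := u.lift) (θ := T.symm) (Eventually.of_forall fun _ => rfl)
      ((LocalUniformization.regAt_lift (puncturedBall_mono hετ hxε)).contMDiffAt.mdifferentiableAt
        (by simp)) T.symm.differentiable.differentiableAt, hflat _ hxε, T.symm.fderiv]
  rw [h1]
  ext v w
  have h2 := hTT (T.symm v) (T.symm w)
  rw [T.apply_symm_apply, T.apply_symm_apply] at h2
  simp only [smul_apply, pullForm_apply, eucl_apply, smul_eq_mul, h2,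
    ContinuousLinearEquiv.coe_coe]
  rw [two_mul, Real.exp_add, Real.exp_sub, Real.exp_log hs0, Real.exp_log hnorm]
  field_simp

variable [CompactSpace M] [MeasurableSpace M] [BorelSpace M]

/-- Multiplying by the weight preserves compact support and does not create new zeros. A lower bound
for all compactly supported functions therefore passes to every conformal metric, with no condition
on `f` near the singular point. -/
lemma le_cylYamabeConst_confMetric {X : Type*} [TopologicalSpace X] [ChartedSpace (E n) X]
    [IsManifold 𝓘(ℝ, E n) ∞ X] [MeasurableSpace X] [BorelSpace X] [SigmaCompactSpace X]
    [Nonempty X] [T2Space X] (hn : 3 ≤ n) {g : Metric n X} {f : X → ℝ}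
    (hf : ContMDiff 𝓘(ℝ, E n) 𝓘(ℝ, ℝ) ∞ f) {c : ℝ}
    (hc : ∀ v : X → ℝ, ContMDiff 𝓘(ℝ, E n) 𝓘(ℝ, ℝ) ∞ v → HasCompactSupport v →
      c * critNorm g v ≤ ∫ x, energyDensity g v x ∂(vol g)) :
    (c : EReal) ≤ cylYamabeConst (confMetric f hf g) := by
  refine le_iInf₂ fun v ⟨hv, hvc, hv0⟩ => ?_
  rw [EReal.coe_le_coe_iff, yamabeQ_confMetric hn g hf hv (Or.inl hvc)]
  set w : X → ℝ := fun x => weight n f x * v x with hw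
  have hwm : ContMDiff 𝓘(ℝ, E n) 𝓘(ℝ, ℝ) ∞ w := (contMDiff_weight hf).mul hv
  have hwc : HasCompactSupport w := hvc.mul_left
  obtain ⟨x₀, hx₀⟩ := Function.ne_iff.mp hv0
  have hwx : w x₀ ≠ 0 := mul_ne_zero (weight_pos f x₀).ne' hx₀
  have hN : 0 < ∫ x, |w x| ^ (2 * (n : ℝ) / ((n : ℝ) - 2)) ∂(vol g) :=
    integral_pos_of_integrable_nonneg_nonzero (x := x₀)
      (hwm.continuous.abs.rpow_const fun _ => Or.inr (critNorm_exponent_pos hn).le)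
      (integrable_critical hn g hwm.continuous hwc) (fun x => Real.rpow_nonneg (abs_nonneg _) _)
      (Real.rpow_pos_of_pos (abs_pos.mpr hwx) _).ne'
  rw [yamabeQ_eq g hwm, le_div_iff₀ (Real.rpow_pos_of_pos hN _)]
  exact hc w hwm hwc

theorem orbYamabeInvariant_le_cylYamabeInvariant (hn : 3 ≤ n) (u : LocalUniformization Γ p) :
    orbYamabeInvariant u ≤ cylYamabeInvariant u := by
  have := u.sigmaCompactSpace
  have := u.nonempty
  refine iSup₂_le fun C hC => ?_
  obtain ⟨g, hg, rfl⟩ := hC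
  obtain ⟨G, hG⟩ := isOrbifoldMetric_iff.mp hg
  refine le_of_forall_lt fun a ha => ?_
  -- Two real numbers are inserted below the Yamabe constant: the gap between `c` and `c'` pays for
  -- the flattening.
  obtain ⟨c, hac, hc⟩ := EReal.lt_iff_exists_real_btwn.mp ha
  obtain ⟨c', hcc', hc'⟩ := EReal.lt_iff_exists_real_btwn.mp hc
  obtain ⟨ε, g', hε, hετ, hflat, hlow⟩ :=
    hG.exists_flat_lower_bound hn (EReal.coe_lt_coe_iff.mp hcc') hc'.le
  have h0 : ‖(0 : E n)‖ < u.τ := by simpa using u.τ_pos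
  obtain ⟨f, hf, hcyl⟩ := exists_cylindrical_of_flat (hG.isInnerForm h0) (fun γ hγ v w => by
    have := hG.inv γ hγ h0 v w
    rwa [map_zero] at this) hε hετ.le hflat
  exact hac.trans_le ((le_cylYamabeConst_confMetric hn hf hlow).trans
    (le_iSup₂ (f := fun g (_ : g ∈ {g : Metric n (Punctured M p) | IsCylindricalMetric u g}) =>
      cylYamabeConst g) _ hcyl))

end Orbifold

end OrbifoldYamabe

end

theorem theorem2p1 {n : ℕ} (hn : 3 ≤ n)
    {M : Type*} [TopologicalSpace M] [T2Space M] [CompactSpace M]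
    [MeasurableSpace M] [BorelSpace M]
    (p : M) [ChartedSpace (OrbifoldYamabe.E n) (OrbifoldYamabe.Punctured M p)]
    [IsManifold 𝓘(ℝ, OrbifoldYamabe.E n) ∞ (OrbifoldYamabe.Punctured M p)]
    (Γ : Subgroup (OrbifoldYamabe.E n ≃ₗᵢ[ℝ] OrbifoldYamabe.E n))
    (hΓ : OrbifoldYamabe.IsStructureGroup Γ)
    (u : OrbifoldYamabe.LocalUniformization Γ p) :
    OrbifoldYamabe.orbYamabeInvariant u = OrbifoldYamabe.cylYamabeInvariant u := by
  exact le_antisymm (OrbifoldYamabe.orbYamabeInvariant_le_cylYamabeInvariant hn u)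
    (OrbifoldYamabe.cylYamabeInvariant_le_orbYamabeInvariant hn hΓ u)
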